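/- Conventions. A rational function in $x_1,\dots,x_m$ over $\mathbb{Q}$ is expanded as a Laurent series according to $1>x_1>x_2>\cdots>x_m>0$ (so, for $i<j$, $\frac1{1-x_i}=\sum_{k\ge0}x_i^k$ and $\frac1{x_i-x_j}=x_i^{-1}\sum_{k\ge0}(x_j/x_i)^k$), and $\mathrm{CT}$ denotes the constant term of this expansion with respect to all variables. For nonnegative integers $m,k_1,k_2,k_3$ let $$M(m;k_1,k_2,k_3)=\frac{1}{\prod_{i=1}^m x_i^{k_1-1}\prod_{i=1}^m(1-x_i)^{k_2}\prod_{1\le i<j\le m}(x_i-x_j)^{k_3}},\qquad M(0;k_1,k_2,k_3)=1.$$ For $n\ge2$ and a nonnegative integer $t$, let $(m_1,\dots,m_n)=(2,1,\dots,1,0)$ (with $n-2$ entries equal to $1$) and $$\mathcal H=\prod_{i=1}^n\frac{x_i^{(m_i-1)t}}{\prod_{j\ne i}(1-x_j/x_i)^{m_i}},\qquad h_n(t)=(-1)^{\frac{(n-1)(n-2)}2}\,\mathrm{CT}\,\mathcal H .$$ Theorem. Let $n\ge 2$ and $N=\lfloor (n-1)^2/4\rfloor$. Then, for every integer $t\ge0$,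 $$h_n(t)=\mathrm{CT}\,\bar{\mathcal H}_n,\qquad \bar{\mathcal H}_n=\frac{(1-x_n)\prod_{i=2}^{n-1}x_i^{n-1}\prod_{i=2}^{n-1}(x_i-x_n)}{x_n^t\prod_{i=2}^n(1-x_i)^3\prod_{2\le i<j\le n}(x_i-x_j)^2},$$ and: 1. $h_n(t)$, $t=0,1,2,\dots$, is given by a polynomial in $t$ with rational coefficients, of degree $(n-1)^2$ and with leading coefficient $\frac{1}{((n-1)^2)!}\,\mathrm{CT}\,M(n-1;1,1,2)$. In the following parts $h_n$ denotes this polynomial. 2. $h_n(t)=(-1)^{n-1}h_n(-t-n)$ for all $t$. 3. $h_n(t)=P_n(t)\prod_{i=-N-n+1}^{N-1}(t-i)$, where $P_n$ is a polynomial with rational coefficients of degree $(n-1)(n-2)-2N$. 4. $h_n(N)=\bigl(\mathrm{CT}\,M\bigl(\lfloor\frac{n-1}2\rfloor;\,2+\chi(n\text{ is even}),1,2\bigr)\bigr)^2$, where $\chi(\text{true})=1$ and $\chi(\text{false})=0$. -/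

import Mathlib

/-- Exponent vectors `a` of Laurent monomials `x₁^{a₁} ⋯ x_n^{a_n}` (the variable `x_i` has index
`i - 1` in `Fin n`). They are ordered lexicographically starting from the last variable: `a` is
positive iff its last nonzero entry is positive. This is the order of smallness of monomials for
`1 > x₁ > x₂ > ⋯ > x_n > 0`: each `x_i`, and each `x_j / x_i` with `i < j`, has a positive
exponent vector. -/
abbrev ExpVec (n : ℕ) : Type := Lex ((Fin n)ᵒᵈ → ℤ)

/-- The exponent vector with entries `a i`. -/
def expVec {n : ℕ} (a : Fin n → ℤ) : ExpVec n := toLex fun i => a (OrderDual.ofDual i)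

/-- The field of generalized Laurent series over `ℚ` in `x₁, …, x_n`, with well-ordered support for
the order on exponent vectors. It contains the iterated Laurent series field
`ℚ((x₁))((x₂))⋯((x_n))`. Here, if `i < j`, the inverse of `x_i - x_j` is `x_i⁻¹ ∑ (x_j / x_i) ^ k`,
and the inverse of `1 - x_i` is `∑ x_i ^ k`. -/
abbrev LaurentField (n : ℕ) : Type := HahnSeries (ExpVec n) ℚ

/-- The field `ℚ(x₁, …, x_n)` of rational functions. -/
abbrev RatFn (n : ℕ) : Type := FractionRing (MvPolynomial (Fin n) ℚ)

noncomputable section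

/-- The variable with index `i` in the field of rational functions. -/
def RatFn.X {n : ℕ} (i : Fin n) : RatFn n :=
  algebraMap (MvPolynomial (Fin n) ℚ) (RatFn n) (MvPolynomial.X i)

/-- A polynomial regarded as a Laurent series. -/
def polyToLaurent (n : ℕ) : MvPolynomial (Fin n) ℚ →ₐ[ℚ] LaurentField n :=
  MvPolynomial.aeval fun i => HahnSeries.single (expVec (Pi.single i 1)) 1

theorem polyToLaurent_monomial (n : ℕ) (m : Fin n →₀ ℕ) (c : ℚ) :
    polyToLaurent n (MvPolynomial.monomial m c) =
      HahnSeries.single (expVec fun i => (m i : ℤ)) c := by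
  have key : ∀ s : Finset (Fin n),
      (∏ i ∈ s, (HahnSeries.single (expVec (Pi.single i 1) : ExpVec n) (1 : ℚ)) ^ m i) =
        HahnSeries.single (∑ i ∈ s, m i • (expVec (Pi.single i 1) : ExpVec n)) 1 := by
    intro s
    induction s using Finset.induction_on with
    | empty => simp
    | insert a s ha ih =>
      rw [Finset.prod_insert ha, Finset.sum_insert ha, ih, HahnSeries.single_pow,
        HahnSeries.single_mul_single]
      simp
  have hsum : (∑ i : Fin n, m i • (expVec (Pi.single i 1) : ExpVec n)) =
      expVec fun i => (m i : ℤ) := by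
    have h : (∑ i : Fin n, m i • (Pi.single i 1 : Fin n → ℤ)) = fun i => (m i : ℤ) := by
      ext j
      simp [Finset.sum_apply, Pi.single_apply]
    have e : ∀ s : Finset (Fin n), (∑ i ∈ s, m i • (expVec (Pi.single i 1) : ExpVec n)) =
        expVec (∑ i ∈ s, m i • (Pi.single i 1 : Fin n → ℤ)) := by
      intro s
      induction s using Finset.induction_on with
      | empty => rfl
      | insert a s ha ih => rw [Finset.sum_insert ha, Finset.sum_insert ha, ih]; rfl
    rw [e, h]
  rw [polyToLaurent, MvPolynomial.aeval_monomial, Finsupp.prod_fintype _ _ (by simp), key, hsum,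
    HahnSeries.algebraMap_apply, HahnSeries.C_apply, HahnSeries.single_mul_single]
  simp

theorem polyToLaurent_coeff (n : ℕ) (p : MvPolynomial (Fin n) ℚ) (m : Fin n →₀ ℕ) :
    (polyToLaurent n p).coeff (expVec fun i => (m i : ℤ)) = p.coeff m := by
  induction p using MvPolynomial.induction_on' with
  | monomial k c =>
    rw [polyToLaurent_monomial, MvPolynomial.coeff_monomial]
    by_cases h : k = m
    · subst h; simp
    · rw [if_neg h, HahnSeries.coeff_single_of_ne]
      intro h'
      apply h
      ext i
      have h2 : (m i : ℤ) = (k i : ℤ) := congrFun (toLex.injective h') (OrderDual.toDual i)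
      exact_mod_cast h2.symm
  | add p q hp hq => rw [map_add, HahnSeries.coeff_add, hp, hq, MvPolynomial.coeff_add]

theorem polyToLaurent_injective (n : ℕ) : Function.Injective (polyToLaurent n) := by
  intro p q h
  ext m
  rw [← polyToLaurent_coeff, ← polyToLaurent_coeff, h]

/-- The Laurent series expansion of rational functions according to
`1 > x₁ > x₂ > ⋯ > x_n > 0`: the unique field homomorphism that extends `polyToLaurent`. -/
def laurentExpansion (n : ℕ) : RatFn n →+* LaurentField n :=
  IsFractionRing.lift (A := MvPolynomial (Fin n) ℚ) (K := RatFn n) (L := LaurentField n)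
    (g := (polyToLaurent n : MvPolynomial (Fin n) ℚ →+* LaurentField n)) (polyToLaurent_injective n)

/-- The constant term, with respect to all variables, of the Laurent series expansion of a
rational function. -/
def constantTerm {n : ℕ} (f : RatFn n) : ℚ :=
  (laurentExpansion n f).coeff 0

/-- The Morris rational function `M(n; k₁, k₂, k₃)`. -/
def morris (n k₁ k₂ k₃ : ℕ) : RatFn n :=
  1 / ((∏ i : Fin n, RatFn.X i ^ ((k₁ : ℤ) - 1)) * (∏ i : Fin n, (1 - RatFn.X i) ^ k₂) *
    ∏ i : Fin n, ∏ j ∈ Finset.Ioi i, (RatFn.X i - RatFn.X j) ^ k₃)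

/-- The rational function `𝓗^m = ∏_i x_i^{(m_i - 1) t} / ∏_{j ≠ i} (1 - x_j / x_i)^{m_i}`. -/
def birkhoffTerm (n : ℕ) (m : Fin n → ℕ) (t : ℤ) : RatFn n :=
  ∏ i : Fin n, RatFn.X i ^ (((m i : ℤ) - 1) * t) /
    ∏ j ∈ Finset.univ.erase i, (1 - RatFn.X j / RatFn.X i) ^ m i

/-- The composition `(2, 1^{n-2}, 0)` of `n` (for `n ≥ 2`). -/
def comp21 (n : ℕ) (i : Fin n) : ℕ :=
  if i.val = 0 then 2 else if i.val = n - 1 then 0 else 1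

/-- `h_n(t)`, for a nonnegative integer `t`. -/
def hn (n t : ℕ) : ℚ :=
  (-1) ^ ((n - 1) * (n - 2) / 2) * constantTerm (birkhoffTerm n (comp21 n) t)

/-- The indices of the variables `x₂, …, x_{n-1}`. -/
def midIdx (n : ℕ) : Finset (Fin n) :=
  Finset.univ.filter fun i => 1 ≤ i.val ∧ i.val + 1 < n

/-- The index of the last variable `x_n`. -/
def lastIdx (n : ℕ) (h2 : 2 ≤ n) : Fin n := ⟨n - 1, by omega⟩

/-- The rational function `H̄_n` in `x₂, …, x_n`, as an element of `ℚ(x₁, …, x_n)` which does not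
involve `x₁`. -/
def barH (n : ℕ) (h2 : 2 ≤ n) (t : ℤ) : RatFn n :=
  ((1 - RatFn.X (lastIdx n h2)) * (∏ i ∈ midIdx n, RatFn.X i ^ (n - 1)) *
      ∏ i ∈ midIdx n, (RatFn.X i - RatFn.X (lastIdx n h2))) /
    (RatFn.X (lastIdx n h2) ^ t * (∏ i ∈ Finset.univ.filter (fun i : Fin n => 1 ≤ i.val), (1 - RatFn.X i) ^ 3) *
      ∏ i ∈ Finset.univ.filter (fun i : Fin n => 1 ≤ i.val), ∏ j ∈ Finset.Ioi i,
        (RatFn.X i - RatFn.X j) ^ 2)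

end

/-! Put m = n - 1. Once every factor 1 - x_j/x_i with j < i is turned round, the constant term of 𝓗
is a coefficient of a product of factors (1 - x_j/x_i)⁻¹ with i < j. It counts integer flows on
vertices 0, …, m with fixed edge multiplicities, and t enters only the demands at the vertices 0 and
m. Such a count depends on the demands and not on the monomials attached to the vertices, so the
first variable may be replaced by 1; this gives the formula with `barH` (`hn_eq_barH`).

An iterated constant term is an iterated residue. The function of `barH` has no pole at infinity in
any variable, so its expansion at the origin has the same residue as its expansion at the point (1,
…, 1) (`arrCT_xv_eq_uv`). If there is no pole at the origin, the same holds for the expansion at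
infinity (`arrCT_iv_eq_uv`). Both are proved algebraically, by partial fractions in one variable at
a time.

At (1, …, 1) the parameter t occurs only in one factor (1 - x)^(-t-1), whose coefficients are the
polynomials binom(t + k, k). The remaining factor has total degree at least -m², so only k ≤ m²
contribute, and the value is a polynomial in t (`arrCT_uv_eq_eval`). Its top coefficient sees only
the part of lowest degree; it is a Morris constant term, and it is positive because it counts flows
that exist. An upper bound for the total degree kills the coefficients of small k and gives the
zeros -1, …, -m.

The substitution x ↦ 1/x exchanges t and -t - n up to the sign (-1)^m and exchanges the origin with
infinity, whence the reciprocity (`flowPoly_reciprocity`).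

The vertices k, …, m have total demand t - k(m - k). If this is negative, there is no flow
(`hn_eq_zero`); the cut in the middle gives the zeros 0, …, N - 1, and reciprocity reflects them. If
t = N, nothing crosses the middle cut, the count factors (`flowSeries_coeff_split`), and the two
halves are the same Morris constant term (`hn_eq_morris_sq`). -/

set_option linter.unusedSectionVars false

/-! ### Hahn series: monomials, supports in half spaces, positivity -/

section HahnTools

variable {Γ : Type*} [AddCommGroup Γ] [LinearOrder Γ] [IsOrderedAddMonoid Γ]

/-- The monomial with exponent `a`. -/
noncomputable def mono (a : Γ) : HahnSeries Γ ℚ := HahnSeries.single a 1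

theorem mono_zero : mono (0 : Γ) = 1 := rfl

theorem mono_add (a b : Γ) : mono (a + b) = mono a * mono b := by
  simp [mono, HahnSeries.single_mul_single]

theorem mono_ne_zero (a : Γ) : mono a ≠ 0 := by simp [mono]

theorem mono_neg (a : Γ) : mono (-a) = (mono a)⁻¹ := by
  refine eq_inv_of_mul_eq_one_left ?_
  rw [← mono_add, neg_add_cancel, mono_zero]

theorem mono_sub (a b : Γ) : mono (a - b) = mono a / mono b := by
  rw [sub_eq_add_neg, mono_add, mono_neg, div_eq_mul_inv]

theorem mono_nsmul (a : Γ) (k : ℕ) : mono (k • a) = mono a ^ k := by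
  simp [mono, HahnSeries.single_pow]

theorem mono_zsmul (a : Γ) (k : ℤ) : mono (k • a) = mono a ^ k := by
  cases k with
  | ofNat k => simpa using mono_nsmul a k
  | negSucc k => rw [negSucc_zsmul, mono_neg, mono_nsmul, zpow_negSucc]

theorem mono_sum {ι : Type*} (s : Finset ι) (f : ι → Γ) :
    mono (∑ i ∈ s, f i) = ∏ i ∈ s, mono (f i) := by
  classical
  induction s using Finset.induction_on with
  | empty => simp [mono_zero]
  | insert a s ha ih => rw [Finset.sum_insert ha, Finset.prod_insert ha, mono_add, ih]

theorem coeff_mono_mul (a γ : Γ) (f : HahnSeries Γ ℚ) :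
    (mono a * f).coeff γ = f.coeff (γ - a) := by
  simp [mono, HahnSeries.coeff_single_mul]

theorem mono_injective : Function.Injective (mono : Γ → HahnSeries Γ ℚ) := by
  intro a b h
  by_contra hab
  have : (mono a).coeff a = (mono b).coeff a := by rw [h]
  simp [mono, HahnSeries.coeff_single_of_ne hab] at this

theorem one_sub_mono_ne_zero {a : Γ} (ha : a ≠ 0) : (1 - mono a : HahnSeries Γ ℚ) ≠ 0 := by
  rw [← mono_zero, sub_ne_zero]
  exact fun h => ha (mono_injective h).symm

/-- This recursion stands in for the geometric series: facts about inverse factors follow from it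
and from the well-ordered support. -/
theorem coeff_mul_inv_one_sub (f : HahnSeries Γ ℚ) {a : Γ} (ha : 0 < a) (γ : Γ) :
    (f * (1 - mono a)⁻¹).coeff γ = f.coeff γ + (f * (1 - mono a)⁻¹).coeff (γ - a) := by
  set g := f * (1 - mono a)⁻¹ with hg
  have h : f = g - mono a * g := by
    rw [hg]; field_simp [one_sub_mono_ne_zero ha.ne']
  rw [h, HahnSeries.coeff_sub, coeff_mono_mul]; ring

/-- A Hahn series has no infinite descending chain of nonzero coefficients. -/
theorem coeff_eq_zero_of_descent (f : HahnSeries Γ ℚ) {a : Γ} (ha : 0 < a) (P : Γ → Prop)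
    (h : ∀ γ, P γ → f.coeff γ ≠ 0 → P (γ - a) ∧ f.coeff (γ - a) ≠ 0) :
    ∀ γ, P γ → f.coeff γ = 0 := by
  intro γ hγ
  by_contra hne
  have hwf : {δ | P δ ∧ f.coeff δ ≠ 0}.IsWF := f.isWF_support.mono fun δ hδ => hδ.2
  have hn : {δ | P δ ∧ f.coeff δ ≠ 0}.Nonempty := ⟨γ, hγ, hne⟩
  have hm := hwf.min_mem hn
  exact hwf.not_lt_min hn (h _ hm.1 hm.2) (sub_lt_self _ ha)

/-- The support of `f` is contained in the half space `d ≤ ℓ`. -/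
def SuppGE (ℓ : Γ →+ ℤ) (d : ℤ) (f : HahnSeries Γ ℚ) : Prop := ∀ γ, f.coeff γ ≠ 0 → d ≤ ℓ γ

variable {ℓ : Γ →+ ℤ} {d d' : ℤ} {f g : HahnSeries Γ ℚ}

theorem SuppGE.mono_le (h : SuppGE ℓ d f) (hd : d' ≤ d) : SuppGE ℓ d' f :=
  fun γ hγ => hd.trans (h γ hγ)

theorem SuppGE.mul (hf : SuppGE ℓ d f) (hg : SuppGE ℓ d' g) : SuppGE ℓ (d + d') (f * g) := by
  intro γ hγ
  rw [HahnSeries.coeff_mul] at hγ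
  obtain ⟨ij, hij, hne⟩ := Finset.exists_ne_zero_of_sum_ne_zero hγ
  obtain ⟨h1, h2, h3⟩ := Finset.mem_antidiagonal.1 hij
  rw [← h3, map_add]
  exact add_le_add (hf _ h1) (hg _ h2)

theorem SuppGE.mul_zero (hf : SuppGE ℓ d f) (hg : SuppGE ℓ 0 g) : SuppGE ℓ d (f * g) := by
  simpa using hf.mul hg

theorem suppGE_mono {a : Γ} (h : d ≤ ℓ a) : SuppGE ℓ d (mono a) := by
  intro γ hγ
  have : γ = a := by
    by_contra hne
    exact hγ (HahnSeries.coeff_single_of_ne hne)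
  rwa [this]

theorem suppGE_one : SuppGE ℓ 0 1 := by
  rw [← mono_zero]; exact suppGE_mono (by simp)

theorem SuppGE.add (hf : SuppGE ℓ d f) (hg : SuppGE ℓ d g) : SuppGE ℓ d (f + g) := by
  intro γ hγ
  by_cases h : f.coeff γ = 0
  · exact hg γ fun h' => hγ (by simp [h, h'])
  · exact hf γ h

theorem SuppGE.neg (hf : SuppGE ℓ d f) : SuppGE ℓ d (-f) := by
  intro γ hγ
  exact hf γ fun h => hγ (by simp [h])

theorem SuppGE.sub (hf : SuppGE ℓ d f) (hg : SuppGE ℓ d g) : SuppGE ℓ d (f - g) := by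
  rw [sub_eq_add_neg]; exact hf.add hg.neg

theorem SuppGE.pow (hf : SuppGE ℓ 0 f) (k : ℕ) : SuppGE ℓ 0 (f ^ k) := by
  induction k with
  | zero => simpa using suppGE_one
  | succ k ih => rw [pow_succ]; exact ih.mul_zero hf

theorem SuppGE.prod {ι : Type*} (s : Finset ι) (F : ι → HahnSeries Γ ℚ)
    (h : ∀ i ∈ s, SuppGE ℓ 0 (F i)) : SuppGE ℓ 0 (∏ i ∈ s, F i) := by
  classical
  induction s using Finset.induction_on with
  | empty => simpa using suppGE_one
  | insert a s ha ih =>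
    rw [Finset.prod_insert ha]
    exact (h a (by simp)).mul_zero (ih fun i hi => h i (by simp [hi]))

/-- Outside the half space `f` contributes nothing, so by the recursion a nonzero coefficient there
would propagate along γ, γ - a, γ - 2a, … without end. -/
theorem SuppGE.inv_one_sub {a : Γ} (hf : SuppGE ℓ d f) (ha : 0 < a) (hl : 0 ≤ ℓ a) :
    SuppGE ℓ d (f * (1 - mono a)⁻¹) := by
  intro γ hγ
  by_contra hlt
  refine hγ (coeff_eq_zero_of_descent _ ha (fun δ => ℓ δ < d) ?_ γ (not_le.1 hlt))
  intro δ hδ hne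
  refine ⟨by rw [map_sub]; linarith, ?_⟩
  rw [coeff_mul_inv_one_sub f ha] at hne
  rwa [show f.coeff δ = 0 by by_contra h; exact absurd (hf δ h) (not_le.2 hδ), zero_add] at hne

theorem suppGE_inv_one_sub {a : Γ} (ha : 0 < a) (hl : 0 ≤ ℓ a) :
    SuppGE ℓ 0 ((1 - mono a)⁻¹) := by
  simpa using (suppGE_one (ℓ := ℓ)).inv_one_sub ha hl

theorem suppGE_one_sub {a : Γ} (hl : 0 ≤ ℓ a) : SuppGE ℓ 0 (1 - mono a) :=
  suppGE_one.sub (suppGE_mono hl)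

theorem SuppGE.coeff_eq_zero (hf : SuppGE ℓ d f) {γ : Γ} (h : ℓ γ < d) : f.coeff γ = 0 := by
  by_contra hne
  exact absurd (hf γ hne) (not_le.2 h)

theorem SuppGE.coeff_zero (hf : SuppGE ℓ d f) (h : 0 < d) : f.coeff 0 = 0 :=
  hf.coeff_eq_zero (by simpa using h)

/-- Constant terms are multiplicative for series whose supports only cancel at `0`. -/
theorem coeff_zero_mul_of_disjoint
    (h : ∀ γ, f.coeff γ ≠ 0 → g.coeff (-γ) ≠ 0 → γ = 0) :
    (f * g).coeff 0 = f.coeff 0 * g.coeff 0 := by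
  rw [HahnSeries.coeff_mul, Finset.sum_eq_single (0, 0)]
  · intro ij hij hne
    obtain ⟨h1, h2, h3⟩ := Finset.mem_antidiagonal.1 hij
    have h4 : ij.2 = -ij.1 := (neg_eq_of_add_eq_zero_right h3).symm
    have h5 := h _ h1 (h4 ▸ h2)
    exact absurd (Prod.ext h5 (by rw [h4, h5, neg_zero])) hne
  · intro h0
    by_contra hne
    exact h0 (Finset.mem_antidiagonal.2
      ⟨left_ne_zero_of_mul hne, right_ne_zero_of_mul hne, add_zero 0⟩)

/-- `f` has nonnegative coefficients and its coefficient at `γ` is positive. -/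
def PosAt (γ : Γ) (f : HahnSeries Γ ℚ) : Prop := (∀ δ, 0 ≤ f.coeff δ) ∧ 0 < f.coeff γ

theorem posAt_mono (γ : Γ) : PosAt γ (mono γ) := by
  refine ⟨fun δ => ?_, by simp [mono]⟩
  by_cases h : δ = γ
  · simp [h, mono]
  · simp [mono, HahnSeries.coeff_single_of_ne h]

/-- A negative coefficient would propagate downwards for ever, and positivity at γ moves up by one
`a` at each use of the recursion. -/
theorem PosAt.inv_one_sub {γ a : Γ} (hf : PosAt γ f) (ha : 0 < a) (k : ℕ) :
    PosAt (γ + k • a) (f * (1 - mono a)⁻¹) := by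
  have hnn : ∀ δ, 0 ≤ (f * (1 - mono a)⁻¹).coeff δ := by
    intro δ
    by_contra hlt
    refine (not_le.1 hlt).ne (coeff_eq_zero_of_descent _ ha
      (fun δ => (f * (1 - mono a)⁻¹).coeff δ < 0) ?_ δ (not_le.1 hlt))
    intro δ hδ _
    rw [coeff_mul_inv_one_sub f ha] at hδ
    have := hf.1 δ
    exact ⟨by linarith, by linarith⟩
  refine ⟨hnn, ?_⟩
  induction k with
  | zero =>
    rw [coeff_mul_inv_one_sub f ha, zero_smul, add_zero]
    exact add_pos_of_pos_of_nonneg hf.2 (hnn _)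
  | succ k ih =>
    rw [coeff_mul_inv_one_sub f ha, succ_nsmul, ← add_assoc, add_sub_cancel_right]
    exact add_pos_of_nonneg_of_pos (hf.1 _) ih

theorem PosAt.inv_one_sub_pow {γ a : Γ} (hf : PosAt γ f) (ha : 0 < a) (k : ℕ) :
    PosAt γ (f * ((1 - mono a) ^ k)⁻¹) := by
  induction k with
  | zero => simpa using hf
  | succ k ih =>
    rw [pow_succ, mul_inv, ← mul_assoc]
    simpa using ih.inv_one_sub ha 0

/-- The generating function of flows on the vertices `0, …, r - 1`, where vertex `i` has the weight
`v i` and there are `c i j` edges from `i` to `j`. -/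
noncomputable def flowSeries (v : ℕ → Γ) (c : ℕ → ℕ → ℕ) (r : ℕ) : HahnSeries Γ ℚ :=
  ∏ j ∈ Finset.range r, ∏ i ∈ Finset.range j, ((1 - mono (v j - v i)) ^ c i j)⁻¹

end HahnTools

/-! ### Flow counts do not depend on the vertex weights -/

section Transport

variable {Γ Γ' : Type*} [AddCommGroup Γ] [LinearOrder Γ] [IsOrderedAddMonoid Γ]
  [AddCommGroup Γ'] [LinearOrder Γ'] [IsOrderedAddMonoid Γ']

theorem eventually_coeff_eq_zero (f : HahnSeries Γ ℚ) {a : Γ} (ha : 0 < a) (γ : Γ) :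
    ∃ K : ℕ, ∀ k ≥ K, f.coeff (γ - k • a) = 0 := by
  by_contra! h
  have hwf : {δ | f.coeff δ ≠ 0 ∧ ∃ k : ℕ, δ = γ - k • a}.IsWF :=
    f.isWF_support.mono fun δ hδ => hδ.1
  obtain ⟨k₀, -, h₀⟩ := h 0
  have hn : {δ | f.coeff δ ≠ 0 ∧ ∃ k : ℕ, δ = γ - k • a}.Nonempty := ⟨_, h₀, k₀, rfl⟩
  obtain ⟨-, k, hk⟩ := hwf.min_mem hn
  obtain ⟨l, hl, hne⟩ := h (k + 1)
  refine hwf.not_lt_min hn ⟨hne, l, rfl⟩ ?_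
  rw [hk]
  exact sub_lt_sub_left (nsmul_lt_nsmul_left ha hl) _

/-- `f` and `f'` have the same coefficients on two images of a group. -/
def SameCoeff {A : Type*} (β : A → Γ) (β' : A → Γ') (f : HahnSeries Γ ℚ) (f' : HahnSeries Γ' ℚ) :
    Prop := ∀ q, f.coeff (β q) = f'.coeff (β' q)

theorem SameCoeff.inv_one_sub {A : Type*} [AddCommGroup A] {β : A →+ Γ} {β' : A →+ Γ'}
    {f : HahnSeries Γ ℚ} {f' : HahnSeries Γ' ℚ} (h : SameCoeff β β' f f') {e : A}
    (he : 0 < β e) (he' : 0 < β' e) :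
    SameCoeff β β' (f * (1 - mono (β e))⁻¹) (f' * (1 - mono (β' e))⁻¹) := by
  intro q
  obtain ⟨K, hK⟩ := eventually_coeff_eq_zero (f * (1 - mono (β e))⁻¹) he (β q)
  obtain ⟨K', hK'⟩ := eventually_coeff_eq_zero (f' * (1 - mono (β' e))⁻¹) he' (β' q)
  have key : ∀ k : ℕ, (f * (1 - mono (β e))⁻¹).coeff (β q - k • β e) =
      (f' * (1 - mono (β' e))⁻¹).coeff (β' q - k • β' e) := by
    intro k
    -- Far enough below, both coefficients vanish; the induction climbs back up from that depth by
    -- the recursion.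
    induction hm : max K K' - k generalizing k with
    | zero => rw [hK k (by omega), hK' k (by omega)]
    | succ m ih =>
      rw [coeff_mul_inv_one_sub f he, coeff_mul_inv_one_sub f' he', sub_sub, sub_sub, ← succ_nsmul,
        ← succ_nsmul, ih (k + 1) (by omega)]
      congr 1
      have hk := h (q - k • e)
      rwa [map_sub, map_sub, map_nsmul, map_nsmul] at hk
  simpa using key 0

theorem SameCoeff.inv_one_sub_pow {A : Type*} [AddCommGroup A] {β : A →+ Γ} {β' : A →+ Γ'}
    {f : HahnSeries Γ ℚ} {f' : HahnSeries Γ' ℚ} (h : SameCoeff β β' f f') {e : A}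
    (he : 0 < β e) (he' : 0 < β' e) (k : ℕ) :
    SameCoeff β β' (f * ((1 - mono (β e)) ^ k)⁻¹) (f' * ((1 - mono (β' e)) ^ k)⁻¹) := by
  induction k with
  | zero => simpa using h
  | succ k ih =>
    rw [pow_succ, mul_inv, ← mul_assoc, pow_succ, mul_inv, ← mul_assoc]
    exact ih.inv_one_sub he he'

theorem SameCoeff.prod {A ι : Type*} {β : A → Γ} {β' : A → Γ'}
    (s : Finset ι) (F : ι → HahnSeries Γ ℚ) (F' : ι → HahnSeries Γ' ℚ)
    (h : ∀ i ∈ s, ∀ f f', SameCoeff β β' f f' → SameCoeff β β' (f * F i) (f' * F' i))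
    {f : HahnSeries Γ ℚ} {f' : HahnSeries Γ' ℚ} (hf : SameCoeff β β' f f') :
    SameCoeff β β' (f * ∏ i ∈ s, F i) (f' * ∏ i ∈ s, F' i) := by
  classical
  induction s using Finset.induction_on generalizing f f' with
  | empty => simpa using hf
  | insert a s ha ih =>
    rw [Finset.prod_insert ha, Finset.prod_insert ha, ← mul_assoc, ← mul_assoc]
    exact ih (fun i hi => h i (by simp [hi])) (h a (by simp) f f' hf)

/-- Sum-zero integer vectors indexed by `0, …, r - 1`. -/
def sumZero (r : ℕ) : AddSubgroup (ℕ → ℤ) where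
  carrier := {q | ∑ i ∈ Finset.range r, q i = 0}
  add_mem' := fun {p q} hp hq => by
    simp only [Set.mem_ofPred_eq] at *
    simp [Finset.sum_add_distrib, hp, hq]
  zero_mem' := by simp
  neg_mem' := fun {p} hp => by
    simp only [Set.mem_ofPred_eq] at *
    simp [hp]

/-- The combination of the weights `v i` with coefficients `q i`. -/
def weightSum (v : ℕ → Γ) (r : ℕ) : sumZero r →+ Γ where
  toFun q := ∑ i ∈ Finset.range r, q.1 i • v i
  map_zero' := by simp
  map_add' := fun p q => by simp [add_smul, Finset.sum_add_distrib]

/-- The vector with a demand of one unit at `j` and a supply of one unit at `i`. -/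
def edgeVec {r i j : ℕ} (hi : i < r) (hj : j < r) : sumZero r :=
  ⟨Pi.single j 1 - Pi.single i 1, by
    change ∑ _ ∈ _, _ = (0 : ℤ)
    simp [Finset.sum_sub_distrib, hi, hj]⟩

theorem weightSum_edgeVec (v : ℕ → Γ) {r i j : ℕ} (hi : i < r) (hj : j < r) :
    weightSum v r (edgeVec hi hj) = v j - v i := by
  change ∑ k ∈ Finset.range r, (Pi.single j (1 : ℤ) - Pi.single i 1 : ℕ → ℤ) k • v k = _
  simp [sub_smul, Finset.sum_sub_distrib, Pi.single_apply, ite_smul, hi, hj]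

/-- The coefficients of `flowSeries` only depend on the demands, not on the weights. -/
theorem flowSeries_coeff_eq (v : ℕ → Γ) (v' : ℕ → Γ') (c : ℕ → ℕ → ℕ) (r : ℕ)
    (hv : ∀ i j, i < j → j < r → v i < v j) (hv' : ∀ i j, i < j → j < r → v' i < v' j)
    (hinj : ∀ q : ℕ → ℤ, ∑ i ∈ Finset.range r, q i = 0 → ∑ i ∈ Finset.range r, q i • v i = 0 →
      ∀ i < r, q i = 0)
    (hinj' : ∀ q : ℕ → ℤ, ∑ i ∈ Finset.range r, q i = 0 → ∑ i ∈ Finset.range r, q i • v' i = 0 →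
      ∀ i < r, q i = 0)
    (q : ℕ → ℤ) (hq : ∑ i ∈ Finset.range r, q i = 0) :
    (flowSeries v c r).coeff (∑ i ∈ Finset.range r, q i • v i) =
      (flowSeries v' c r).coeff (∑ i ∈ Finset.range r, q i • v' i) := by
  have h1 : SameCoeff (weightSum v r) (weightSum v' r) 1 1 := by
    intro p
    have key : weightSum v r p = 0 ↔ weightSum v' r p = 0 := by
      constructor
      · intro h
        change ∑ i ∈ Finset.range r, p.1 i • v' i = 0
        exact Finset.sum_eq_zero fun i hi => by
          simp [hinj p.1 p.2 h i (Finset.mem_range.1 hi)]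
      · intro h
        change ∑ i ∈ Finset.range r, p.1 i • v i = 0
        exact Finset.sum_eq_zero fun i hi => by
          simp [hinj' p.1 p.2 h i (Finset.mem_range.1 hi)]
    rw [HahnSeries.coeff_one, HahnSeries.coeff_one]
    by_cases h : weightSum v r p = 0
    · rw [if_pos h, if_pos (key.1 h)]
    · rw [if_neg h, if_neg fun h' => h (key.2 h')]
  have h2 : SameCoeff (weightSum v r) (weightSum v' r) (1 * flowSeries v c r)
      (1 * flowSeries v' c r) := by
    refine SameCoeff.prod _ _ _ (fun j hj f f' hf => SameCoeff.prod _ _ _ (fun i hi g g' hg => ?_)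
      hf) h1
    have hj' := Finset.mem_range.1 hj
    have hi' := Finset.mem_range.1 hi
    rw [← weightSum_edgeVec v (hi'.trans hj') hj', ← weightSum_edgeVec v' (hi'.trans hj') hj']
    refine hg.inv_one_sub_pow ?_ ?_ _
    · rw [weightSum_edgeVec]; exact sub_pos.2 (hv i j hi' hj')
    · rw [weightSum_edgeVec]; exact sub_pos.2 (hv' i j hi' hj')
  rw [one_mul, one_mul] at h2
  exact h2 ⟨q, hq⟩

end Transport

/-! ### Monomials and linear functionals on exponent vectors -/

section Monomials

variable {n : ℕ}

/-- The exponent vector of the variable with index `i`, and `0` if `n ≤ i`. -/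
def ev (n i : ℕ) : ExpVec n := expVec fun j => if j.val = i then 1 else 0

/-- The linear functional on exponent vectors with values `S i`. -/
def wt (n : ℕ) (S : ℕ → ℤ) : ExpVec n →+ ℤ where
  toFun a := ∑ j : Fin n, S j.val * ofLex a (OrderDual.toDual j)
  map_zero' := Finset.sum_eq_zero fun j _ => mul_zero _
  map_add' := fun a b => by
    rw [← Finset.sum_add_distrib]
    exact Finset.sum_congr rfl fun j _ => mul_add _ _ _

theorem wt_ev (S : ℕ → ℤ) {i : ℕ} (hi : i < n) : wt n S (ev n i) = S i := by
  change ∑ j : Fin n, S j.val * (if j.val = i then 1 else 0) = S i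
  rw [Finset.sum_eq_single ⟨i, hi⟩]
  · simp
  · intro j _ hj
    rw [if_neg fun h => hj (Fin.ext h), mul_zero]
  · simp

theorem ev_pos {i : ℕ} (hi : i < n) : 0 < ev n i := by
  refine ⟨OrderDual.toDual ⟨i, hi⟩, fun j hj => ?_, ?_⟩
  · have h : (OrderDual.ofDual j).val ≠ i := (Fin.lt_def.1 hj).ne'
    change (0 : ℤ) = if (OrderDual.ofDual j).val = i then 1 else 0
    rw [if_neg h]
  · change (0 : ℤ) < if i = i then 1 else 0
    simp

theorem ev_lt_ev {i j : ℕ} (hij : i < j) (hj : j < n) : ev n i < ev n j := by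
  refine ⟨OrderDual.toDual ⟨j, hj⟩, fun k hk => ?_, ?_⟩
  · have h : j < (OrderDual.ofDual k).val := Fin.lt_def.1 hk
    change (if (OrderDual.ofDual k).val = i then (1 : ℤ) else 0) =
      if (OrderDual.ofDual k).val = j then 1 else 0
    rw [if_neg (by omega), if_neg (by omega)]
  · change (if j = i then (1 : ℤ) else 0) < if j = j then 1 else 0
    rw [if_neg (by omega), if_pos rfl]; exact zero_lt_one

theorem exists_apply_ne_zero {γ : ExpVec n} (h : γ ≠ 0) :
    ∃ i < n, wt n (Pi.single i 1) γ ≠ 0 := by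
  by_contra! h'
  apply h
  funext j
  have := h' (OrderDual.ofDual j).val (OrderDual.ofDual j).isLt
  change ∑ k : Fin n, (Pi.single (OrderDual.ofDual j).val 1 : ℕ → ℤ) k.val *
    γ (OrderDual.toDual k) = 0 at this
  rw [Finset.sum_eq_single (OrderDual.ofDual j)] at this
  · rw [Pi.single_eq_same, one_mul] at this
    exact this
  · intro b _ hb
    rw [Pi.single_eq_of_ne fun h => hb (Fin.ext h), zero_mul]
  · simp

/-- The variable with index `i` as a Laurent series. -/
noncomputable def xv (n i : ℕ) : LaurentField n := mono (ev n i)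

theorem laurentExpansion_X (i : Fin n) : laurentExpansion n (RatFn.X i) = xv n i := by
  have h : laurentExpansion n (RatFn.X i) = polyToLaurent n (MvPolynomial.X i) :=
    IsFractionRing.lift_algebraMap (K := RatFn n)
      (g := (polyToLaurent n : MvPolynomial (Fin n) ℚ →+* LaurentField n))
      (polyToLaurent_injective n) _
  rw [h, polyToLaurent, MvPolynomial.aeval_X, xv, mono, ev]
  have hi : (Pi.single i 1 : Fin n → ℤ) = fun j => if j.val = i.val then 1 else 0 := by
    funext j; simp [Pi.single_apply, Fin.ext_iff]
  rw [hi]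

theorem xv_ne_zero (i : ℕ) : xv n i ≠ 0 := mono_ne_zero _

theorem one_sub_xv_ne_zero {i : ℕ} (hi : i < n) : 1 - xv n i ≠ 0 :=
  one_sub_mono_ne_zero (ev_pos hi).ne'

theorem xv_sub_xv_ne_zero {i j : ℕ} (hij : i < j) (hj : j < n) : xv n i - xv n j ≠ 0 :=
  sub_ne_zero.2 fun h => (ev_lt_ev hij hj).ne (mono_injective h)

theorem xv_sub_xv_eq (i j : ℕ) :
    xv n i - xv n j = xv n i * (1 - mono (ev n j - ev n i)) := by
  rw [mono_sub]
  change _ = xv n i * (1 - xv n j / xv n i)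
  field_simp [xv_ne_zero]

variable {ℓ : ExpVec n →+ ℤ} {d d' : ℤ} {f g : LaurentField n}

theorem SuppGE.pow' {Γ : Type*} [AddCommGroup Γ] [LinearOrder Γ] [IsOrderedAddMonoid Γ]
    {ℓ : Γ →+ ℤ} {d : ℤ} {f : HahnSeries Γ ℚ} (hf : SuppGE ℓ d f) (k : ℕ) :
    SuppGE ℓ (k * d) (f ^ k) := by
  induction k with
  | zero => simpa using suppGE_one
  | succ k ih =>
    rw [pow_succ]
    refine (ih.mul hf).mono_le (le_of_eq ?_)
    push_cast; ring

theorem suppGE_xv_zpow (i : ℕ) (z : ℤ) (h : d ≤ z * ℓ (ev n i)) : SuppGE ℓ d (xv n i ^ z) := by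
  rw [xv, ← mono_zsmul]
  exact suppGE_mono (by rwa [map_zsmul, smul_eq_mul])

theorem suppGE_inv_one_sub_xv_pow {i : ℕ} (hi : i < n) (p : ℕ) (h : 0 ≤ ℓ (ev n i)) :
    SuppGE ℓ 0 (((1 - xv n i) ^ p)⁻¹) := by
  rw [← inv_pow]
  exact (suppGE_inv_one_sub (ev_pos hi) h).pow p

theorem suppGE_one_sub_xv_zpow {i : ℕ} (hi : i < n) (z : ℤ) (h : 0 ≤ ℓ (ev n i)) :
    SuppGE ℓ 0 ((1 - xv n i) ^ z) := by
  cases z with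
  | ofNat k =>
    rw [Int.ofNat_eq_natCast, zpow_natCast]
    exact (suppGE_one_sub h).pow k
  | negSucc k => rw [zpow_negSucc]; exact suppGE_inv_one_sub_xv_pow hi _ h

theorem suppGE_inv_one_sub_div_pow {i j : ℕ} (hij : i < j) (hj : j < n) (p : ℕ)
    (h : ℓ (ev n i) ≤ ℓ (ev n j)) :
    SuppGE ℓ 0 (((1 - mono (ev n j - ev n i)) ^ p)⁻¹) := by
  rw [← inv_pow]
  exact (suppGE_inv_one_sub (sub_pos.2 (ev_lt_ev hij hj)) (by simpa using h)).pow p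

theorem suppGE_inv_xv_sub_pow {i j : ℕ} (hij : i < j) (hj : j < n) (p : ℕ)
    (h : ℓ (ev n i) ≤ ℓ (ev n j)) (hd : d ≤ -p * ℓ (ev n i)) :
    SuppGE ℓ d (((xv n i - xv n j) ^ p)⁻¹) := by
  rw [xv_sub_xv_eq, mul_pow, mul_inv]
  refine SuppGE.mul_zero ?_ (suppGE_inv_one_sub_div_pow hij hj p h)
  have := suppGE_xv_zpow (ℓ := ℓ) (d := d) i (-p) hd
  rwa [zpow_neg, zpow_natCast] at this

theorem SuppGE.prod_sum {ι : Type*} (s : Finset ι) (F : ι → LaurentField n) (D : ι → ℤ)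
    (h : ∀ i ∈ s, SuppGE ℓ (D i) (F i)) : SuppGE ℓ (∑ i ∈ s, D i) (∏ i ∈ s, F i) := by
  classical
  induction s using Finset.induction_on with
  | empty => simpa using suppGE_one
  | insert a s ha ih =>
    rw [Finset.prod_insert ha, Finset.sum_insert ha]
    exact (h a (by simp)).mul (ih fun i hi => h i (by simp [hi]))

end Monomials

/-! ### The class of rational functions, with partial fractions -/

section RationalClass

variable {F : Type*} [Field F]

/-- The rational function `v_k^A (1 - v_k)^{-p} ∏_{j ∈ s} (v_k - v_j)^{-γ_j}`. -/
def rowFn (v : ℕ → F) (k : ℕ) (s : Finset ℕ) (A : ℤ) (p : ℕ) (γ : ℕ → ℕ) : F :=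
  v k ^ A * ((1 - v k) ^ p)⁻¹ * ∏ j ∈ s, ((v k - v j) ^ γ j)⁻¹

/-- The rational function `∏ v_i^{a_i} (1 - v_i)^{-b_i} ∏_{i < j} (v_i - v_j)^{-c_{ij}}` in the
variables `v_i`, `i ∈ s`. -/
def arrFn (v : ℕ → F) (s : Finset ℕ) (a : ℕ → ℤ) (b : ℕ → ℕ) (c : ℕ → ℕ → ℕ) : F :=
  ∏ i ∈ s, rowFn v i (s.filter (i < ·)) (a i) (b i) (c i)

theorem arrFn_insert (v : ℕ → F) {k : ℕ} {s : Finset ℕ} (hk : ∀ j ∈ s, k < j) (a : ℕ → ℤ)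
    (b : ℕ → ℕ) (c : ℕ → ℕ → ℕ) :
    arrFn v (insert k s) a b c = rowFn v k s (a k) (b k) (c k) * arrFn v s a b c := by
  have hks : k ∉ s := fun h => (hk k h).false
  rw [arrFn, Finset.prod_insert hks]
  congr 1
  · congr 1
    rw [Finset.filter_insert, if_neg (lt_irrefl k), Finset.filter_true_of_mem hk]
  · refine Finset.prod_congr rfl fun i hi => ?_
    rw [Finset.filter_insert, if_neg (hk i hi).not_gt]

theorem arrFn_congr (v : ℕ → F) {s : Finset ℕ} {a a' : ℕ → ℤ} {b b' : ℕ → ℕ} {c c' : ℕ → ℕ → ℕ}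
    (ha : ∀ i ∈ s, a i = a' i) (hb : ∀ i ∈ s, b i = b' i)
    (hc : ∀ i ∈ s, ∀ j ∈ s, i < j → c i j = c' i j) :
    arrFn v s a b c = arrFn v s a' b' c' := by
  refine Finset.prod_congr rfl fun i hi => ?_
  rw [rowFn, rowFn, ha i hi, hb i hi]
  congr 1
  refine Finset.prod_congr rfl fun j hj => ?_
  rw [Finset.mem_filter] at hj
  rw [hc i hi j hj.1 hj.2]

theorem arrFn_update (v : ℕ → F) {s : Finset ℕ} {j : ℕ} (hj : j ∈ s) (a : ℕ → ℤ) (b : ℕ → ℕ)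
    (c : ℕ → ℕ → ℕ) :
    arrFn v s a (Function.update b j (b j + 1)) c = (1 - v j)⁻¹ * arrFn v s a b c := by
  rw [arrFn, arrFn, ← Finset.mul_prod_erase s _ hj, ← Finset.mul_prod_erase s _ hj, ← mul_assoc]
  congr 1
  · simp only [rowFn, Function.update_self, pow_succ, mul_inv]; ring
  · refine Finset.prod_congr rfl fun i hi => ?_
    rw [Function.update_of_ne (Finset.ne_of_mem_erase hi)]

theorem rowFn_update (v : ℕ → F) {s : Finset ℕ} {k j : ℕ} (hj : j ∈ s) (A : ℤ) (p : ℕ) (γ : ℕ → ℕ)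
    (hγ : 0 < γ j) :
    rowFn v k s A p γ = (v k - v j)⁻¹ * rowFn v k s A p (Function.update γ j (γ j - 1)) := by
  rw [rowFn, rowFn, ← Finset.mul_prod_erase s _ hj, ← Finset.mul_prod_erase s _ hj]
  have : ∏ i ∈ s.erase j, ((v k - v i) ^ Function.update γ j (γ j - 1) i)⁻¹ =
      ∏ i ∈ s.erase j, ((v k - v i) ^ γ i)⁻¹ := by
    refine Finset.prod_congr rfl fun i hi => ?_
    rw [Function.update_of_ne (Finset.ne_of_mem_erase hi)]
  obtain ⟨g, hg⟩ : ∃ g, γ j = g + 1 := ⟨γ j - 1, by omega⟩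
  rw [this, Function.update_self, hg, Nat.add_sub_cancel, pow_succ, mul_inv]
  ring

/-- Partial fractions with respect to `v_k`. -/
theorem rowFn_partialFraction (v : ℕ → F) {s : Finset ℕ} {k j : ℕ} (hj : j ∈ s) (A : ℤ) (p : ℕ)
    (γ : ℕ → ℕ) (hγ : 0 < γ j) (hj1 : 1 - v j ≠ 0) (hk1 : 1 - v k ≠ 0) (hkj : v k - v j ≠ 0) :
    rowFn v k s A (p + 1) γ = (1 - v j)⁻¹ * (rowFn v k s A p γ +
      rowFn v k s A (p + 1) (Function.update γ j (γ j - 1))) := by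
  have h1 : ∀ δ, rowFn v k s A (p + 1) δ = (1 - v k)⁻¹ * rowFn v k s A p δ := by
    intro δ; rw [rowFn, rowFn, pow_succ, mul_inv]; ring
  rw [h1, h1, rowFn_update v hj A p γ hγ]
  field_simp
  ring

/-- This is v/(1 - v) = 1/(1 - v) - 1. It changes the exponent `A` at the price of a term with a
pole of lower order at 1. -/
theorem rowFn_shift (v : ℕ → F) (s : Finset ℕ) {k : ℕ} (A : ℤ) (p : ℕ) (γ : ℕ → ℕ)
    (hk : v k ≠ 0) (hk1 : 1 - v k ≠ 0) :
    rowFn v k s (A + 1) (p + 1) γ = rowFn v k s A (p + 1) γ - rowFn v k s A p γ := by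
  rw [rowFn, rowFn, rowFn, pow_succ, mul_inv, zpow_add_one₀ hk]
  field_simp
  ring

/-- A partial fraction step lowers either `p` or one `γ j`, and raises `b j`. It ends when there is
no pole at 1 (`p = 0`) or when the variable is decoupled from the others (`γ = 0` on `s`). -/
theorem partialFraction_induction (s : Finset ℕ) (Q : ℕ → (ℕ → ℕ) → (ℕ → ℕ) → Prop)
    (h0 : ∀ γ b, Q 0 γ b) (h1 : ∀ p γ b, (∀ j ∈ s, γ j = 0) → Q p γ b)
    (h2 : ∀ p γ b j, j ∈ s → 0 < γ j → (∀ γ b, Q p γ b) →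
      Q (p + 1) (Function.update γ j (γ j - 1)) (Function.update b j (b j + 1)) → Q (p + 1) γ b) :
    ∀ p γ b, Q p γ b := by
  intro p
  induction p with
  | zero => exact h0
  | succ p ih =>
    intro γ
    induction hm : ∑ j ∈ s, γ j generalizing γ with
    | zero => exact fun b => h1 _ _ _ fun j hj => (Finset.sum_eq_zero_iff.1 hm) j hj
    | succ m ihm =>
      intro b
      obtain ⟨j, hj, hne⟩ : ∃ j ∈ s, γ j ≠ 0 := by
        by_contra! h
        rw [Finset.sum_eq_zero h] at hm
        omega
      refine h2 p γ b j hj (by omega) ih (ihm _ ?_ _)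
      rw [← Finset.add_sum_erase s _ hj] at hm ⊢
      have : ∑ i ∈ s.erase j, Function.update γ j (γ j - 1) i = ∑ i ∈ s.erase j, γ i :=
        Finset.sum_congr rfl fun i hi => Function.update_of_ne (Finset.ne_of_mem_erase hi) _ _
      rw [Function.update_self, this]
      omega

end RationalClass

/-! ### One-variable residues for the three expansions -/

section Residues

variable {Γ : Type*} [AddCommGroup Γ] [LinearOrder Γ] [IsOrderedAddMonoid Γ]

/-- The constant term of `∏ W_i` times the function `arrFn` of the variables `v_i`. -/
noncomputable def arrCT (v W : ℕ → HahnSeries Γ ℚ) (s : Finset ℕ) (a : ℕ → ℤ) (b : ℕ → ℕ)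
    (c : ℕ → ℕ → ℕ) : ℚ := ((∏ i ∈ s, W i) * arrFn v s a b c).coeff 0

/-- The constant term of `arrFn` with a separated smallest index `k`. -/
noncomputable def rowCT (v W : ℕ → HahnSeries Γ ℚ) (k : ℕ) (s : Finset ℕ) (a : ℕ → ℤ)
    (c : ℕ → ℕ → ℕ) (A : ℤ) (p : ℕ) (γ b : ℕ → ℕ) : ℚ :=
  (W k * rowFn v k s A p γ * ((∏ i ∈ s, W i) * arrFn v s a b c)).coeff 0

theorem arrCT_insert (v W : ℕ → HahnSeries Γ ℚ) {k : ℕ} {s : Finset ℕ} (hk : ∀ j ∈ s, k < j)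
    (a : ℕ → ℤ) (b : ℕ → ℕ) (c : ℕ → ℕ → ℕ) :
    arrCT v W (insert k s) a b c = rowCT v W k s a c (a k) (b k) (c k) b := by
  have hks : k ∉ s := fun h => (hk k h).false
  rw [arrCT, rowCT, arrFn_insert v hk, Finset.prod_insert hks]
  congr 1; ring

theorem arrCT_congr (v W : ℕ → HahnSeries Γ ℚ) {s : Finset ℕ} {a a' : ℕ → ℤ} {b b' : ℕ → ℕ}
    {c c' : ℕ → ℕ → ℕ} (ha : ∀ i ∈ s, a i = a' i) (hb : ∀ i ∈ s, b i = b' i)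
    (hc : ∀ i ∈ s, ∀ j ∈ s, i < j → c i j = c' i j) :
    arrCT v W s a b c = arrCT v W s a' b' c' := by
  rw [arrCT, arrCT, arrFn_congr v ha hb hc]

theorem rowCT_partialFraction (v W : ℕ → HahnSeries Γ ℚ) {k j : ℕ} {s : Finset ℕ} (hj : j ∈ s)
    (a : ℕ → ℤ) (c : ℕ → ℕ → ℕ) (A : ℤ) (p : ℕ) (γ b : ℕ → ℕ) (hγ : 0 < γ j)
    (hj1 : 1 - v j ≠ 0) (hk1 : 1 - v k ≠ 0) (hkj : v k - v j ≠ 0) :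
    rowCT v W k s a c A (p + 1) γ b =
      rowCT v W k s a c A p γ (Function.update b j (b j + 1)) +
      rowCT v W k s a c A (p + 1) (Function.update γ j (γ j - 1))
        (Function.update b j (b j + 1)) := by
  rw [rowCT, rowCT, rowCT, ← HahnSeries.coeff_add, arrFn_update v hj,
    rowFn_partialFraction v hj A p γ hγ hj1 hk1 hkj]
  congr 1; ring

theorem rowCT_shift (v W : ℕ → HahnSeries Γ ℚ) {k : ℕ} (s : Finset ℕ)
    (a : ℕ → ℤ) (c : ℕ → ℕ → ℕ) (A : ℤ) (p : ℕ) (γ b : ℕ → ℕ)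
    (hk : v k ≠ 0) (hk1 : 1 - v k ≠ 0) :
    rowCT v W k s a c (A + 1) (p + 1) γ b =
      rowCT v W k s a c A (p + 1) γ b - rowCT v W k s a c A p γ b := by
  rw [rowCT, rowCT, rowCT, ← HahnSeries.coeff_sub, rowFn_shift v s A p γ hk hk1]
  congr 1; ring

theorem rowFn_of_forall_eq_zero {F : Type*} [Field F] (v : ℕ → F) (k : ℕ) {s : Finset ℕ} (A : ℤ)
    (p : ℕ) {γ : ℕ → ℕ} (hγ : ∀ j ∈ s, γ j = 0) :
    rowFn v k s A p γ = v k ^ A * ((1 - v k) ^ p)⁻¹ := by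
  rw [rowFn, Finset.prod_eq_one, mul_one]
  intro j hj; simp [hγ j hj]

variable {n : ℕ}

/-- The constant term of `g`, if `g` does not involve `x_i`, is that of `g / (1 - x_i)`. -/
theorem coeff_zero_inv_one_sub_mul {i : ℕ} (hi : i < n) {g : LaurentField n}
    (hg : SuppGE (wt n (Pi.single i 1)) 0 g) :
    ((1 - xv n i)⁻¹ * g).coeff 0 = g.coeff 0 := by
  have h : (1 - xv n i)⁻¹ * g = g + xv n i ^ (1 : ℤ) * (((1 - xv n i) ^ 1)⁻¹ * g) := by
    field_simp [one_sub_xv_ne_zero hi]; ring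
  rw [h, HahnSeries.coeff_add]
  have hw : wt n (Pi.single i 1) (ev n i) = 1 := by rw [wt_ev _ hi]; simp
  have := ((suppGE_xv_zpow (d := 1) i 1 (by rw [hw]; simp)).mul_zero
    ((suppGE_inv_one_sub_xv_pow hi 1 (by rw [hw]; simp)).mul_zero hg)).coeff_zero one_pos
  rw [this, add_zero]

variable {ℓ : ExpVec n →+ ℤ}

/-! ### Expansion at the origin -/

section Origin

theorem suppGE_rowFn_xv {s : Finset ℕ} {k : ℕ} (hk : k < n) (hs : ∀ j ∈ s, k < j ∧ j < n)
    (hℓ : ℓ (ev n k) = 0) (hℓs : ∀ j ∈ s, ℓ (ev n j) = 0) (A : ℤ) (p : ℕ) (γ : ℕ → ℕ) :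
    SuppGE ℓ 0 (rowFn (xv n) k s A p γ) := by
  refine ((suppGE_xv_zpow k A (by simp [hℓ])).mul_zero
    (suppGE_inv_one_sub_xv_pow hk p hℓ.ge)).mul_zero (SuppGE.prod _ _ fun j hj => ?_)
  exact suppGE_inv_xv_sub_pow (hs j hj).1 (hs j hj).2 _ (by rw [hℓ, hℓs j hj]) (by simp [hℓ])

theorem suppGE_arrFn_xv {s : Finset ℕ} (hs : ∀ j ∈ s, j < n)
    (hℓs : ∀ j ∈ s, ℓ (ev n j) = 0) (a : ℕ → ℤ) (b : ℕ → ℕ) (c : ℕ → ℕ → ℕ) :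
    SuppGE ℓ 0 ((∏ i ∈ s, xv n i) * arrFn (xv n) s a b c) := by
  refine (SuppGE.prod _ _ fun i hi => suppGE_mono (hℓs i hi).ge).mul_zero
    (SuppGE.prod _ _ fun i hi => suppGE_rowFn_xv (hs i hi) (fun j hj => ?_) (hℓs i hi)
      (fun j hj => hℓs j (Finset.filter_subset _ _ hj)) _ _ _)
  rw [Finset.mem_filter] at hj
  exact ⟨hj.2, hs j hj.1⟩

/-- Without a factor 1 - x_k, and with x_k larger than every x_j, all exponents of x_k are at most A
+ 1 - Σ γ, which is negative. -/
theorem rowCT_xv_eq_zero {s : Finset ℕ} {k : ℕ} (hk : k < n) (hs : ∀ j ∈ s, k < j ∧ j < n)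
    (a : ℕ → ℤ) (c : ℕ → ℕ → ℕ) (A : ℤ) (γ b : ℕ → ℕ) (hA : A + 2 ≤ ∑ j ∈ s, (γ j : ℤ)) :
    rowCT (xv n) (xv n) k s a c A 0 γ b = 0 := by
  have hw : ∀ j < n, (wt n fun i => -Pi.single (M := fun _ => ℤ) k 1 i) (ev n j) =
      -Pi.single (M := fun _ => ℤ) k 1 j := fun j hj => wt_ev _ hj
  have hwk := hw k hk
  rw [Pi.single_eq_same] at hwk
  have hws : ∀ j ∈ s, (wt n fun i => -Pi.single (M := fun _ => ℤ) k 1 i) (ev n j) = 0 := by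
    intro j hj
    rw [hw j (hs j hj).2, Pi.single_eq_of_ne (hs j hj).1.ne', neg_zero]
  have h := ((suppGE_xv_zpow (d := -1) k 1 (by rw [hwk]; simp)).mul
    ((suppGE_xv_zpow (d := -A) k A (by rw [hwk]; simp)).mul
    (SuppGE.prod_sum s (fun j => ((xv n k - xv n j) ^ γ j)⁻¹) (fun j => (γ j : ℤ)) fun j hj =>
      suppGE_inv_xv_sub_pow (hs j hj).1 (hs j hj).2 _ (by rw [hwk, hws j hj]; simp)
        (by rw [hwk]; simp)))).mul_zero
    (suppGE_arrFn_xv (fun j hj => (hs j hj).2) hws a b c)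
  rw [rowCT, rowFn, pow_zero, inv_one, mul_one]
  rw [zpow_one] at h
  exact h.coeff_zero (by linarith)

theorem suppGE_single_arrFn_xv {s : Finset ℕ} {k : ℕ} (hs : ∀ j ∈ s, k < j ∧ j < n)
    (a : ℕ → ℤ) (b : ℕ → ℕ) (c : ℕ → ℕ → ℕ) :
    SuppGE (wt n (Pi.single k 1)) 0 ((∏ i ∈ s, xv n i) * arrFn (xv n) s a b c) := by
  refine suppGE_arrFn_xv (fun j hj => (hs j hj).2) (fun j hj => ?_) a b c
  rw [wt_ev _ (hs j hj).2, Pi.single_eq_of_ne (hs j hj).1.ne']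

theorem rowCT_xv_one {s : Finset ℕ} {k : ℕ} (hk : k < n) (hs : ∀ j ∈ s, k < j ∧ j < n)
    (a : ℕ → ℤ) (c : ℕ → ℕ → ℕ) {γ : ℕ → ℕ} (b : ℕ → ℕ) (hγ : ∀ j ∈ s, γ j = 0) :
    rowCT (xv n) (xv n) k s a c (-1) 1 γ b = arrCT (xv n) (xv n) s a b c := by
  rw [rowCT, rowFn_of_forall_eq_zero _ _ _ _ hγ, arrCT,
    ← coeff_zero_inv_one_sub_mul hk (suppGE_single_arrFn_xv hs a b c)]
  congr 2
  field_simp [xv_ne_zero]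

/-- Elimination of `x_k` when `1 - x_k` has exponent `-1`. -/
theorem rowCT_xv_merge {s : Finset ℕ} {k : ℕ} (hk : k < n) (hs : ∀ j ∈ s, k < j ∧ j < n)
    (a : ℕ → ℤ) (c : ℕ → ℕ → ℕ) {A : ℤ} (hA : A ≤ -1) (γ b : ℕ → ℕ) :
    rowCT (xv n) (xv n) k s a c A 1 γ b = arrCT (xv n) (xv n) s a (b + γ) c := by
  suffices H : ∀ p γ b, p = 1 →
      rowCT (xv n) (xv n) k s a c A p γ b = arrCT (xv n) (xv n) s a (b + γ) c from H 1 γ b rfl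
  refine partialFraction_induction s _ (by simp) ?_ ?_
  · rintro p γ b hγ rfl
    have : arrCT (xv n) (xv n) s a (b + γ) c = arrCT (xv n) (xv n) s a b c :=
      arrCT_congr _ _ (fun _ _ => rfl) (fun j hj => by simp [hγ j hj]) (fun _ _ _ _ _ => rfl)
    rw [this]
    -- Lowering `A` does not change the value: the correction term in the shift has no pole at 1, so
    -- it vanishes.
    induction A, hA using Int.leInductionDown with
    | base => exact rowCT_xv_one hk hs a c b hγ
    | pred A hA ih =>
      have := rowCT_shift (xv n) (xv n) s a c (A - 1) 0 γ b (xv_ne_zero k) (one_sub_xv_ne_zero hk)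
      rw [sub_add_cancel, zero_add, ih, rowCT_xv_eq_zero hk hs a c (A - 1) γ b, sub_zero] at this
      · exact this.symm
      · rw [Finset.sum_eq_zero fun j hj => by simp [hγ j hj]]; omega
  · rintro p γ b j hj hγ - ih hp
    obtain rfl : p = 0 := by omega
    rw [rowCT_partialFraction (xv n) (xv n) hj a c A 0 γ b hγ (one_sub_xv_ne_zero (hs j hj).2)
      (one_sub_xv_ne_zero hk) (xv_sub_xv_ne_zero (hs j hj).1 (hs j hj).2),
      rowCT_xv_eq_zero hk hs, zero_add, ih rfl]
    · congr 1
      funext i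
      by_cases h : i = j
      · subst h; simp; omega
      · simp [h]
    · have : (γ j : ℤ) ≤ ∑ j ∈ s, (γ j : ℤ) :=
        Finset.single_le_sum (f := fun j => (γ j : ℤ)) (fun i _ => by positivity) hj
      omega

/-- No pole at the origin: only positive powers of x_k occur. -/
theorem rowCT_xv_of_nonneg {s : Finset ℕ} {k : ℕ} (hk : k < n) (hs : ∀ j ∈ s, k < j ∧ j < n)
    (a : ℕ → ℤ) (c : ℕ → ℕ → ℕ) {A : ℤ} (hA : 0 ≤ A) (p : ℕ) {γ : ℕ → ℕ} (b : ℕ → ℕ)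
    (hγ : ∀ j ∈ s, γ j = 0) : rowCT (xv n) (xv n) k s a c A p γ b = 0 := by
  rw [rowCT, rowFn_of_forall_eq_zero _ _ _ _ hγ]
  have hwk : wt n (Pi.single k 1) (ev n k) = 1 := by rw [wt_ev _ hk, Pi.single_eq_same]
  have h := ((suppGE_xv_zpow (d := 1) k 1 (by rw [hwk]; simp)).mul
    ((suppGE_xv_zpow (d := A) k A (by rw [hwk]; simp)).mul_zero
    (suppGE_inv_one_sub_xv_pow hk p (by rw [hwk]; simp)))).mul_zero
    (suppGE_single_arrFn_xv hs a b c)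
  rw [zpow_one] at h
  exact h.coeff_zero (by linarith)

end Origin

/-! ### Expansion at the point with all coordinates `1` -/

section One

/-- The variables `1 - x_{n - i}`. -/
noncomputable def uv (n i : ℕ) : LaurentField n := 1 - xv n (n - i)

/-- The weights `x_{n - i}`. -/
noncomputable def uw (n i : ℕ) : LaurentField n := xv n (n - i)

theorem one_sub_uv (i : ℕ) : 1 - uv n i = uw n i := by rw [uv, uw]; ring

theorem uv_sub_uv (i j : ℕ) : uv n i - uv n j = xv n (n - j) - xv n (n - i) := by
  rw [uv, uv]; ring

theorem suppGE_rowFn_uv {s : Finset ℕ} {k : ℕ} (hk0 : 0 < k) (hk : k < n)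
    (hs : ∀ j ∈ s, k < j ∧ j < n) (hℓ : 0 ≤ ℓ (ev n (n - k)))
    (hℓs : ∀ j ∈ s, ℓ (ev n (n - j)) = 0)
    (A : ℤ) (p : ℕ) (γ : ℕ → ℕ) :
    SuppGE ℓ (-p * ℓ (ev n (n - k))) (rowFn (uv n) k s A p γ) := by
  refine SuppGE.mul_zero ?_ (SuppGE.prod _ _ fun j hj => ?_)
  · rw [one_sub_uv]
    have h := (suppGE_one_sub_xv_zpow (ℓ := ℓ) (i := n - k) (by omega) A hℓ).mul
      (suppGE_xv_zpow (ℓ := ℓ) (n - k) (-p) le_rfl)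
    rwa [zero_add, zpow_neg, zpow_natCast] at h
  · rw [uv_sub_uv]
    have := hs j hj
    exact suppGE_inv_xv_sub_pow (by omega) (by omega) _ (by rw [hℓs j hj]; exact hℓ)
      (by rw [hℓs j hj]; simp)

theorem suppGE_arrFn_uv {s : Finset ℕ} (hs : ∀ j ∈ s, 0 < j ∧ j < n)
    (hℓs : ∀ j ∈ s, ℓ (ev n (n - j)) = 0) (a : ℕ → ℤ) (b : ℕ → ℕ) (c : ℕ → ℕ → ℕ) :
    SuppGE ℓ 0 ((∏ i ∈ s, uw n i) * arrFn (uv n) s a b c) := by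
  refine (SuppGE.prod _ _ fun i hi => suppGE_mono (hℓs i hi).ge).mul_zero
    (SuppGE.prod _ _ fun i hi => ?_)
  have := suppGE_rowFn_uv (ℓ := ℓ) (s := s.filter (i < ·)) (hs i hi).1 (hs i hi).2
    (fun j hj => ?_) (hℓs i hi).ge
      (fun j hj => hℓs j (Finset.filter_subset _ _ hj)) (a i) (b i) (c i)
  · rwa [hℓs i hi, mul_zero] at this
  · rw [Finset.mem_filter] at hj
    exact ⟨hj.2, (hs j hj.1).2⟩

theorem wt_single_rev {s : Finset ℕ} {k : ℕ} (hk0 : 0 < k) (z : ℤ)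
    (hs : ∀ j ∈ s, k < j ∧ j < n) :
    ∀ j ∈ s, wt n (Pi.single (n - k) z) (ev n (n - j)) = 0 := by
  intro j hj
  have := hs j hj
  rw [wt_ev _ (by omega), Pi.single_eq_of_ne (by omega)]

/-- No pole at 1: the indices are reversed, so x_{n-k} is the smallest variable present, and it
occurs with positive powers only. -/
theorem rowCT_uv_eq_zero {s : Finset ℕ} {k : ℕ} (hk0 : 0 < k) (hk : k < n)
    (hs : ∀ j ∈ s, k < j ∧ j < n) (a : ℕ → ℤ) (c : ℕ → ℕ → ℕ) (A : ℤ) (γ b : ℕ → ℕ) :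
    rowCT (uv n) (uw n) k s a c A 0 γ b = 0 := by
  have hwk : wt n (Pi.single (n - k) 1) (ev n (n - k)) = 1 := by
    rw [wt_ev _ (by omega), Pi.single_eq_same]
  have hws := wt_single_rev hk0 1 hs
  have h := ((suppGE_xv_zpow (d := 1) (n - k) 1 (by rw [hwk]; simp)).mul
    (suppGE_rowFn_uv hk0 hk hs (by rw [hwk]; simp) hws A 0 γ)).mul_zero
    (suppGE_arrFn_uv (fun j hj => ⟨hk0.trans (hs j hj).1, (hs j hj).2⟩) hws a b c)
  rw [zpow_one] at h
  exact h.coeff_zero (by rw [hwk]; simp)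

theorem rowCT_uv_one {s : Finset ℕ} {k : ℕ} (hk0 : 0 < k) (hk : k < n)
    (hs : ∀ j ∈ s, k < j ∧ j < n) (a : ℕ → ℤ) (c : ℕ → ℕ → ℕ) (A : ℤ) {γ : ℕ → ℕ} (b : ℕ → ℕ)
    (hA : A = -1 ∨ A = 0) (hγ : ∀ j ∈ s, γ j = 0) :
    rowCT (uv n) (uw n) k s a c A 1 γ b = arrCT (uv n) (uw n) s a b c := by
  rw [rowCT, rowFn_of_forall_eq_zero _ _ _ _ hγ, one_sub_uv, pow_one, arrCT, mul_comm (uv n k ^ A),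
    ← mul_assoc (uw n k), mul_inv_cancel₀ (xv_ne_zero _), one_mul]
  obtain rfl | rfl := hA
  · rw [zpow_neg_one]
    exact coeff_zero_inv_one_sub_mul (by omega) (suppGE_arrFn_uv
      (fun j hj => ⟨hk0.trans (hs j hj).1, (hs j hj).2⟩) (wt_single_rev hk0 1 hs) a b c)
  · rw [zpow_zero, one_mul]

/-- In x = x_{n-k} the row is the Laurent polynomial x (1 - x)^A x^(-p), whose top degree A + 1 - p
is negative. -/
theorem rowCT_uv_of_nonneg {s : Finset ℕ} {k : ℕ} (hk0 : 0 < k) (hk : k < n)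
    (hs : ∀ j ∈ s, k < j ∧ j < n) (a : ℕ → ℤ) (c : ℕ → ℕ → ℕ) (A : ℕ) (p : ℕ) (hA : A + 2 ≤ p)
    {γ : ℕ → ℕ} (b : ℕ → ℕ)
    (hγ : ∀ j ∈ s, γ j = 0) : rowCT (uv n) (uw n) k s a c A p γ b = 0 := by
  have hwk : wt n (Pi.single (n - k) (-1)) (ev n (n - k)) = -1 := by
    rw [wt_ev _ (by omega), Pi.single_eq_same]
  have hu : SuppGE (wt n (Pi.single (n - k) (-1))) (-1) (uv n k) :=
    (suppGE_one.mono_le (by simp)).sub (suppGE_mono (by rw [hwk]))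
  rw [rowCT, rowFn_of_forall_eq_zero _ _ _ _ hγ, one_sub_uv]
  have h := ((suppGE_xv_zpow (d := -1) (n - k) 1 (by rw [hwk]; simp)).mul
    ((hu.pow' A).mul (suppGE_xv_zpow (d := p) (n - k) (-p) (by rw [hwk]; simp)))).mul_zero
    (suppGE_arrFn_uv (fun j hj => ⟨hk0.trans (hs j hj).1, (hs j hj).2⟩)
      (wt_single_rev hk0 (-1) hs) a b c)
  rw [zpow_one, zpow_neg, zpow_natCast] at h
  rw [zpow_natCast]
  exact h.coeff_zero (by linarith)

end One

/-! ### Expansion at infinity -/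

section Infinity

/-- The variables `x_i⁻¹`. -/
noncomputable def iv (n i : ℕ) : LaurentField n := (xv n i)⁻¹

/-- The weights `-x_i⁻¹`. -/
noncomputable def iw (n i : ℕ) : LaurentField n := -(xv n i)⁻¹

theorem one_sub_iv (i : ℕ) : 1 - iv n i = -((xv n i)⁻¹ * (1 - xv n i)) := by
  rw [iv]; field_simp [xv_ne_zero]; ring

theorem iv_sub_iv (i j : ℕ) :
    iv n i - iv n j = -((xv n j)⁻¹ * (1 - mono (ev n j - ev n i))) := by
  rw [iv, iv, mono_sub]
  change _ = -((xv n j)⁻¹ * (1 - xv n j / xv n i))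
  field_simp [xv_ne_zero]; ring

theorem SuppGE.neg_pow_inv {f : LaurentField n} {d : ℤ} (p : ℕ) (hf : SuppGE ℓ d ((f ^ p)⁻¹)) :
    SuppGE ℓ d (((-f) ^ p)⁻¹) := by
  rcases Nat.even_or_odd p with h | h
  · rwa [h.neg_pow]
  · rw [h.neg_pow, inv_neg]; exact hf.neg

theorem suppGE_iv_factor {i : ℕ} (hi : i < n) (p : ℕ) (h : 0 ≤ ℓ (ev n i)) :
    SuppGE ℓ (p * ℓ (ev n i)) (((1 - iv n i) ^ p)⁻¹) := by
  rw [one_sub_iv]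
  refine SuppGE.neg_pow_inv p ?_
  rw [mul_pow, mul_inv, inv_pow, inv_inv]
  have := suppGE_xv_zpow (ℓ := ℓ) i p le_rfl
  rw [zpow_natCast] at this
  exact this.mul_zero (suppGE_inv_one_sub_xv_pow hi p h)

theorem suppGE_iv_sub {i j : ℕ} (hij : i < j) (hj : j < n) (p : ℕ) (h : ℓ (ev n j) = 0)
    (hi : ℓ (ev n i) ≤ 0) : SuppGE ℓ 0 (((iv n i - iv n j) ^ p)⁻¹) := by
  rw [iv_sub_iv]
  refine SuppGE.neg_pow_inv p ?_
  rw [mul_pow, mul_inv, inv_pow, inv_inv]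
  have := suppGE_xv_zpow (ℓ := ℓ) (d := 0) j p (by rw [h]; simp)
  rw [zpow_natCast] at this
  exact this.mul_zero (suppGE_inv_one_sub_div_pow hij hj p (by rw [h]; exact hi))

theorem suppGE_rowFn_iv {s : Finset ℕ} {k : ℕ} (hk : k < n) (hs : ∀ j ∈ s, k < j ∧ j < n)
    (hℓ : ℓ (ev n k) = 0) (hℓs : ∀ j ∈ s, ℓ (ev n j) = 0) (A : ℤ) (p : ℕ) (γ : ℕ → ℕ) :
    SuppGE ℓ 0 (rowFn (iv n) k s A p γ) := by
  have h1 := suppGE_iv_factor hk p hℓ.ge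
  rw [hℓ, mul_zero] at h1
  refine (SuppGE.mul_zero ?_ h1).mul_zero (SuppGE.prod _ _ fun j hj =>
    suppGE_iv_sub (hs j hj).1 (hs j hj).2 _ (hℓs j hj) hℓ.le)
  rw [iv, inv_zpow, ← zpow_neg]
  exact suppGE_xv_zpow k (-A) (by simp [hℓ])

theorem suppGE_arrFn_iv {s : Finset ℕ} (hs : ∀ j ∈ s, j < n)
    (hℓs : ∀ j ∈ s, ℓ (ev n j) = 0) (a : ℕ → ℤ) (b : ℕ → ℕ) (c : ℕ → ℕ → ℕ) :
    SuppGE ℓ 0 ((∏ i ∈ s, iw n i) * arrFn (iv n) s a b c) := by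
  refine (SuppGE.prod _ _ fun i hi => SuppGE.neg ?_).mul_zero
    (SuppGE.prod _ _ fun i hi => suppGE_rowFn_iv (hs i hi) (fun j hj => ?_) (hℓs i hi)
      (fun j hj => hℓs j (Finset.filter_subset _ _ hj)) _ _ _)
  · rw [← zpow_neg_one]
    exact suppGE_xv_zpow i (-1) (by simp [hℓs i hi])
  · rw [Finset.mem_filter] at hj
    exact ⟨hj.2, hs j hj.1⟩

theorem suppGE_single_arrFn_iv {s : Finset ℕ} {k : ℕ} (z : ℤ) (hs : ∀ j ∈ s, k < j ∧ j < n)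
    (a : ℕ → ℤ) (b : ℕ → ℕ) (c : ℕ → ℕ → ℕ) :
    SuppGE (wt n (Pi.single k z)) 0 ((∏ i ∈ s, iw n i) * arrFn (iv n) s a b c) := by
  refine suppGE_arrFn_iv (fun j hj => (hs j hj).2) (fun j hj => ?_) a b c
  rw [wt_ev _ (hs j hj).2, Pi.single_eq_of_ne (hs j hj).1.ne']

/-- With no pole at 0 or at 1 in the variable x_k⁻¹, only negative powers of x_k remain. -/
theorem rowCT_iv_eq_zero {s : Finset ℕ} {k : ℕ} (hk : k < n) (hs : ∀ j ∈ s, k < j ∧ j < n)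
    (a : ℕ → ℤ) (c : ℕ → ℕ → ℕ) (A : ℕ) (γ b : ℕ → ℕ) :
    rowCT (iv n) (iw n) k s a c A 0 γ b = 0 := by
  have hwk : wt n (Pi.single k (-1)) (ev n k) = -1 := by rw [wt_ev _ hk, Pi.single_eq_same]
  have hws : ∀ j ∈ s, wt n (Pi.single k (-1)) (ev n j) = 0 := fun j hj => by
    rw [wt_ev _ (hs j hj).2, Pi.single_eq_of_ne (hs j hj).1.ne']
  have h := (((suppGE_xv_zpow (d := 1) k (-1) (by rw [hwk]; simp)).neg.mul
    ((suppGE_xv_zpow (d := A) k (-A) (by rw [hwk]; simp)).mul_zero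
    (SuppGE.prod s (fun j => ((iv n k - iv n j) ^ γ j)⁻¹) fun j hj =>
      suppGE_iv_sub (hs j hj).1 (hs j hj).2 _ (hws j hj) (by rw [hwk]; simp)))).mul_zero
    (suppGE_single_arrFn_iv (-1) hs a b c))
  rw [rowCT, rowFn, pow_zero, inv_one, mul_one]
  rw [zpow_neg_one, zpow_neg, ← inv_zpow] at h
  exact h.coeff_zero (by positivity)

theorem rowCT_iv_zero_one {s : Finset ℕ} {k : ℕ} (hk : k < n) (hs : ∀ j ∈ s, k < j ∧ j < n)
    (a : ℕ → ℤ) (c : ℕ → ℕ → ℕ) {γ : ℕ → ℕ} (b : ℕ → ℕ) (hγ : ∀ j ∈ s, γ j = 0) :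
    rowCT (iv n) (iw n) k s a c 0 1 γ b = arrCT (iv n) (iw n) s a b c := by
  rw [rowCT, rowFn_of_forall_eq_zero _ _ _ _ hγ, arrCT,
    ← coeff_zero_inv_one_sub_mul hk (suppGE_single_arrFn_iv 1 hs a b c), one_sub_iv, iw]
  congr 2
  field_simp [xv_ne_zero]

/-- Here (1 - x_k⁻¹)^(-p) starts with x_k^p, which outweighs the factor x_k⁻¹ of `iw`. -/
theorem rowCT_iv_zero_of_two_le {s : Finset ℕ} {k : ℕ} (hk : k < n)
    (hs : ∀ j ∈ s, k < j ∧ j < n) (a : ℕ → ℤ) (c : ℕ → ℕ → ℕ) {p : ℕ} (hp : 2 ≤ p)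
    {γ : ℕ → ℕ} (b : ℕ → ℕ) (hγ : ∀ j ∈ s, γ j = 0) :
    rowCT (iv n) (iw n) k s a c 0 p γ b = 0 := by
  have hwk : wt n (Pi.single k 1) (ev n k) = 1 := by rw [wt_ev _ hk, Pi.single_eq_same]
  rw [rowCT, rowFn_of_forall_eq_zero _ _ _ _ hγ, zpow_zero, one_mul]
  have h := ((suppGE_xv_zpow (d := -1) k (-1) (by rw [hwk]; simp)).neg.mul
    (suppGE_iv_factor hk p (by rw [hwk]; simp))).mul_zero (suppGE_single_arrFn_iv 1 hs a b c)
  rw [zpow_neg_one] at h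
  exact h.coeff_zero (by rw [hwk]; linarith)

end Infinity

end Residues

/-! ### Comparison of the three expansions -/

section ResidueTheorems

variable {n : ℕ}

theorem uv_ne_zero {i : ℕ} (hi0 : 0 < i) (hi : i < n) : uv n i ≠ 0 :=
  one_sub_xv_ne_zero (by omega)

theorem one_sub_uv_ne_zero (i : ℕ) : 1 - uv n i ≠ 0 := by
  rw [one_sub_uv]; exact xv_ne_zero _

theorem uv_sub_uv_ne_zero {i j : ℕ} (hij : i < j) (hi0 : 0 < i) (hj : j < n) :
    uv n i - uv n j ≠ 0 := by
  rw [uv_sub_uv]; exact xv_sub_xv_ne_zero (by omega) (by omega)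

theorem iv_ne_zero (i : ℕ) : iv n i ≠ 0 := inv_ne_zero (xv_ne_zero i)

theorem one_sub_iv_ne_zero {i : ℕ} (hi : i < n) : 1 - iv n i ≠ 0 := by
  rw [one_sub_iv]
  exact neg_ne_zero.2 (mul_ne_zero (inv_ne_zero (xv_ne_zero i)) (one_sub_xv_ne_zero hi))

theorem iv_sub_iv_ne_zero {i j : ℕ} (hij : i < j) (hj : j < n) : iv n i - iv n j ≠ 0 :=
  sub_ne_zero.2 fun h => (ev_lt_ev hij hj).ne (mono_injective (inv_injective h))

/-- If there is no pole at the origin, then expansion at infinity and at the point with all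
coordinates `1` give the same residue. -/
theorem arrCT_iv_eq_uv (s : Finset ℕ) (hs : ∀ j ∈ s, 0 < j ∧ j < n) (a : ℕ → ℤ)
    (ha : ∀ j ∈ s, 0 ≤ a j) (b : ℕ → ℕ) (c : ℕ → ℕ → ℕ) :
    arrCT (iv n) (iw n) s a b c = arrCT (uv n) (uw n) s a b c := by
  induction s using Finset.induction_on_min generalizing b with
  | empty => simp [arrCT, arrFn]
  | insert k s hks ih =>
    obtain ⟨hk0, hk⟩ := hs k (Finset.mem_insert_self k s)
    have hs' : ∀ j ∈ s, k < j ∧ j < n := fun j hj =>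
      ⟨hks j hj, (hs j (Finset.mem_insert_of_mem hj)).2⟩
    replace ih := ih (fun j hj => hs j (Finset.mem_insert_of_mem hj))
      (fun j hj => ha j (Finset.mem_insert_of_mem hj))
    rw [arrCT_insert _ _ hks, arrCT_insert _ _ hks]
    obtain ⟨A, hA⟩ := Int.eq_ofNat_of_zero_le (ha k (Finset.mem_insert_self k s))
    rw [hA]
    refine partialFraction_induction s (fun p γ b => rowCT (iv n) (iw n) k s a c A p γ b =
      rowCT (uv n) (uw n) k s a c A p γ b) ?_ ?_ ?_ _ _ _
    · intro γ b
      rw [rowCT_iv_eq_zero hk hs', rowCT_uv_eq_zero hk0 hk hs']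
    · intro p γ b hγ
      clear hA
      induction A generalizing p with
      | zero =>
        match p with
        | 0 => rw [rowCT_iv_eq_zero hk hs', rowCT_uv_eq_zero hk0 hk hs']
        | 1 =>
          rw [Nat.cast_zero, rowCT_iv_zero_one hk hs' a c b hγ,
            rowCT_uv_one hk0 hk hs' a c 0 b (Or.inr rfl) hγ, ih]
        | p + 2 =>
          rw [rowCT_uv_of_nonneg hk0 hk hs' a c 0 (p + 2) (by omega) b hγ, Nat.cast_zero,
            rowCT_iv_zero_of_two_le hk hs' a c (by omega) b hγ]
      | succ A ihA =>
        cases p with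
        | zero => rw [rowCT_iv_eq_zero hk hs', rowCT_uv_eq_zero hk0 hk hs']
        | succ p =>
          rw [Nat.cast_succ, rowCT_shift (iv n) (iw n) s a c A p γ b (iv_ne_zero k)
            (one_sub_iv_ne_zero hk), rowCT_shift (uv n) (uw n) s a c A p γ b (uv_ne_zero hk0 hk)
            (one_sub_uv_ne_zero k), ihA, ihA]
    · intro p γ b j hj hγ h1 h2
      rw [rowCT_partialFraction (iv n) (iw n) hj a c A p γ b hγ (one_sub_iv_ne_zero (hs' j hj).2)
        (one_sub_iv_ne_zero hk) (iv_sub_iv_ne_zero (hs' j hj).1 (hs' j hj).2),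
        rowCT_partialFraction (uv n) (uw n) hj a c A p γ b hγ (one_sub_uv_ne_zero j)
        (one_sub_uv_ne_zero k) (uv_sub_uv_ne_zero (hs' j hj).1 hk0 (hs' j hj).2), h1, h2]

/-- The residue theorem for v^A (1 - v)^(-p). Both sides vanish if A ≥ 0 or p = 0, both drop the
variable if A = -1 and p = 1, and the shift identity reaches all other exponents. -/
theorem rowCT_xv_eq_uv_of_forall_eq_zero {s : Finset ℕ} {k : ℕ} (hk0 : 0 < k) (hk : k < n)
    (hs : ∀ j ∈ s, k < j ∧ j < n) (a : ℕ → ℤ) (c : ℕ → ℕ → ℕ) {γ : ℕ → ℕ} (b : ℕ → ℕ)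
    (hγ : ∀ j ∈ s, γ j = 0)
    (ih : arrCT (xv n) (xv n) s a b c = arrCT (uv n) (uw n) s a b c) (p : ℕ) (A : ℤ)
    (hA : A + 2 ≤ p) :
    rowCT (xv n) (xv n) k s a c A p γ b = rowCT (uv n) (uw n) k s a c A p γ b := by
  have hpos : ∀ (A : ℤ) (p : ℕ), 0 ≤ A → A + 2 ≤ p →
      rowCT (xv n) (xv n) k s a c A p γ b = rowCT (uv n) (uw n) k s a c A p γ b := by
    intro A p h0 h2
    obtain ⟨A, rfl⟩ := Int.eq_ofNat_of_zero_le h0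
    rw [rowCT_xv_of_nonneg hk hs a c h0 p b hγ,
      rowCT_uv_of_nonneg hk0 hk hs a c A p (by omega) b hγ]
  have hzero : ∀ A : ℤ, A + 2 ≤ 0 →
      rowCT (xv n) (xv n) k s a c A 0 γ b = rowCT (uv n) (uw n) k s a c A 0 γ b := by
    intro A h2
    rw [rowCT_uv_eq_zero hk0 hk hs, rowCT_xv_eq_zero hk hs]
    rwa [Finset.sum_eq_zero fun j hj => by simp [hγ j hj]]
  have hshift : ∀ (A : ℤ) (p : ℕ),
      rowCT (xv n) (xv n) k s a c (A + 1) (p + 1) γ b =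
        rowCT (uv n) (uw n) k s a c (A + 1) (p + 1) γ b →
      rowCT (xv n) (xv n) k s a c A p γ b = rowCT (uv n) (uw n) k s a c A p γ b →
      rowCT (xv n) (xv n) k s a c A (p + 1) γ b = rowCT (uv n) (uw n) k s a c A (p + 1) γ b := by
    intro A p h1 h2
    rw [rowCT_shift (xv n) (xv n) s a c A p γ b (xv_ne_zero k) (one_sub_xv_ne_zero hk),
      rowCT_shift (uv n) (uw n) s a c A p γ b (uv_ne_zero hk0 hk) (one_sub_uv_ne_zero k), h2] at h1
    linarith
  induction p generalizing A with
  | zero => exact hzero A (by simpa using hA)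
  | succ p ihp =>
    push_cast at hA
    rcases le_or_gt 0 A with h0 | h0
    · exact hpos A (p + 1) h0 (by push_cast; omega)
    · have h0' : A ≤ -1 := by omega
      clear h0 hA
      induction A, h0' using Int.leInductionDown with
      | base =>
        cases p with
        | zero =>
          rw [rowCT_xv_one hk hs a c b hγ, ih,
            rowCT_uv_one hk0 hk hs a c (-1) b (Or.inl rfl) hγ]
        | succ p =>
          exact hshift _ _ (hpos _ _ (by omega) (by push_cast; omega))
            (ihp _ (by push_cast; omega))
      | pred A hA ihA =>
        refine hshift _ _ (by rwa [sub_add_cancel]) (ihp _ (by omega))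

/-- If there is no pole at infinity, then expansion at the origin and at the point with all
coordinates `1` give the same residue. -/
theorem arrCT_xv_eq_uv (s : Finset ℕ) (hs : ∀ j ∈ s, 0 < j ∧ j < n) (a : ℕ → ℤ) (b : ℕ → ℕ)
    (c : ℕ → ℕ → ℕ)
    (hadm : ∀ i ∈ s, a i + 2 ≤ b i + ∑ j ∈ s with i < j, (c i j : ℤ) +
      ∑ j ∈ s with j < i, (c j i : ℤ)) :
    arrCT (xv n) (xv n) s a b c = arrCT (uv n) (uw n) s a b c := by
  induction s using Finset.induction_on_min generalizing b with
  | empty => simp [arrCT, arrFn]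
  | insert k s hks ih =>
    obtain ⟨hk0, hk⟩ := hs k (Finset.mem_insert_self k s)
    have hs' : ∀ j ∈ s, k < j ∧ j < n := fun j hj =>
      ⟨hks j hj, (hs j (Finset.mem_insert_of_mem hj)).2⟩
    have hkns : k ∉ s := fun h => (hks k h).false
    replace ih := ih (fun j hj => hs j (Finset.mem_insert_of_mem hj))
    rw [arrCT_insert _ _ hks, arrCT_insert _ _ hks]
    have hadm_k : a k + 2 ≤ b k + ∑ j ∈ s, (c k j : ℤ) := by
      have := hadm k (Finset.mem_insert_self k s)
      rwa [Finset.filter_insert, if_neg (lt_irrefl k), Finset.filter_true_of_mem hks,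
        Finset.filter_insert, if_neg (lt_irrefl k),
        Finset.filter_false_of_mem fun j hj => (hks j hj).not_gt, Finset.sum_empty, add_zero] at this
    have hadm_s : ∀ i ∈ s, a i + 2 ≤ b i + c k i + (∑ j ∈ s with i < j, (c i j : ℤ) +
        ∑ j ∈ s with j < i, (c j i : ℤ)) := by
      intro i hi
      have := hadm i (Finset.mem_insert_of_mem hi)
      rw [Finset.filter_insert, if_neg (hks i hi).not_gt,
        Finset.filter_insert, if_pos (hks i hi), Finset.sum_insert (by simp [hkns])] at this
      linarith
    -- The absence of a pole at infinity in x_i is stated through `b i + γ i`, which does not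
    -- decrease when partial fractions move an exponent from `γ` to `b`.
    have key : ∀ (p : ℕ) (γ b : ℕ → ℕ), (∀ i ∈ s, a i + 2 ≤ b i + γ i + (∑ j ∈ s with i < j, (c i j : ℤ) +
        ∑ j ∈ s with j < i, (c j i : ℤ))) → ∀ A : ℤ, A + 2 ≤ p + ∑ j ∈ s, (γ j : ℤ) →
        rowCT (xv n) (xv n) k s a c A p γ b = rowCT (uv n) (uw n) k s a c A p γ b := by
      refine partialFraction_induction s _ ?_ ?_ ?_
      · intro γ b hb A hA
        rw [rowCT_uv_eq_zero hk0 hk hs', rowCT_xv_eq_zero hk hs']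
        simpa using hA
      · intro p γ b hγ hb A hA
        refine rowCT_xv_eq_uv_of_forall_eq_zero hk0 hk hs' a c b hγ (ih b fun i hi => ?_) p A ?_
        · have := hb i hi
          rw [hγ i hi] at this
          push_cast at this
          linarith
        · rwa [Finset.sum_eq_zero fun j hj => by simp [hγ j hj], add_zero] at hA
      · intro p γ b j hj hγ h1 h2 hb A hA
        have hb1 : ∀ i ∈ s, a i + 2 ≤ (Function.update b j (b j + 1) i : ℕ) + γ i +
            (∑ j ∈ s with i < j, (c i j : ℤ) + ∑ j ∈ s with j < i, (c j i : ℤ)) := by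
          intro i hi
          have := hb i hi
          by_cases h : i = j
          · subst h; rw [Function.update_self]; push_cast; linarith
          · rwa [Function.update_of_ne h]
        have hb2 : ∀ i ∈ s, a i + 2 ≤ (Function.update b j (b j + 1) i : ℕ) +
            (Function.update γ j (γ j - 1) i : ℕ) +
            (∑ j ∈ s with i < j, (c i j : ℤ) + ∑ j ∈ s with j < i, (c j i : ℤ)) := by
          intro i hi
          have := hb i hi
          by_cases h : i = j
          · subst h; rw [Function.update_self, Function.update_self]; push_cast [hγ]; linarith
          · rwa [Function.update_of_ne h, Function.update_of_ne h]
        have hsum : ∑ i ∈ s, (Function.update γ j (γ j - 1) i : ℤ) = ∑ i ∈ s, (γ i : ℤ) - 1 := by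
          rw [← Finset.add_sum_erase s _ hj, ← Finset.add_sum_erase s (fun i => (γ i : ℤ)) hj,
            Function.update_self, Nat.cast_sub hγ,
            Finset.sum_congr rfl fun i hi => by
              rw [Function.update_of_ne (Finset.ne_of_mem_erase hi)]]
          push_cast; ring
        -- Both terms of the partial fraction lose one unit of `p + Σ γ`, so they stay admissible
        -- only with slack one. In the boundary case the shift identity below first lowers `A`.
        have hlt : ∀ A : ℤ, A + 3 ≤ (p + 1 : ℕ) + ∑ j ∈ s, (γ j : ℤ) →
            rowCT (xv n) (xv n) k s a c A (p + 1) γ b =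
              rowCT (uv n) (uw n) k s a c A (p + 1) γ b := by
          intro A hA
          push_cast at hA
          rw [rowCT_partialFraction (xv n) (xv n) hj a c A p γ b hγ
            (one_sub_xv_ne_zero (hs' j hj).2) (one_sub_xv_ne_zero hk)
            (xv_sub_xv_ne_zero (hs' j hj).1 (hs' j hj).2),
            rowCT_partialFraction (uv n) (uw n) hj a c A p γ b hγ (one_sub_uv_ne_zero j)
            (one_sub_uv_ne_zero k) (uv_sub_uv_ne_zero (hs' j hj).1 hk0 (hs' j hj).2),
            h1 _ _ hb1 A (by linarith), h2 hb2 A (by rw [hsum]; push_cast; linarith)]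
        push_cast at hA
        have e1 := rowCT_shift (xv n) (xv n) s a c (A - 1) p γ b (xv_ne_zero k)
          (one_sub_xv_ne_zero hk)
        have e2 := rowCT_shift (uv n) (uw n) s a c (A - 1) p γ b (uv_ne_zero hk0 hk)
          (one_sub_uv_ne_zero k)
        rw [sub_add_cancel] at e1 e2
        rw [e1, e2, hlt (A - 1) (by push_cast; linarith), h1 γ b hb (A - 1) (by linarith)]
    exact key _ _ _ hadm_s _ hadm_k

end ResidueTheorems

/-! ### The polynomials binom(t + k, k) -/

open Polynomial in
/-- The polynomial `binom(t + k, k)` in `t`. -/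
noncomputable def risingPoly (k : ℕ) : Polynomial ℚ :=
  C ((k.factorial : ℚ)⁻¹) * ∏ l ∈ Finset.range k, (X + C ((l : ℚ) + 1))

section RisingPoly

open Polynomial

theorem risingPoly_zero : risingPoly 0 = 1 := by simp [risingPoly]

theorem natDegree_prod_linear (k : ℕ) :
    (∏ l ∈ Finset.range k, (X + C ((l : ℚ) + 1))).natDegree = k := by
  rw [natDegree_prod_of_monic _ _ fun _ _ => monic_X_add_C _]
  simp only [natDegree_X_add_C, Finset.sum_const, Finset.card_range, smul_eq_mul, mul_one]

theorem monic_prod_linear (k : ℕ) : (∏ l ∈ Finset.range k, (X + C ((l : ℚ) + 1))).Monic :=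
  monic_prod_of_monic _ _ fun _ _ => monic_X_add_C _

theorem leadingCoeff_risingPoly (k : ℕ) : (risingPoly k).leadingCoeff = (k.factorial : ℚ)⁻¹ := by
  rw [risingPoly, leadingCoeff_mul, leadingCoeff_C, monic_prod_linear, mul_one]

theorem degree_risingPoly (k : ℕ) : (risingPoly k).degree = k := by
  rw [risingPoly, degree_C_mul (inv_ne_zero (by positivity)),
    degree_eq_natDegree (monic_prod_linear k).ne_zero, natDegree_prod_linear]

theorem eval_risingPoly (k : ℕ) (t : ℚ) :
    (risingPoly k).eval t = (k.factorial : ℚ)⁻¹ * ∏ l ∈ Finset.range k, (t + (l + 1)) := by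
  simp [risingPoly, eval_prod]

/-- Pascal's rule. -/
theorem eval_risingPoly_succ_sub (k : ℕ) (t : ℚ) :
    (risingPoly (k + 1)).eval t - (risingPoly k).eval t = (risingPoly (k + 1)).eval (t - 1) := by
  rw [eval_risingPoly, eval_risingPoly, eval_risingPoly, Finset.prod_range_succ,
    Finset.prod_range_succ', Nat.factorial_succ]
  have : ∏ l ∈ Finset.range k, (t - 1 + (((l + 1 : ℕ) : ℚ) + 1)) =
      ∏ l ∈ Finset.range k, (t + ((l : ℚ) + 1)) :=
    Finset.prod_congr rfl fun l _ => by push_cast; ring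
  rw [this]
  have hk : (k.factorial : ℚ) ≠ 0 := by positivity
  have hk1 : (k : ℚ) + 1 ≠ 0 := by positivity
  push_cast
  field_simp
  ring

theorem eval_risingPoly_zero (k : ℕ) : (risingPoly k).eval 0 = 1 := by
  induction k with
  | zero => simp [risingPoly_zero]
  | succ k ih =>
    have h := eval_risingPoly_succ_sub k 0
    have h0 : (risingPoly (k + 1)).eval (0 - 1 : ℚ) = 0 := by
      rw [eval_risingPoly, Finset.prod_range_succ']; simp
    rw [h0, ih] at h
    linarith

theorem eval_risingPoly_neg {k j : ℕ} (hj : 1 ≤ j) (hjk : j ≤ k) :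
    (risingPoly k).eval (-j : ℚ) = 0 := by
  rw [eval_risingPoly, Finset.prod_eq_zero (i := j - 1) (by simp; omega), mul_zero]
  push_cast [hj]; ring

end RisingPoly

/-! ### The binomial series of (1 - x)^(-t-1) -/

section BinomialSeries

variable {n : ℕ} {ℓ : ExpVec n →+ ℤ}

theorem SuppGE.smul {Γ : Type*} [AddCommGroup Γ] [LinearOrder Γ] [IsOrderedAddMonoid Γ]
    {ℓ : Γ →+ ℤ} {d : ℤ} {f : HahnSeries Γ ℚ} (r : ℚ) (hf : SuppGE ℓ d f) : SuppGE ℓ d (r • f) := by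
  intro γ hγ
  exact hf γ fun h => hγ (by simp [h])

theorem sum_risingPoly_mul_one_sub (x : LaurentField n) (K : ℕ) (t : ℚ) :
    (∑ k ∈ Finset.range (K + 1), (risingPoly k).eval t • x ^ k) * (1 - x) =
      ∑ k ∈ Finset.range (K + 1), (risingPoly k).eval (t - 1) • x ^ k -
        (risingPoly K).eval t • x ^ (K + 1) := by
  induction K with
  | zero => simp [risingPoly_zero]
  | succ K ih =>
    rw [Finset.sum_range_succ, add_mul, ih, Finset.sum_range_succ _ (K + 1),
      ← eval_risingPoly_succ_sub]
    simp only [Algebra.smul_def, map_sub]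
    ring

/-- The truncated binomial series. -/
theorem suppGE_binomialSeries {i : ℕ} (hi : i < n) (hℓ : ℓ (ev n i) = 1) (K : ℕ) (t : ℤ) :
    SuppGE ℓ (K + 1) ((1 - xv n i) ^ (-t - 1) -
      ∑ k ∈ Finset.range (K + 1), (risingPoly k).eval (t : ℚ) • xv n i ^ k) := by
  have hx : ∀ r : ℚ, SuppGE ℓ (K + 1) (r • xv n i ^ (K + 1)) := by
    intro r
    have := suppGE_xv_zpow (ℓ := ℓ) (d := (K + 1 : ℕ)) i (K + 1 : ℕ) (by rw [hℓ, mul_one])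
    rw [zpow_natCast] at this
    push_cast at this
    exact this.smul r
  have h1 := one_sub_xv_ne_zero hi
  have hrec : ∀ t : ℤ, ((1 - xv n i) ^ (-t - 1) -
      ∑ k ∈ Finset.range (K + 1), (risingPoly k).eval (t : ℚ) • xv n i ^ k) * (1 - xv n i) =
      (1 - xv n i) ^ (-(t - 1) - 1) -
      ∑ k ∈ Finset.range (K + 1), (risingPoly k).eval ((t - 1 : ℤ) : ℚ) • xv n i ^ k +
      (risingPoly K).eval (t : ℚ) • xv n i ^ (K + 1) := by
    intro t
    rw [sub_mul, sum_risingPoly_mul_one_sub, ← zpow_add_one₀ h1]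
    push_cast
    rw [show -(t - 1) - 1 = -t - 1 + 1 by ring]
    ring
  have hneg1 : SuppGE ℓ (K + 1) ((1 - xv n i) ^ (-(-1 : ℤ) - 1) -
      ∑ k ∈ Finset.range (K + 1), (risingPoly k).eval ((-1 : ℤ) : ℚ) • xv n i ^ k) := by
    have h0 : ∑ k ∈ Finset.range (K + 1), (risingPoly k).eval ((-1 : ℤ) : ℚ) • xv n i ^ k = 1 := by
      rw [Finset.sum_range_succ', Finset.sum_eq_zero, risingPoly_zero]
      · simp
      · intro k _
        have := eval_risingPoly_neg (k := k + 1) le_rfl (by omega)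
        push_cast at this ⊢
        rw [this, zero_smul]
    rw [h0]
    simp only [neg_neg, sub_self, zpow_zero]
    intro γ hγ
    simp at hγ
  have hup : ∀ t : ℤ, SuppGE ℓ (K + 1) ((1 - xv n i) ^ (-(t - 1) - 1) -
      ∑ k ∈ Finset.range (K + 1), (risingPoly k).eval ((t - 1 : ℤ) : ℚ) • xv n i ^ k) →
      SuppGE ℓ (K + 1) ((1 - xv n i) ^ (-t - 1) -
        ∑ k ∈ Finset.range (K + 1), (risingPoly k).eval (t : ℚ) • xv n i ^ k) := by
    intro t ht
    rw [← mul_inv_cancel_right₀ h1 ((1 - xv n i) ^ (-t - 1) - _), hrec]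
    exact (ht.add (hx _)).inv_one_sub (ev_pos hi) (by rw [hℓ]; simp)
  have hdown : ∀ t : ℤ, SuppGE ℓ (K + 1) ((1 - xv n i) ^ (-t - 1) -
        ∑ k ∈ Finset.range (K + 1), (risingPoly k).eval (t : ℚ) • xv n i ^ k) →
      SuppGE ℓ (K + 1) ((1 - xv n i) ^ (-(t - 1) - 1) -
      ∑ k ∈ Finset.range (K + 1), (risingPoly k).eval ((t - 1 : ℤ) : ℚ) • xv n i ^ k) := by
    intro t ht
    rw [← sub_eq_of_eq_add (hrec t)]
    exact (ht.mul_zero (suppGE_one_sub (by rw [hℓ]; simp))).sub (hx _)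
  have e : t = (t + 1) - 1 := by ring
  -- The expansion is trivial at t = -1, and multiplication by 1 - x passes from t to t - 1; hence
  -- the two directions `hup` and `hdown`.
  induction t using Int.induction_on with
  | zero => exact hup 0 (by simpa using hneg1)
  | succ i ih => exact hup _ (by simpa using ih (by ring))
  | pred i ih => exact hdown _ (ih (by ring))

end BinomialSeries

/-! ### The exponents that occur in `barH` -/

section Parameters

/-- The exponents of `x_1, …, x_m`: `-t - 1` for the last variable, and `A` for the others. -/
def aPar (m : ℕ) (A t : ℤ) (i : ℕ) : ℤ := if i = m then -t - 1 else A

/-- The exponents of `(1 - x_i)⁻¹`. -/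
def bPar (m i : ℕ) : ℕ := if i = m then 2 else 3

/-- The exponents of `(x_i - x_j)⁻¹`. -/
def cPar (m _i j : ℕ) : ℕ := if j = m then 1 else 2

theorem sum_cPar {m i : ℕ} (hi : i < m) :
    ∑ j ∈ Finset.Ico (i + 1) (m + 1), (cPar m i j : ℤ) = 2 * (m - i) - 1 := by
  rw [Finset.sum_Ico_succ_top (by omega), Finset.sum_congr rfl fun j hj => by
    rw [cPar, if_neg (Finset.mem_Ico.1 hj).2.ne]]
  rw [cPar, if_pos rfl, Finset.sum_const, Nat.card_Ico, nsmul_eq_mul, Nat.cast_sub (by omega)]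
  push_cast; ring

theorem filter_lt_Ico {m i : ℕ} (hi : 0 < i) :
    (Finset.Ico 1 (m + 1)).filter (i < ·) = Finset.Ico (i + 1) (m + 1) := by
  ext j; simp only [Finset.mem_filter, Finset.mem_Ico]; omega

theorem filter_gt_Ico {m i : ℕ} (hi : i ≤ m) :
    (Finset.Ico 1 (m + 1)).filter (· < i) = Finset.Ico 1 i := by
  ext j; simp only [Finset.mem_filter, Finset.mem_Ico]; omega

theorem bPar_add_sum_cPar {m i : ℕ} (hi : i ≤ m) :
    (bPar m i : ℤ) + ∑ j ∈ Finset.Ico (i + 1) (m + 1), (cPar m i j : ℤ) = 2 * (m - i) + 2 := by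
  rcases hi.eq_or_lt with rfl | hi
  · simp [bPar]
  · rw [sum_cPar hi, bPar, if_neg hi.ne]; push_cast; ring

/-- For i < m the right side is 2m, whatever i is. For i = m the left side is 1 - t, and the
exponent `bPar` alone suffices because t ≥ 0. -/
theorem aPar_admissible {m : ℕ} {A t : ℤ} (hA : A ≤ m - 1) (ht : 0 ≤ t) :
    ∀ i ∈ Finset.Ico 1 (m + 1), aPar m A t i + 2 ≤ bPar m i +
      ∑ j ∈ Finset.Ico 1 (m + 1) with i < j, (cPar m i j : ℤ) +
      ∑ j ∈ Finset.Ico 1 (m + 1) with j < i, (cPar m j i : ℤ) := by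
  intro i hi
  rw [Finset.mem_Ico] at hi
  rw [filter_lt_Ico (by omega), filter_gt_Ico (by omega), bPar_add_sum_cPar (by omega)]
  by_cases him : i = m
  · subst him
    have : 0 ≤ ∑ j ∈ Finset.Ico 1 i, (cPar i j i : ℤ) := by positivity
    rw [aPar, if_pos rfl]; linarith
  · have : ∑ j ∈ Finset.Ico 1 i, (cPar m j i : ℤ) = 2 * (i - 1) := by
      rw [Finset.sum_congr rfl fun j hj => by rw [cPar, if_neg him], Finset.sum_const,
        Nat.card_Ico, nsmul_eq_mul, Nat.cast_sub hi.1]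
      push_cast; ring
    rw [this, aPar, if_neg him]
    have : (1 : ℤ) ≤ i := by omega
    have : (i : ℤ) < m := by omega
    linarith

theorem sum_odd_Ico (m : ℕ) (M : ℤ) :
    ∑ i ∈ Finset.Ico 1 (m + 1), (2 * (M - i) + 1) = 2 * M * m - (m : ℤ) ^ 2 := by
  induction m with
  | zero => simp
  | succ m ih => rw [Finset.sum_Ico_succ_top (by omega), ih]; push_cast; ring

/-- The series `∏ W_i · arrFn` at the point with all coordinates `1`, without the factor that
depends on `t`. -/
noncomputable def oneBase (m A : ℕ) : LaurentField (m + 1) :=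
  (∏ i ∈ Finset.Ico 1 (m + 1), uw (m + 1) i) *
    arrFn (uv (m + 1)) (Finset.Ico 1 (m + 1)) (aPar m A (-1)) (bPar m) (cPar m)

/-- The choice t = -1 on the right makes the exponent of the last variable zero, so all dependence
on t is in the factor in front. -/
theorem arrFn_aPar {F : Type*} [Field F] (v : ℕ → F) {m : ℕ} (hm : 1 ≤ m) (A t : ℤ) :
    arrFn v (Finset.Ico 1 (m + 1)) (aPar m A t) (bPar m) (cPar m) =
      v m ^ (-t - 1) *
        arrFn v (Finset.Ico 1 (m + 1)) (aPar m A (-1)) (bPar m) (cPar m) := by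
  rw [arrFn, arrFn, Finset.prod_Ico_succ_top hm, Finset.prod_Ico_succ_top hm]
  rw [Finset.prod_congr rfl fun i hi => by
    rw [aPar, if_neg (Finset.mem_Ico.1 hi).2.ne]]
  rw [Finset.prod_congr (g := fun i => rowFn v i _ (aPar m A (-1) i) _ _) rfl fun i hi => by
    rw [aPar, if_neg (Finset.mem_Ico.1 hi).2.ne]]
  simp only [rowFn, aPar, if_pos, sub_self, neg_neg, zpow_zero]
  ring

end Parameters

/-! ### Series with leading term 1 -/

section UnitSeries

variable {Γ : Type*} [AddCommGroup Γ] [LinearOrder Γ] [IsOrderedAddMonoid Γ]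
  {ℓ : Γ →+ ℤ} {d : ℤ} {f g : HahnSeries Γ ℚ}

/-- `f` is `1` plus terms on which `ℓ` is positive. -/
def UnitGE (ℓ : Γ →+ ℤ) (f : HahnSeries Γ ℚ) : Prop := SuppGE ℓ 1 (f - 1)

theorem UnitGE.suppGE (hf : UnitGE ℓ f) : SuppGE ℓ 0 f := by
  simpa using (hf.mono_le zero_le_one).add suppGE_one

theorem unitGE_one : UnitGE ℓ (1 : HahnSeries Γ ℚ) := by
  intro γ hγ
  simp at hγ

theorem UnitGE.mul (hf : UnitGE ℓ f) (hg : UnitGE ℓ g) : UnitGE ℓ (f * g) := by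
  have h : f * g - 1 = (f - 1) * g + (g - 1) := by ring
  rw [UnitGE, h]
  exact (SuppGE.mul_zero hf hg.suppGE).add hg

theorem UnitGE.pow (hf : UnitGE ℓ f) (k : ℕ) : UnitGE ℓ (f ^ k) := by
  induction k with
  | zero => simpa using unitGE_one
  | succ k ih => rw [pow_succ]; exact ih.mul hf

theorem UnitGE.prod {ι : Type*} (s : Finset ι) (F : ι → HahnSeries Γ ℚ)
    (h : ∀ i ∈ s, UnitGE ℓ (F i)) : UnitGE ℓ (∏ i ∈ s, F i) := by
  classical
  induction s using Finset.induction_on with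
  | empty => simpa using unitGE_one
  | insert a s ha ih =>
    rw [Finset.prod_insert ha]
    exact (h a (by simp)).mul (ih fun i hi => h i (by simp [hi]))

theorem unitGE_one_sub {a : Γ} (hl : 1 ≤ ℓ a) : UnitGE ℓ (1 - mono a) := by
  rw [UnitGE, sub_sub_cancel_left]
  exact (suppGE_mono hl).neg

theorem unitGE_inv_one_sub {a : Γ} (ha : 0 < a) (hl : 1 ≤ ℓ a) : UnitGE ℓ ((1 - mono a)⁻¹) := by
  have h : (1 - mono a)⁻¹ - 1 = mono a * (1 - mono a)⁻¹ := by
    field_simp [one_sub_mono_ne_zero ha.ne']; ring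
  rw [UnitGE, h]
  exact (suppGE_mono hl).inv_one_sub ha (by linarith)

theorem unitGE_inv_one_sub_pow {a : Γ} (ha : 0 < a) (hl : 1 ≤ ℓ a) (p : ℕ) :
    UnitGE ℓ (((1 - mono a) ^ p)⁻¹) := by
  rw [← inv_pow]; exact (unitGE_inv_one_sub ha hl).pow p

theorem UnitGE.coeff_mul_zero (hf : UnitGE ℓ f) (hg : SuppGE ℓ 0 g) :
    (f * g).coeff 0 = g.coeff 0 := by
  have h : f * g = g + (f - 1) * g := by ring
  rw [h, HahnSeries.coeff_add, (SuppGE.mul_zero hf hg).coeff_zero one_pos, add_zero]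

end UnitSeries

/-! ### Polynomiality, degree and the zeros -1, …, -m -/

section Polynomiality

variable {n : ℕ} {ℓ : ExpVec n →+ ℤ}

theorem suppGE_rowFn_uv_const {s : Finset ℕ} {k : ℕ} {z D : ℤ} (hk0 : 0 < k) (hk : k < n)
    (hs : ∀ j ∈ s, k < j ∧ j < n) (hz : ∀ j < n, ℓ (ev n j) = z)
    (A : ℤ) (p : ℕ) (γ : ℕ → ℕ) (hD : SuppGE ℓ D (uv n k ^ A)) :
    SuppGE ℓ (D - z * (p + ∑ j ∈ s, (γ j : ℤ))) (rowFn (uv n) k s A p γ) := by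
  rw [rowFn, one_sub_uv, uw]
  have h1 := suppGE_xv_zpow (ℓ := ℓ) (n - k) (-p) le_rfl
  rw [zpow_neg, zpow_natCast] at h1
  refine ((hD.mul h1).mul (SuppGE.prod_sum s _ (fun j => -γ j * z) fun j hj => ?_)).mono_le ?_
  · rw [uv_sub_uv]
    have := hs j hj
    exact suppGE_inv_xv_sub_pow (by omega) (by omega) _
      (by rw [hz _ (by omega), hz _ (by omega)]) (by rw [hz _ (by omega)])
  · rw [hz _ (by omega), ← Finset.sum_mul, Finset.sum_neg_distrib]
    exact le_of_eq (by ring)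

/-- With `z = 1` and `z = -1` this bounds the total degree from below and from above. The weights
contribute m and the denominators -(m² + m), whence m². -/
theorem suppGE_oneBase {m A : ℕ} {ℓ : ExpVec (m + 1) →+ ℤ} {z : ℤ}
    (hz : ∀ j < m + 1, ℓ (ev (m + 1) j) = z) {D : ℕ → ℤ}
    (hD : ∀ i ∈ Finset.Ico 1 (m + 1), SuppGE ℓ (D i) (uv (m + 1) i ^ aPar m A (-1) i)) :
    SuppGE ℓ (∑ i ∈ Finset.Ico 1 (m + 1), D i - z * (m : ℤ) ^ 2) (oneBase m A) := by
  have h := (SuppGE.prod_sum (ℓ := ℓ) (Finset.Ico 1 (m + 1)) (uw (m + 1)) (fun _ => z)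
    fun i hi => suppGE_mono (by
      rw [hz _ (by have := Finset.mem_Ico.1 hi; omega)])).mul
    (SuppGE.prod_sum (Finset.Ico 1 (m + 1)) _ _ fun i hi => suppGE_rowFn_uv_const
      (s := (Finset.Ico 1 (m + 1)).filter (i < ·))
      (Finset.mem_Ico.1 hi).1 (Finset.mem_Ico.1 hi).2 (fun j hj => by
        rw [Finset.mem_filter, Finset.mem_Ico] at hj; omega) hz (aPar m A (-1) i) (bPar m i)
        (cPar m i) (hD i hi))
  refine h.mono_le (le_of_eq ?_)
  have e : ∀ i ∈ Finset.Ico 1 (m + 1), (D i - z * (bPar m i +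
      ∑ j ∈ Finset.Ico 1 (m + 1) with i < j, (cPar m i j : ℤ))) =
      D i - z * (2 * (m - i) + 1) - z := by
    intro i hi
    rw [Finset.mem_Ico] at hi
    rw [filter_lt_Ico (by omega), bPar_add_sum_cPar (by omega)]; ring
  rw [Finset.sum_congr rfl e, Finset.sum_sub_distrib, Finset.sum_sub_distrib, ← Finset.mul_sum,
    sum_odd_Ico]
  ring

theorem suppGE_tot_oneBase (m A : ℕ) :
    SuppGE (wt (m + 1) fun _ => 1) (-(m : ℤ) ^ 2) (oneBase m A) := by
  refine (suppGE_oneBase (z := 1) (D := fun _ => 0) (fun j hj => wt_ev _ hj)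
    fun i hi => ?_).mono_le (by simp)
  rw [Finset.mem_Ico] at hi
  exact suppGE_one_sub_xv_zpow (by omega) _ (by rw [wt_ev _ (by omega)]; simp)

theorem sum_aPar {m : ℕ} (hm : 1 ≤ m) (A t : ℤ) :
    ∑ i ∈ Finset.Ico 1 (m + 1), aPar m A t i = A * (m - 1) - t - 1 := by
  rw [Finset.sum_Ico_succ_top hm, Finset.sum_congr rfl fun i hi => by
    rw [aPar, if_neg (Finset.mem_Ico.1 hi).2.ne], aPar, if_pos rfl, Finset.sum_const,
    Nat.card_Ico, nsmul_eq_mul, Nat.cast_sub hm]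
  push_cast; ring

theorem suppGE_negTot_oneBase {m : ℕ} (hm : 1 ≤ m) (A : ℕ) :
    SuppGE (wt (m + 1) fun _ => -1) ((m : ℤ) ^ 2 - A * (m - 1)) (oneBase m A) := by
  refine (suppGE_oneBase (z := -1) (D := fun i => -aPar m A (-1) i) (fun j hj => wt_ev _ hj)
    fun i hi => ?_).mono_le ?_
  · rw [Finset.mem_Ico] at hi
    have hu : SuppGE (wt (m + 1) fun _ => -1) (-1) (uv (m + 1) i) :=
      (suppGE_one.mono_le (by simp)).sub (suppGE_mono (by rw [wt_ev _ (by omega)]))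
    obtain ⟨a, ha⟩ : ∃ a : ℕ, aPar m A (-1) i = a := by
      rw [aPar]; split_ifs
      · exact ⟨0, by simp⟩
      · exact ⟨A, rfl⟩
    rw [ha, zpow_natCast]
    exact (hu.pow' a).mono_le (by linarith)
  · rw [Finset.sum_neg_distrib, sum_aPar hm]; linarith

/-- The coefficients of the polynomial `flowPoly` in the basis `risingPoly`. -/
noncomputable def flowPolyCoeff (m A k : ℕ) : ℚ :=
  (xv (m + 1) 1 ^ k * oneBase m A).coeff 0

open Polynomial in
/-- The polynomial with values `arrCT`, as a function of the exponent of the last variable. -/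
noncomputable def flowPoly (m A : ℕ) : Polynomial ℚ :=
  ∑ k ∈ Finset.range (m ^ 2 + 1), C (flowPolyCoeff m A k) * risingPoly k

/-- The tail of the binomial series beyond m² has total degree above m², so after multiplication by
`oneBase` it cannot reach degree 0. -/
theorem arrCT_uv_eq_eval {m : ℕ} (hm : 1 ≤ m) (A : ℕ) (t : ℤ) :
    arrCT (uv (m + 1)) (uw (m + 1)) (Finset.Ico 1 (m + 1)) (aPar m A t) (bPar m) (cPar m) =
      (flowPoly m A).eval (t : ℚ) := by
  have hv : uv (m + 1) m = 1 - xv (m + 1) 1 := by rw [uv, Nat.add_sub_cancel_left]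
  have h1 : (wt (m + 1) fun _ => 1) (ev (m + 1) 1) = 1 := wt_ev _ (by omega)
  have hb := (suppGE_binomialSeries (n := m + 1) (i := 1) (by omega) h1 (m ^ 2) t).mul
    (suppGE_tot_oneBase m A)
  have hz := hb.coeff_zero (by push_cast; linarith)
  rw [sub_mul, HahnSeries.coeff_sub, sub_eq_zero] at hz
  rw [arrCT, arrFn_aPar _ hm, hv, mul_left_comm, ← oneBase, hz, Finset.sum_mul, flowPoly,
    Polynomial.eval_finsetSum, HahnSeries.coeff_sum]
  refine Finset.sum_congr rfl fun k _ => ?_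
  rw [Polynomial.eval_mul, Polynomial.eval_C, smul_mul_assoc, HahnSeries.coeff_smul,
    flowPolyCoeff, smul_eq_mul, mul_comm]

/-- The total degree is at most k + A(m - 1) - m², which is negative. -/
theorem flowPolyCoeff_eq_zero {m A k : ℕ} (hm : 1 ≤ m) (hk : k + A * (m - 1) < m ^ 2) :
    flowPolyCoeff m A k = 0 := by
  have h := (suppGE_xv_zpow (ℓ := wt (m + 1) fun _ => -1) (d := -k) 1 k
    (by rw [wt_ev _ (by omega)]; simp)).mul (suppGE_negTot_oneBase hm A)
  rw [zpow_natCast] at h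
  refine h.coeff_zero ?_
  zify [hm] at hk
  linarith

theorem oneBase_eq {m : ℕ} (hm : 1 ≤ m) (A : ℕ) :
    oneBase m A = (∏ i ∈ Finset.Ico 1 m, uv (m + 1) i ^ A) * oneBase m 0 := by
  rw [oneBase, oneBase, mul_left_comm]
  congr 1
  rw [arrFn, arrFn, Finset.prod_Ico_succ_top hm, Finset.prod_Ico_succ_top hm, ← mul_assoc,
    ← Finset.prod_mul_distrib]
  congr 1
  · refine Finset.prod_congr rfl fun i hi => ?_
    rw [aPar, aPar, if_neg (Finset.mem_Ico.1 hi).2.ne, if_neg (Finset.mem_Ico.1 hi).2.ne]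
    simp only [rowFn, Nat.cast_zero, zpow_zero, zpow_natCast]; ring
  · simp [aPar]

/-- The top coefficient as a constant term. -/
theorem flowPolyCoeff_top {m : ℕ} (hm : 1 ≤ m) (A : ℕ) :
    flowPolyCoeff m A (m ^ 2) =
      arrCT (xv (m + 1)) (xv (m + 1)) (Finset.Ico 1 (m + 1)) (aPar m 0 0) (bPar m) (cPar m) := by
  -- At k = m² only the part of lowest total degree counts, and there the factors (1 - x)^A are 1.
  have h0 : flowPolyCoeff m A (m ^ 2) = flowPolyCoeff m 0 (m ^ 2) := by
    rw [flowPolyCoeff, oneBase_eq hm, mul_left_comm]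
    refine UnitGE.coeff_mul_zero (ℓ := wt (m + 1) fun _ => 1)
      (UnitGE.prod _ _ fun i hi => UnitGE.pow (unitGE_one_sub ?_) A) ?_
    · have := Finset.mem_Ico.1 hi
      rw [wt_ev _ (by omega)]
    · have := (suppGE_xv_zpow (ℓ := wt (m + 1) fun _ => 1) (d := (m : ℤ) ^ 2) 1 ((m ^ 2 : ℕ) : ℤ)
        (by rw [wt_ev _ (by omega)]; simp)).mul (suppGE_tot_oneBase m 0)
      rwa [zpow_natCast, add_neg_cancel] at this
  rw [h0, arrCT_xv_eq_uv _ (fun j hj => by rw [Finset.mem_Ico] at hj; omega) _ _ _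
    (aPar_admissible (by omega) le_rfl)]
  -- For `A = 0` all coefficients below the top vanish, so the polynomial is a multiple of binom(t +
  -- m², m²), and its value at t = 0 is the top coefficient.
  have h := arrCT_uv_eq_eval hm 0 0
  rw [Nat.cast_zero] at h
  rw [h, flowPoly, Polynomial.eval_finsetSum, Finset.sum_eq_single (m ^ 2)]
  · rw [Polynomial.eval_mul, Polynomial.eval_C, Int.cast_zero, eval_risingPoly_zero, mul_one]
  · intro k hk hne
    rw [Finset.mem_range] at hk
    rw [flowPolyCoeff_eq_zero hm (by omega)]; simp
  · simp

open Polynomial in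
theorem degree_flowPoly {m A : ℕ} (h : flowPolyCoeff m A (m ^ 2) ≠ 0) :
    (flowPoly m A).degree = (m ^ 2 : ℕ) ∧
      (flowPoly m A).leadingCoeff = flowPolyCoeff m A (m ^ 2) / ((m ^ 2).factorial : ℚ) := by
  have htop : (C (flowPolyCoeff m A (m ^ 2)) * risingPoly (m ^ 2)).degree = (m ^ 2 : ℕ) := by
    rw [degree_C_mul h, degree_risingPoly]
  have hlow : (∑ k ∈ Finset.range (m ^ 2), C (flowPolyCoeff m A k) * risingPoly k).degree <
      (C (flowPolyCoeff m A (m ^ 2)) * risingPoly (m ^ 2)).degree := by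
    rw [htop, ← mem_degreeLT]
    refine Submodule.sum_mem _ fun k hk => ?_
    rw [mem_degreeLT]
    rw [← smul_eq_C_mul]
    refine (degree_smul_le _ _).trans_lt ?_
    rw [degree_risingPoly]
    exact_mod_cast Finset.mem_range.1 hk
  rw [flowPoly, Finset.sum_range_succ, degree_add_eq_right_of_degree_lt hlow,
    leadingCoeff_add_of_degree_lt hlow, htop, leadingCoeff_mul, leadingCoeff_C,
    leadingCoeff_risingPoly, div_eq_mul_inv]
  exact ⟨rfl, rfl⟩

/-- Only k ≥ m survive, and binom(t + k, k) vanishes at t = -1, …, -k. -/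
theorem flowPoly_eval_neg {m A : ℕ} (hm : 1 ≤ m) (hA : m + A * (m - 1) ≤ m ^ 2) {j : ℕ}
    (hj1 : 1 ≤ j) (hj : j ≤ m) : (flowPoly m A).eval (-j : ℚ) = 0 := by
  rw [flowPoly, Polynomial.eval_finsetSum]
  refine Finset.sum_eq_zero fun k _ => ?_
  rw [Polynomial.eval_mul, Polynomial.eval_C]
  rcases lt_or_ge k m with hk | hk
  · rw [flowPolyCoeff_eq_zero hm (by omega), zero_mul]
  · rw [eval_risingPoly_neg hj1 (hj.trans hk), mul_zero]

end Polynomiality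

/-! ### Reciprocity through x ↦ 1/x -/

section Reciprocity

theorem inv_sub_inv_pow {F : Type*} [Field F] {x y : F} (hx : x ≠ 0) (hy : y ≠ 0) (p : ℕ) :
    ((x⁻¹ - y⁻¹) ^ p)⁻¹ = (-x) ^ p * y ^ p * ((x - y) ^ p)⁻¹ := by
  rw [← mul_pow, ← inv_pow, ← inv_pow, ← mul_pow]
  congr 1
  by_cases h : x = y
  · simp [h]
  · have h1 : x - y ≠ 0 := sub_ne_zero.2 h
    have h2 : x⁻¹ - y⁻¹ = -(x - y) * (x⁻¹ * y⁻¹) := by field_simp; ring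
    rw [h2]
    field_simp

theorem prod_Ico_Ico_comm {M : Type*} [CommMonoid M] (a b : ℕ) (f : ℕ → ℕ → M) :
    ∏ i ∈ Finset.Ico a b, ∏ j ∈ Finset.Ico (i + 1) b, f i j =
      ∏ j ∈ Finset.Ico a b, ∏ i ∈ Finset.Ico a j, f i j :=
  Finset.sum_Ico_Ico_comm' (M := Additive M) a b f

theorem neg_pow_mul_of_even {F : Type*} [Field F] (x : F) {p q : ℕ} (h : Even (p + q)) :
    (-x) ^ p * (-x) ^ q = x ^ (p + q) := by
  rw [← pow_add, h.neg_pow]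

/-- Collects all powers of one variable produced by x ↦ 1/x. The first argument of `cPar` is
immaterial, so 0 serves for every smaller index. -/
theorem reciprocity_factor {F : Type*} [Field F] {x : F} (hx : x ≠ 0) {m i : ℕ} (hi : 1 ≤ i)
    (him : i ≤ m) (t : ℤ) :
    -x⁻¹ * x⁻¹ ^ aPar m (m - 1) (-t - (m + 1)) i * ((-1) ^ bPar m i * x ^ bPar m i) *
      (∏ j ∈ Finset.Ico (i + 1) (m + 1), (-x) ^ cPar m i j) * (∏ _j ∈ Finset.Ico 1 i,
        x ^ cPar m 0 i) = -1 * (x * x ^ aPar m (m - 1) t i) := by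
  obtain ⟨i, rfl⟩ : ∃ i', i = i' + 1 := ⟨i - 1, by omega⟩
  rw [← mul_pow, neg_one_mul, Finset.prod_const, Nat.card_Ico, Nat.add_sub_cancel, inv_zpow,
    ← zpow_neg]
  rcases him.eq_or_lt with rfl | him
  · simp only [aPar, bPar, cPar, if_pos, pow_one, Finset.Ico_self, Finset.prod_empty, mul_one]
    have h : -(-(-t - (((i + 1 : ℕ) : ℤ) + 1)) - 1) = -t - 1 + -(i : ℤ) := by push_cast; ring
    rw [h, zpow_add₀ hx, zpow_neg, zpow_natCast, even_two.neg_pow]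
    field_simp
  · obtain ⟨k, rfl⟩ : ∃ k, m = i + 1 + (k + 1) := ⟨m - i - 2, by omega⟩
    have hs : ∑ j ∈ Finset.Ico (i + 1 + 1) (i + 1 + (k + 1) + 1), cPar (i + 1 + (k + 1)) (i + 1) j =
        2 * k + 1 := by
      have := sum_cPar him
      zify
      rw [this]; push_cast; ring
    have e : ((i + 1 + (k + 1) : ℕ) : ℤ) - 1 = ((i + k + 1 : ℕ) : ℤ) := by push_cast; ring
    rw [Finset.prod_pow_eq_pow_sum, hs, aPar, aPar, if_neg him.ne, if_neg him.ne, bPar,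
      if_neg him.ne, cPar, if_neg him.ne, e, zpow_neg, zpow_natCast, ← pow_mul,
      mul_assoc (-x⁻¹ * _), neg_pow_mul_of_even x (p := 3) ⟨k + 2, by ring⟩]
    field_simp
    ring

/-- No residue theorem is involved: the two series agree up to sign, each variable contributing -1.
-/
theorem arrCT_iv_eq_xv {m : ℕ} (t : ℤ) :
    arrCT (iv (m + 1)) (iw (m + 1)) (Finset.Ico 1 (m + 1))
        (aPar m (m - 1) (-t - (m + 1))) (bPar m) (cPar m) =
      (-1) ^ m * arrCT (xv (m + 1)) (xv (m + 1)) (Finset.Ico 1 (m + 1)) (aPar m (m - 1) t)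
        (bPar m) (cPar m) := by
  have key : (∏ i ∈ Finset.Ico 1 (m + 1), iw (m + 1) i) *
      arrFn (iv (m + 1)) (Finset.Ico 1 (m + 1)) (aPar m (m - 1) (-t - (m + 1))) (bPar m) (cPar m) =
      (-1) ^ m * ((∏ i ∈ Finset.Ico 1 (m + 1), xv (m + 1) i) *
      arrFn (xv (m + 1)) (Finset.Ico 1 (m + 1)) (aPar m (m - 1) t) (bPar m) (cPar m)) := by
    set x := xv (m + 1) with hxdef
    have hx : ∀ i, x i ≠ 0 := fun i => xv_ne_zero i
    have hrow : ∀ i ∈ Finset.Ico 1 (m + 1), iw (m + 1) i * rowFn (iv (m + 1)) i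
        ((Finset.Ico 1 (m + 1)).filter (i < ·)) (aPar m (m - 1) (-t - (m + 1)) i) (bPar m i)
        (cPar m i) =
        (-(x i)⁻¹ * (x i)⁻¹ ^ aPar m (m - 1) (-t - (m + 1)) i *
          ((-1) ^ bPar m i * x i ^ bPar m i) *
          (∏ j ∈ Finset.Ico (i + 1) (m + 1), (-x i) ^ cPar m i j)) *
          (∏ j ∈ Finset.Ico (i + 1) (m + 1), x j ^ cPar m 0 j) *
          (((1 - x i) ^ bPar m i)⁻¹ *
            ∏ j ∈ Finset.Ico (i + 1) (m + 1), ((x i - x j) ^ cPar m i j)⁻¹) := by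
      intro i hi
      rw [Finset.mem_Ico] at hi
      have h1 := inv_sub_inv_pow (one_ne_zero (α := LaurentField (m + 1))) (hx i) (bPar m i)
      rw [inv_one] at h1
      have h2 : ∏ j ∈ Finset.Ico (i + 1) (m + 1), (((x i)⁻¹ - (x j)⁻¹) ^ cPar m i j)⁻¹ =
          (∏ j ∈ Finset.Ico (i + 1) (m + 1), (-x i) ^ cPar m i j) *
          (∏ j ∈ Finset.Ico (i + 1) (m + 1), x j ^ cPar m 0 j) *
          ∏ j ∈ Finset.Ico (i + 1) (m + 1), ((x i - x j) ^ cPar m i j)⁻¹ := by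
        rw [← Finset.prod_mul_distrib, ← Finset.prod_mul_distrib]
        exact Finset.prod_congr rfl fun j _ => inv_sub_inv_pow (hx i) (hx j) _
      rw [filter_lt_Ico (by omega), rowFn]
      simp only [iv, iw, ← hxdef]
      rw [h1, h2]
      ring
    have hrow' : ∀ i ∈ Finset.Ico 1 (m + 1), x i * rowFn x i
        ((Finset.Ico 1 (m + 1)).filter (i < ·)) (aPar m (m - 1) t i) (bPar m i) (cPar m i) =
        (x i * x i ^ aPar m (m - 1) t i) * (((1 - x i) ^ bPar m i)⁻¹ *
            ∏ j ∈ Finset.Ico (i + 1) (m + 1), ((x i - x j) ^ cPar m i j)⁻¹) := by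
      intro i hi
      rw [Finset.mem_Ico] at hi
      rw [filter_lt_Ico (by omega), rowFn]
      ring
    have hc : ∏ _i ∈ Finset.Ico 1 (m + 1), (-1 : LaurentField (m + 1)) = (-1) ^ m := by simp
    rw [arrFn, arrFn, ← Finset.prod_mul_distrib, ← Finset.prod_mul_distrib,
      Finset.prod_congr rfl hrow, Finset.prod_congr rfl hrow', Finset.prod_mul_distrib,
      Finset.prod_mul_distrib, prod_Ico_Ico_comm 1 (m + 1) fun _ j => x j ^ cPar m 0 j,
      ← Finset.prod_mul_distrib, Finset.prod_congr rfl fun i hi =>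
        reciprocity_factor (hx i) (Finset.mem_Ico.1 hi).1
          (Nat.lt_succ_iff.1 (Finset.mem_Ico.1 hi).2) t,
      Finset.prod_mul_distrib, hc, mul_assoc, ← Finset.prod_mul_distrib]
  rw [arrCT, arrCT, key]
  rcases Nat.even_or_odd m with h | h
  · simp [h.neg_one_pow]
  · simp [h.neg_one_pow]

/-- At t there is no pole at infinity, and at -t - (m + 1) there is none at the origin, so both
constant terms are values of the expansion at (1, …, 1). -/
theorem flowPoly_reciprocity_natCast {m : ℕ} (hm : 1 ≤ m) (t : ℕ) :
    (flowPoly m (m - 1)).eval (t : ℚ) =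
      (-1) ^ m * (flowPoly m (m - 1)).eval (-t - (m + 1) : ℚ) := by
  have hs : ∀ j ∈ Finset.Ico 1 (m + 1), 0 < j ∧ j < m + 1 := fun j hj => by
    rw [Finset.mem_Ico] at hj; omega
  have h1 := arrCT_uv_eq_eval hm (m - 1) t
  have h2 := arrCT_uv_eq_eval hm (m - 1) (-t - (m + 1))
  rw [Nat.cast_sub hm, Nat.cast_one] at h1 h2
  rw [← arrCT_xv_eq_uv _ hs _ _ _ (aPar_admissible le_rfl (by positivity))] at h1
  rw [← arrCT_iv_eq_uv _ hs _ (fun j _ => by rw [aPar]; split_ifs <;> omega),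
    arrCT_iv_eq_xv, h1] at h2
  push_cast at h2 ⊢
  rw [← h2, ← mul_assoc, ← mul_pow]
  simp

end Reciprocity

/-! ### Constant terms as coefficients of flow series -/

section FlowForm

variable {n : ℕ}

/-- The weights of the vertices `1, x_1, x_2, …`. -/
def baseV (n i : ℕ) : ExpVec n := if i = 0 then 0 else ev n i

theorem baseV_pos {i : ℕ} (hi : 0 < i) : baseV n i = ev n i := if_neg hi.ne'

theorem baseV_lt {i j : ℕ} (hij : i < j) (hj : j < n) : baseV n i < baseV n j := by
  rw [baseV_pos (by omega : 0 < j)]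
  rcases Nat.eq_zero_or_pos i with rfl | hi
  · simpa [baseV] using ev_pos hj
  · rw [baseV_pos hi]; exact ev_lt_ev hij hj

theorem eq_zero_of_sum_ev_eq_zero {s : Finset ℕ} (hs : ∀ i ∈ s, i < n) {q : ℕ → ℤ}
    (h : ∑ i ∈ s, q i • ev n i = 0) : ∀ i ∈ s, q i = 0 := by
  intro i hi
  have := congrArg (wt n (Pi.single i 1)) h
  rw [map_sum, map_zero, Finset.sum_eq_single i] at this
  · rw [map_zsmul, wt_ev _ (hs i hi), Pi.single_eq_same] at this
    simpa using this
  · intro j hj hne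
    rw [map_zsmul, wt_ev _ (hs j hj), Pi.single_eq_of_ne hne, smul_zero]
  · exact fun h => absurd hi h

theorem sum_range_baseV {r : ℕ} (q : ℕ → ℤ) :
    ∑ i ∈ Finset.range r, q i • baseV n i = ∑ i ∈ Finset.Ico 1 r, q i • ev n i := by
  rcases Nat.eq_zero_or_pos r with rfl | hr
  · simp
  · rw [Finset.range_eq_Ico, Finset.sum_eq_sum_Ico_succ_bot hr, baseV, if_pos rfl, zsmul_zero,
      zero_add]
    exact Finset.sum_congr rfl fun i hi => by rw [baseV_pos (Finset.mem_Ico.1 hi).1]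

theorem baseV_independent {r : ℕ} (hr : r ≤ n) (q : ℕ → ℤ)
    (hq : ∑ i ∈ Finset.range r, q i = 0) (h : ∑ i ∈ Finset.range r, q i • baseV n i = 0) :
    ∀ i < r, q i = 0 := by
  rw [sum_range_baseV] at h
  have h1 := eq_zero_of_sum_ev_eq_zero (fun i hi => by rw [Finset.mem_Ico] at hi; omega) h
  intro i hi
  rcases Nat.eq_zero_or_pos i with rfl | h0
  · rw [Finset.range_eq_Ico, Finset.sum_eq_sum_Ico_succ_bot hi, Finset.sum_eq_zero h1,
      add_zero] at hq
    exact hq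
  · exact h1 i (Finset.mem_Ico.2 ⟨h0, hi⟩)

/-- The edge multiplicities `b` from the source `0` and `c` between the other vertices. -/
def withSource (b : ℕ → ℕ) (c : ℕ → ℕ → ℕ) (i j : ℕ) : ℕ := if i = 0 then b j else c i j

/-- The demand at the vertex `i` of the flow series of `arrFn`. -/
def demand (r : ℕ) (a : ℕ → ℤ) (c : ℕ → ℕ → ℕ) (i : ℕ) : ℤ :=
  ∑ j ∈ Finset.Ico (i + 1) r, (c i j : ℤ) - (a i + 1)

theorem xv_mul_rowFn {r i : ℕ} (A : ℤ) (p : ℕ) (c : ℕ → ℕ → ℕ) :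
    xv n i * rowFn (xv n) i (Finset.Ico (i + 1) r) A p (c i) =
      mono (-((∑ j ∈ Finset.Ico (i + 1) r, (c i j : ℤ) - (A + 1)) • ev n i)) *
        (((1 - mono (ev n i)) ^ p)⁻¹ *
        ∏ j ∈ Finset.Ico (i + 1) r, ((1 - mono (ev n j - ev n i)) ^ c i j)⁻¹) := by
  have h : ∏ j ∈ Finset.Ico (i + 1) r, ((xv n i - xv n j) ^ c i j)⁻¹ =
      xv n i ^ (-∑ j ∈ Finset.Ico (i + 1) r, (c i j : ℤ)) *
        ∏ j ∈ Finset.Ico (i + 1) r, ((1 - mono (ev n j - ev n i)) ^ c i j)⁻¹ := by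
    rw [← Nat.cast_sum, zpow_neg, zpow_natCast, ← Finset.prod_pow_eq_pow_sum,
      ← Finset.prod_inv_distrib, ← Finset.prod_mul_distrib]
    exact Finset.prod_congr rfl fun j _ => by rw [xv_sub_xv_eq, mul_pow, mul_inv]
  rw [rowFn, h, ← neg_smul, mono_zsmul, neg_sub, sub_eq_add_neg (A + 1), zpow_add₀ (mono_ne_zero _),
    zpow_add_one₀ (mono_ne_zero _)]
  simp only [xv]
  ring

theorem flowSeries_baseV {r : ℕ} (b : ℕ → ℕ) (c : ℕ → ℕ → ℕ) :
    flowSeries (baseV n) (withSource b c) r = ∏ i ∈ Finset.Ico 1 r,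
      (((1 - mono (ev n i)) ^ b i)⁻¹ *
        ∏ j ∈ Finset.Ico (i + 1) r, ((1 - mono (ev n j - ev n i)) ^ c i j)⁻¹) := by
  rcases Nat.eq_zero_or_pos r with rfl | hr
  · simp [flowSeries]
  · rw [Finset.prod_mul_distrib, prod_Ico_Ico_comm, ← Finset.prod_mul_distrib, flowSeries,
      Finset.range_eq_Ico, Finset.prod_eq_prod_Ico_succ_bot hr, Finset.range_zero,
      Finset.prod_empty, one_mul]
    refine Finset.prod_congr rfl fun j hj => ?_
    have hj1 := (Finset.mem_Ico.1 hj).1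
    rw [Finset.range_eq_Ico, Finset.prod_eq_prod_Ico_succ_bot (by omega)]
    congr 1
    · simp [baseV, withSource, show j ≠ 0 by omega]
    · refine Finset.prod_congr rfl fun i hi => ?_
      have hi1 := (Finset.mem_Ico.1 hi).1
      rw [baseV_pos (by omega), baseV_pos (by omega), withSource, if_neg (by omega)]

theorem filter_lt_Ico_one {r i : ℕ} (hi : 0 < i) :
    (Finset.Ico 1 r).filter (i < ·) = Finset.Ico (i + 1) r := by
  ext j; simp only [Finset.mem_filter, Finset.mem_Ico]; omega

/-- The constant term of `arrFn` as a coefficient of a flow series. -/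
theorem arrCT_eq_flowSeries_coeff {r : ℕ} (a : ℕ → ℤ) (b : ℕ → ℕ) (c : ℕ → ℕ → ℕ) :
    arrCT (xv n) (xv n) (Finset.Ico 1 r) a b c =
      (flowSeries (baseV n) (withSource b c) r).coeff
        (∑ i ∈ Finset.Ico 1 r, demand r a c i • ev n i) := by
  have h : (∏ i ∈ Finset.Ico 1 r, xv n i) * arrFn (xv n) (Finset.Ico 1 r) a b c =
      mono (-∑ i ∈ Finset.Ico 1 r, demand r a c i • ev n i) *
        flowSeries (baseV n) (withSource b c) r := by
    rw [arrFn, flowSeries_baseV, ← Finset.prod_mul_distrib, ← Finset.sum_neg_distrib, mono_sum,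
      ← Finset.prod_mul_distrib]
    refine Finset.prod_congr rfl fun i hi => ?_
    rw [filter_lt_Ico_one (Finset.mem_Ico.1 hi).1, xv_mul_rowFn, demand]
  rw [arrCT, h, coeff_mono_mul, zero_sub, neg_neg]

/-- Transport of coefficients of flow series with source `1` to other weights. -/
theorem flowSeries_baseV_coeff_eq {Γ : Type*} [AddCommGroup Γ] [LinearOrder Γ]
    [IsOrderedAddMonoid Γ] (v : ℕ → Γ) {r : ℕ} (hr : r ≤ n) (c : ℕ → ℕ → ℕ)
    (hv : ∀ i j, i < j → j < r → v i < v j)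
    (hinj : ∀ q : ℕ → ℤ, ∑ i ∈ Finset.range r, q i = 0 → ∑ i ∈ Finset.range r, q i • v i = 0 →
      ∀ i < r, q i = 0)
    (q : ℕ → ℤ) (hq : ∑ i ∈ Finset.range r, q i = 0) :
    (flowSeries (baseV n) c r).coeff (∑ i ∈ Finset.Ico 1 r, q i • ev n i) =
      (flowSeries v c r).coeff (∑ i ∈ Finset.range r, q i • v i) := by
  rw [← sum_range_baseV]
  exact flowSeries_coeff_eq (baseV n) v c r (fun i j hij hj => baseV_lt hij (hj.trans_le hr)) hv
    (baseV_independent hr) hinj q hq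

/-- The constant term of `arrFn` does not depend on the number of variables of the field. -/
theorem arrCT_xv_field {n' r : ℕ} (hr : r ≤ n) (hr' : r ≤ n') (a : ℕ → ℤ) (b : ℕ → ℕ)
    (c : ℕ → ℕ → ℕ) :
    arrCT (xv n) (xv n) (Finset.Ico 1 r) a b c = arrCT (xv n') (xv n') (Finset.Ico 1 r) a b c := by
  rcases Nat.eq_zero_or_pos r with rfl | h0
  · simp [arrCT, arrFn]
  -- The demand at the source is chosen so that the total is zero, as transport requires.
  let q : ℕ → ℤ := fun i =>
    if i = 0 then -∑ i ∈ Finset.Ico 1 r, demand r a c i else demand r a c i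
  have hq1 : ∀ i ∈ Finset.Ico 1 r, q i = demand r a c i := fun i hi =>
    if_neg (by have := (Finset.mem_Ico.1 hi).1; omega)
  have hq : ∑ i ∈ Finset.range r, q i = 0 := by
    rw [Finset.range_eq_Ico, Finset.sum_eq_sum_Ico_succ_bot h0, Finset.sum_congr rfl hq1]
    simp [q]
  have e : ∀ N, ∑ i ∈ Finset.Ico 1 r, demand r a c i • ev N i =
      ∑ i ∈ Finset.Ico 1 r, q i • ev N i := fun N =>
    Finset.sum_congr rfl fun i hi => by rw [hq1 i hi]
  rw [arrCT_eq_flowSeries_coeff, arrCT_eq_flowSeries_coeff, e, e, ← sum_range_baseV (n := n'),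
    flowSeries_baseV_coeff_eq (baseV n') hr _ (fun i j hij hj => baseV_lt hij (hj.trans_le hr'))
    (baseV_independent hr') q hq]

/-- The flow that sends `q j` along one edge from the source straight to each vertex j is feasible.
-/
theorem posAt_flowSeries_baseV {r : ℕ} (hr : r ≤ n) (c : ℕ → ℕ → ℕ)
    (hc : ∀ j, 0 < c 0 j) (q : ℕ → ℕ) :
    PosAt (∑ i ∈ Finset.Ico 1 r, q i • ev n i) (flowSeries (baseV n) c r) := by
  induction r with
  | zero => simpa [flowSeries, mono_zero] using posAt_mono (0 : ExpVec n)
  | succ r ih =>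
    replace ih := ih (by omega)
    rw [flowSeries, Finset.prod_range_succ, ← flowSeries]
    rcases Nat.eq_zero_or_pos r with rfl | h0
    · simpa using ih
    · rw [Finset.sum_Ico_succ_top h0, Finset.range_eq_Ico, Finset.prod_eq_prod_Ico_succ_bot h0]
      have hbase : baseV n r - baseV n 0 = ev n r := by simp [baseV, h0.ne']
      obtain ⟨k, hk⟩ : ∃ k, c 0 r = k + 1 := ⟨c 0 r - 1, by have := hc r; omega⟩
      have hev : (0 : ExpVec n) < ev n r := ev_pos (by omega)
      have h1 := (ih.inv_one_sub hev (q r)).inv_one_sub_pow hev k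
      rw [← mul_assoc, hbase, hk, pow_succ', mul_inv, ← mul_assoc]
      -- The other edges into `r` may stay empty.
      have : ∀ s : Finset ℕ, (∀ i ∈ s, i < r) → ∀ f, PosAt
          (∑ i ∈ Finset.Ico 1 r, q i • ev n i + q r • ev n r) f →
          PosAt (∑ i ∈ Finset.Ico 1 r, q i • ev n i + q r • ev n r)
            (f * ∏ i ∈ s, ((1 - mono (baseV n r - baseV n i)) ^ c i r)⁻¹) := by
        intro s
        induction s using Finset.induction_on with
        | empty => intro _ f hf; simpa using hf
        | insert a s ha ihs =>
          intro hs f hf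
          rw [Finset.prod_insert ha, ← mul_assoc]
          exact ihs (fun i hi => hs i (by simp [hi])) _ (hf.inv_one_sub_pow
            (sub_pos.2 (baseV_lt (hs a (by simp)) (by omega))) _)
      exact this _ (fun i hi => (Finset.mem_Ico.1 hi).2) _ h1

end FlowForm

/-! ### Morris constant terms in the class `arrFn` -/

section RationalFunctions

variable {n : ℕ}

theorem prod_fin_eq_prod_range {M : Type*} [CommMonoid M] (f : ℕ → M) :
    ∏ i : Fin n, f i = ∏ i ∈ Finset.range n, f i := Fin.prod_univ_eq_prod_range f n

theorem prod_finset_fin {M : Type*} [CommMonoid M] (s : Finset (Fin n)) (t : Finset ℕ) (f : ℕ → M)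
    (h : ∀ j, j ∈ t ↔ ∃ i ∈ s, i.val = j) : ∏ i ∈ s, f i.val = ∏ j ∈ t, f j := by
  have : t = s.map Fin.valEmbedding := by
    ext j; rw [h]; simp
  rw [this, Finset.prod_map]; rfl

theorem prod_Ioi_fin {M : Type*} [CommMonoid M] (i : Fin n) (f : ℕ → M) :
    ∏ j ∈ Finset.Ioi i, f j.val = ∏ j ∈ Finset.Ico (i.val + 1) n, f j := by
  refine prod_finset_fin _ _ f fun j => ?_
  rw [Finset.mem_Ico]
  constructor
  · rintro ⟨h1, h2⟩
    exact ⟨⟨j, h2⟩, Finset.mem_Ioi.2 (Fin.lt_def.2 h1), rfl⟩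
  · rintro ⟨k, hk, rfl⟩
    exact ⟨Fin.lt_def.1 (Finset.mem_Ioi.1 hk), k.isLt⟩

theorem constantTerm_morris (k k₁ k₂ k₃ : ℕ) :
    constantTerm (morris k k₁ k₂ k₃) = arrCT (xv k) (xv k) (Finset.range k) (fun _ => -(k₁ : ℤ))
      (fun _ => k₂) (fun _ _ => k₃) := by
  rw [constantTerm, arrCT, morris]
  congr 1
  simp only [map_div₀, map_mul, map_prod, map_pow, map_zpow₀, map_sub, map_one, laurentExpansion_X]
  have h : ∀ i : Fin k, ∏ j ∈ Finset.Ioi i, (xv k i - xv k j) ^ k₃ =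
      ∏ j ∈ Finset.Ico (i.val + 1) k, (xv k i - xv k j) ^ k₃ := fun i =>
    prod_Ioi_fin i fun j => (xv k i - xv k j) ^ k₃
  rw [Finset.prod_congr rfl fun i _ => h i,
    prod_fin_eq_prod_range fun i => xv k i ^ ((k₁ : ℤ) - 1),
    prod_fin_eq_prod_range fun i => (1 - xv k i) ^ k₂,
    prod_fin_eq_prod_range fun i => ∏ j ∈ Finset.Ico (i + 1) k, (xv k i - xv k j) ^ k₃,
    ← Finset.prod_mul_distrib, ← Finset.prod_mul_distrib, one_div, ← Finset.prod_inv_distrib,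
    arrFn, ← Finset.prod_mul_distrib]
  refine Finset.prod_congr rfl fun i hi => ?_
  have hf : (Finset.range k).filter (i < ·) = Finset.Ico (i + 1) k := by
    ext j; simp only [Finset.mem_filter, Finset.mem_range, Finset.mem_Ico]; omega
  rw [rowFn, hf, Finset.prod_inv_distrib, mul_inv, mul_inv, ← zpow_neg, neg_sub, sub_eq_add_neg,
    zpow_add₀ (xv_ne_zero i), zpow_one]
  ring

/-- The first variable has a simple pole at 1 and none at infinity; setting it to 1 adds `k₃` to the
exponents of the other 1 - x_j. -/
theorem constantTerm_morris_one {k k₁ k₃ : ℕ} (hk : 1 ≤ k) (hk₁ : 1 ≤ k₁) :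
    constantTerm (morris k k₁ 1 k₃) = arrCT (xv k) (xv k) (Finset.Ico 1 k) (fun _ => -(k₁ : ℤ))
      (fun _ => k₃ + 1) (fun _ _ => k₃) := by
  have hs : Finset.range k = insert 0 (Finset.Ico 1 k) := by
    ext j; simp only [Finset.mem_range, Finset.mem_insert, Finset.mem_Ico]; omega
  have h : ∀ j ∈ Finset.Ico 1 k, 0 < j ∧ j < k := fun j hj => by
    rw [Finset.mem_Ico] at hj; omega
  rw [constantTerm_morris, hs, arrCT_insert _ _ fun j hj => (h j hj).1,
    rowCT_xv_merge hk h _ _ (by omega)]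
  exact arrCT_congr _ _ (fun _ _ => rfl) (fun _ _ => by simp [add_comm]) fun _ _ _ _ _ => rfl

end RationalFunctions

/-! ### `barH` in the class `arrFn` -/

section BarH

theorem constantTerm_barH {m : ℕ} (hm : 1 ≤ m) (h2 : 2 ≤ m + 1) (t : ℤ) :
    constantTerm (barH (m + 1) h2 t) = arrCT (xv (m + 1)) (xv (m + 1)) (Finset.Ico 1 (m + 1))
      (aPar m (m - 1) t) (bPar m) (cPar m) := by
  rw [constantTerm, arrCT, barH]
  congr 1
  simp only [map_div₀, map_mul, map_prod, map_pow, map_zpow₀, map_sub, map_one, laurentExpansion_X]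
  have hlast : (lastIdx (m + 1) h2).val = m := by simp [lastIdx]
  rw [hlast]
  set x := xv (m + 1) with hxdef
  have hx : ∀ i, x i ≠ 0 := fun i => xv_ne_zero i
  have hmid : ∀ j, j ∈ Finset.Ico 1 m ↔ ∃ i ∈ midIdx (m + 1), i.val = j := by
    intro j
    rw [Finset.mem_Ico]
    constructor
    · rintro ⟨h1, h2⟩
      exact ⟨⟨j, by omega⟩, by simp [midIdx, h1, h2], rfl⟩
    · rintro ⟨k, hk, rfl⟩
      simpa [midIdx, Nat.succ_lt_succ_iff] using hk
  have htail : ∀ j, j ∈ Finset.Ico 1 (m + 1) ↔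
      ∃ i ∈ Finset.univ.filter (fun i : Fin (m + 1) => 1 ≤ i.val), i.val = j := by
    intro j
    rw [Finset.mem_Ico]
    constructor
    · rintro ⟨h1, h2⟩
      exact ⟨⟨j, h2⟩, by simpa using h1, rfl⟩
    · rintro ⟨k, hk, rfl⟩
      exact ⟨(Finset.mem_filter.1 hk).2, k.isLt⟩
  have hin : ∀ i : Fin (m + 1), ∏ j ∈ Finset.Ioi i, (x i - x j) ^ 2 =
      ∏ j ∈ Finset.Ico (i.val + 1) (m + 1), (x i - x j) ^ 2 := fun i =>
    prod_Ioi_fin i fun j => (x i - x j) ^ 2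
  rw [Finset.prod_congr rfl fun i _ => hin i,
    prod_finset_fin _ _ (fun i => x i ^ (m + 1 - 1)) hmid,
    prod_finset_fin _ _ (fun i => x i - x m) hmid,
    prod_finset_fin _ _ (fun i => (1 - x i) ^ 3) htail,
    prod_finset_fin _ _ (fun i => ∏ j ∈ Finset.Ico (i + 1) (m + 1), (x i - x j) ^ 2) htail,
    Finset.prod_Ico_succ_top hm, Finset.prod_Ico_succ_top hm, Finset.Ico_self, Finset.prod_empty,
    mul_one, arrFn, ← Finset.prod_mul_distrib (s := Finset.Ico 1 (m + 1)),
    Finset.prod_Ico_succ_top hm]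
  have h1 : ∀ i ∈ Finset.Ico 1 m, x i * rowFn x i ((Finset.Ico 1 (m + 1)).filter (i < ·))
      (aPar m (m - 1) t i) (bPar m i) (cPar m i) =
      x i ^ (m + 1 - 1) * (x i - x m) * ((1 - x i) ^ 3)⁻¹ *
        (∏ j ∈ Finset.Ico (i + 1) (m + 1), (x i - x j) ^ 2)⁻¹ := by
    intro i hi
    rw [Finset.mem_Ico] at hi
    rw [filter_lt_Ico (by omega), rowFn, aPar, if_neg hi.2.ne, bPar, if_neg hi.2.ne,
      Finset.prod_Ico_succ_top hi.2, Finset.prod_Ico_succ_top hi.2,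
      Finset.prod_congr rfl fun j hj => by rw [cPar, if_neg (Finset.mem_Ico.1 hj).2.ne],
      cPar, if_pos rfl, Finset.prod_inv_distrib, Nat.add_sub_cancel]
    have hxm : x i * x i ^ ((m : ℤ) - 1) = x i ^ m := by
      rw [← zpow_one_add₀ (hx i), add_sub_cancel, zpow_natCast]
    rw [← mul_assoc, ← mul_assoc, ← mul_assoc, hxm, pow_one]
    have hne := xv_sub_xv_ne_zero (n := m + 1) hi.2 (Nat.lt_succ_self m)
    rw [← hxdef] at hne
    field_simp
  have h2 : x m * rowFn x m ((Finset.Ico 1 (m + 1)).filter (m < ·))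
      (aPar m (m - 1) t m) (bPar m m) (cPar m m) =
      (1 - x m) * (x m ^ t)⁻¹ * ((1 - x m) ^ 3)⁻¹ := by
    rw [filter_lt_Ico (by omega), rowFn, aPar, if_pos rfl, bPar, if_pos rfl, Finset.Ico_self,
      Finset.prod_empty, mul_one, ← mul_assoc, ← zpow_one_add₀ (hx m), add_sub_cancel, zpow_neg]
    have hne := one_sub_xv_ne_zero (n := m + 1) (Nat.lt_succ_self m)
    rw [← hxdef] at hne
    field_simp
  rw [Finset.prod_congr rfl h1, h2]
  simp only [Finset.prod_mul_distrib, Finset.prod_inv_distrib]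
  rw [div_eq_mul_inv, mul_inv, mul_inv, mul_inv]
  ring

end BarH

/-! ### 𝓗 as a flow series, and its reduction to `barH` -/

section BirkhoffTerm

theorem prod_range_erase {M : Type*} [CommMonoid M] (n : ℕ) (f : ℕ → ℕ → M) :
    ∏ i ∈ Finset.range n, ∏ j ∈ (Finset.range n).erase i, f i j =
      ∏ j ∈ Finset.range n, ∏ i ∈ Finset.range j, (f i j * f j i) := by
  induction n with
  | zero => simp
  | succ n ih =>
    rw [Finset.prod_range_succ, Finset.prod_range_succ, ← ih]
    have h1 : (Finset.range (n + 1)).erase n = Finset.range n := by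
      ext j; simp only [Finset.mem_erase, Finset.mem_range]; omega
    have h2 : ∀ i ∈ Finset.range n, ∏ j ∈ (Finset.range (n + 1)).erase i, f i j =
        f i n * ∏ j ∈ (Finset.range n).erase i, f i j := by
      intro i hi
      rw [Finset.mem_range] at hi
      have : (Finset.range (n + 1)).erase i = insert n ((Finset.range n).erase i) := by
        ext j; simp only [Finset.mem_erase, Finset.mem_range, Finset.mem_insert]; omega
      rw [this, Finset.prod_insert (by simp)]
    rw [h1, Finset.prod_congr rfl h2, Finset.prod_mul_distrib, Finset.prod_mul_distrib, mul_assoc,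
      mul_left_comm, mul_comm, mul_assoc, mul_comm (∏ i ∈ Finset.range n, f n i), ← mul_assoc]

/-- With y smaller than x, the factor 1 - x/y must be turned into -(x/y)(1 - y/x) before it is
expanded. -/
theorem birkhoff_factor {F : Type*} [Field F] {x y : F} (hx : x ≠ 0) (hy : y ≠ 0) (p q : ℕ) :
    ((1 - y / x) ^ p)⁻¹ * ((1 - x / y) ^ q)⁻¹ =
      (-1) ^ q * (y ^ q * (x ^ q)⁻¹) * ((1 - y / x) ^ (p + q))⁻¹ := by
  have h : 1 - x / y = -1 * (x * y⁻¹) * (1 - y / x) := by field_simp; ring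
  rw [h, mul_pow, mul_pow, mul_pow, pow_add]
  have hs : ((-1 : F) ^ q)⁻¹ = (-1) ^ q := by rw [← inv_pow, inv_neg_one]
  simp only [mul_inv, inv_pow, inv_inv, hs]
  ring

theorem birkhoff_prod {F : Type*} [Field F] (x : ℕ → F) (hx : ∀ i, x i ≠ 0) (n : ℕ) (μ : ℕ → ℕ)
    (t : ℤ) :
    ∏ i ∈ Finset.range n, (x i ^ (((μ i : ℤ) - 1) * t) /
        ∏ j ∈ (Finset.range n).erase i, (1 - x j / x i) ^ μ i) =
      (-1) ^ (∑ j ∈ Finset.range n, j * μ j) * (∏ i ∈ Finset.range n,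
        x i ^ (-(∑ j ∈ Finset.Ico (i + 1) n, (μ j : ℤ) - i * μ i - (μ i - 1) * t))) *
      ∏ j ∈ Finset.range n, ∏ i ∈ Finset.range j, ((1 - x j / x i) ^ (μ i + μ j))⁻¹ := by
  have h1 : ∏ j ∈ Finset.range n, ∏ i ∈ Finset.range j, (x i ^ μ j)⁻¹ =
      ∏ i ∈ Finset.range n, x i ^ (-∑ j ∈ Finset.Ico (i + 1) n, (μ j : ℤ)) := by
    rw [Finset.range_eq_Ico]
    simp only [Finset.range_eq_Ico]
    rw [← prod_Ico_Ico_comm 0 n fun i j => (x i ^ μ j)⁻¹]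
    refine Finset.prod_congr rfl fun i _ => ?_
    rw [Finset.prod_inv_distrib, Finset.prod_pow_eq_pow_sum, zpow_neg, ← Nat.cast_sum,
      zpow_natCast]
  have h2 : ∏ j ∈ Finset.range n, ∏ i ∈ Finset.range j, (-1 : F) ^ μ j =
      (-1) ^ (∑ j ∈ Finset.range n, j * μ j) := by
    rw [← Finset.prod_pow_eq_pow_sum]
    refine Finset.prod_congr rfl fun j _ => ?_
    rw [Finset.prod_const, Finset.card_range, ← pow_mul, mul_comm]
  have h3 : ∏ j ∈ Finset.range n, ∏ i ∈ Finset.range j, x j ^ μ j =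
      ∏ j ∈ Finset.range n, x j ^ ((j : ℤ) * μ j) := by
    refine Finset.prod_congr rfl fun j _ => ?_
    rw [Finset.prod_const, Finset.card_range, ← pow_mul, mul_comm, ← Nat.cast_mul, zpow_natCast]
  rw [Finset.prod_congr rfl fun i _ => by rw [div_eq_mul_inv, ← Finset.prod_inv_distrib],
    Finset.prod_mul_distrib, prod_range_erase n fun i j => ((1 - x j / x i) ^ μ i)⁻¹]
  simp only [birkhoff_factor (hx _) (hx _), Finset.prod_mul_distrib]
  rw [h1, h2, h3]
  have h4 : ∀ i, x i ^ (-(∑ j ∈ Finset.Ico (i + 1) n, (μ j : ℤ) - i * μ i - (μ i - 1) * t)) =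
      x i ^ (((μ i : ℤ) - 1) * t) * (x i ^ ((i : ℤ) * μ i) *
        x i ^ (-∑ j ∈ Finset.Ico (i + 1) n, (μ j : ℤ))) := by
    intro i
    rw [← zpow_add₀ (hx i), ← zpow_add₀ (hx i)]
    congr 1; ring
  simp only [h4, Finset.prod_mul_distrib]
  ring

/-- The composition `(2, 1, …, 1, 0)` with index set `ℕ`. -/
def compNat (m i : ℕ) : ℕ := if i = 0 then 2 else if i = m then 0 else 1

/-- The demands of the flow series of `birkhoffTerm`. -/
def birkhoffDemand (m : ℕ) (t : ℤ) (i : ℕ) : ℤ :=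
  if i = 0 then m - 1 - t else if i = m then t else m - 1 - 2 * i

theorem sum_compNat {m i : ℕ} (hi : i < m) :
    ∑ j ∈ Finset.Ico (i + 1) (m + 1), (compNat m j : ℤ) = m - 1 - i := by
  rw [Finset.sum_Ico_succ_top (by omega), Finset.sum_congr rfl fun j hj => by
    rw [compNat, if_neg (by have := (Finset.mem_Ico.1 hj).1; omega),
      if_neg (Finset.mem_Ico.1 hj).2.ne]]
  rw [compNat, if_neg (by omega), if_pos rfl, Finset.sum_const, Nat.card_Ico, nsmul_eq_mul,
    Nat.cast_sub (by omega)]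
  push_cast; ring

theorem birkhoffDemand_eq {m i : ℕ} (hm : 1 ≤ m) (hi : i ≤ m) (t : ℤ) :
    ∑ j ∈ Finset.Ico (i + 1) (m + 1), (compNat m j : ℤ) - i * compNat m i -
      (compNat m i - 1) * t = birkhoffDemand m t i := by
  rcases hi.eq_or_lt with rfl | hi
  · have : i ≠ 0 := by omega
    simp [compNat, birkhoffDemand, this]
  · rw [sum_compNat hi, compNat, birkhoffDemand]
    rcases Nat.eq_zero_or_pos i with rfl | h0
    · simp
    · rw [if_neg h0.ne', if_neg h0.ne', if_neg hi.ne, if_neg hi.ne]; push_cast; ring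

theorem sum_mul_compNat {m : ℕ} : ∑ j ∈ Finset.range (m + 1), j * compNat m j = m * (m - 1) / 2 := by
  rw [Finset.sum_range_succ, ← Finset.sum_range_id]
  have h : m * compNat m m = 0 := by
    rcases Nat.eq_zero_or_pos m with rfl | h
    · simp
    · simp [compNat, h.ne']
  rw [h, add_zero]
  refine Finset.sum_congr rfl fun j hj => ?_
  rcases Nat.eq_zero_or_pos j with rfl | h
  · simp
  · rw [compNat, if_neg h.ne', if_neg (Finset.mem_range.1 hj).ne, mul_one]

theorem flowSeries_congr {Γ : Type*} [AddCommGroup Γ] [LinearOrder Γ] [IsOrderedAddMonoid Γ]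
    (v : ℕ → Γ) {c c' : ℕ → ℕ → ℕ} {r : ℕ} (h : ∀ i j, i < j → j < r → c i j = c' i j) :
    flowSeries v c r = flowSeries v c' r :=
  Finset.prod_congr rfl fun j hj => Finset.prod_congr rfl fun i hi => by
    rw [h i j (Finset.mem_range.1 hi) (Finset.mem_range.1 hj)]

/-- The sign from turning factors round is (-1)^(Σ j μ_j) = (-1)^(m(m-1)/2), which cancels the sign
in `hn`. The edge multiplicities are the sums μ_i + μ_j. -/
theorem hn_eq_flowSeries_coeff {m : ℕ} (hm : 1 ≤ m) (t : ℕ) :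
    hn (m + 1) t = (flowSeries (ev (m + 1)) (withSource (bPar m) (cPar m)) (m + 1)).coeff
      (∑ i ∈ Finset.range (m + 1), birkhoffDemand m t i • ev (m + 1) i) := by
  have hx : ∀ i, xv (m + 1) i ≠ 0 := fun i => xv_ne_zero i
  have hL : laurentExpansion (m + 1) (birkhoffTerm (m + 1) (comp21 (m + 1)) t) =
      (-1) ^ (m * (m - 1) / 2) * (mono (-∑ i ∈ Finset.range (m + 1),
        birkhoffDemand m t i • ev (m + 1) i) *
        flowSeries (ev (m + 1)) (withSource (bPar m) (cPar m)) (m + 1)) := by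
    rw [birkhoffTerm]
    simp only [map_div₀, map_prod, map_pow, map_zpow₀, map_sub, map_one, laurentExpansion_X]
    have hc : ∀ i : Fin (m + 1), comp21 (m + 1) i = compNat m i.val := fun i => rfl
    have hin : ∀ i : Fin (m + 1), ∏ j ∈ Finset.univ.erase i,
        (1 - xv (m + 1) j / xv (m + 1) i) ^ comp21 (m + 1) i =
        ∏ j ∈ (Finset.range (m + 1)).erase i.val,
          (1 - xv (m + 1) j / xv (m + 1) i) ^ compNat m i.val := by
      intro i
      refine prod_finset_fin _ _ (fun j => (1 - xv (m + 1) j / xv (m + 1) i) ^ compNat m i.val)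
        fun j => ?_
      rw [Finset.mem_erase, Finset.mem_range]
      constructor
      · rintro ⟨h1, h2⟩
        exact ⟨⟨j, h2⟩, by simpa [Fin.ext_iff] using h1, rfl⟩
      · rintro ⟨k, hk, rfl⟩
        exact ⟨by simpa [Fin.ext_iff] using hk, k.isLt⟩
    simp only [hin]
    simp only [hc]
    rw [prod_fin_eq_prod_range fun i => xv (m + 1) i ^ (((compNat m i : ℤ) - 1) * t) /
      ∏ j ∈ (Finset.range (m + 1)).erase i, (1 - xv (m + 1) j / xv (m + 1) i) ^ compNat m i,
      birkhoff_prod _ hx, sum_mul_compNat, mul_assoc, flowSeries_congr (c' := fun i j =>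
        compNat m i + compNat m j), flowSeries]
    · congr 2
      · rw [← Finset.sum_neg_distrib, mono_sum]
        refine Finset.prod_congr rfl fun i hi => ?_
        rw [birkhoffDemand_eq hm (Nat.lt_succ_iff.1 (Finset.mem_range.1 hi)), ← neg_smul,
          mono_zsmul]
        rfl
      · refine Finset.prod_congr rfl fun j _ => Finset.prod_congr rfl fun i _ => ?_
        rw [mono_sub]
        rfl
    · intro i j hij hj
      have hj0 : j ≠ 0 := by omega
      have him : i ≠ m := by omega
      simp only [withSource, bPar, cPar, compNat, if_neg hj0, if_neg him]
      split_ifs <;> rfl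
  rw [hn, constantTerm, hL, Nat.add_sub_cancel, show m + 1 - 2 = m - 1 by omega]
  have hF : (mono (-∑ i ∈ Finset.range (m + 1), birkhoffDemand m t i • ev (m + 1) i) *
        flowSeries (ev (m + 1)) (withSource (bPar m) (cPar m)) (m + 1)).coeff 0 =
      (flowSeries (ev (m + 1)) (withSource (bPar m) (cPar m)) (m + 1)).coeff
      (∑ i ∈ Finset.range (m + 1), birkhoffDemand m t i • ev (m + 1) i) := by
    rw [coeff_mono_mul, zero_sub, neg_neg]
  rw [← hF]
  rcases Nat.even_or_odd (m * (m - 1) / 2) with h | h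
  · simp [h.neg_one_pow]
  · simp [h.neg_one_pow]

theorem sum_birkhoffDemand {m k : ℕ} (hk : 1 ≤ k) (hkm : k ≤ m) (t : ℤ) :
    ∑ i ∈ Finset.Ico k (m + 1), birkhoffDemand m t i = t - k * (m - k) := by
  rw [Finset.sum_Ico_succ_top (by omega)]
  have h : ∀ M : ℕ, k ≤ M → ∑ i ∈ Finset.Ico k M, ((m : ℤ) - 1 - 2 * i) =
      (M - k) * (m - 1) - (M * (M - 1) - k * (k - 1)) := by
    intro M hM
    induction M, hM using Nat.le_induction with
    | base => simp
    | succ M hM ih => rw [Finset.sum_Ico_succ_top hM, ih]; push_cast; ring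
  rw [Finset.sum_congr rfl fun i hi => by
    rw [birkhoffDemand, if_neg (by have := (Finset.mem_Ico.1 hi).1; omega),
      if_neg (Finset.mem_Ico.1 hi).2.ne], h m hkm, birkhoffDemand, if_neg (by omega), if_pos rfl]
  ring

theorem sum_range_birkhoffDemand {m : ℕ} (hm : 1 ≤ m) (t : ℤ) :
    ∑ i ∈ Finset.range (m + 1), birkhoffDemand m t i = 0 := by
  rw [Finset.range_eq_Ico, Finset.sum_eq_sum_Ico_succ_bot (by omega),
    sum_birkhoffDemand le_rfl hm, birkhoffDemand, if_pos rfl]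
  push_cast; ring

theorem ev_independent {n r : ℕ} (p : ℕ) (q : ℕ → ℤ) (hp : p + r ≤ n)
    (h : ∑ i ∈ Finset.range r, q i • ev n (p + i) = 0) : ∀ i < r, q i = 0 := by
  have e : ∑ i ∈ Finset.Ico p (p + r), q (i - p) • ev n i = 0 := by
    rw [Finset.sum_Ico_eq_sum_range, Nat.add_sub_cancel_left]
    simpa using h
  intro i hi
  simpa using eq_zero_of_sum_ev_eq_zero
    (fun i hi => by rw [Finset.mem_Ico] at hi; omega) e (p + i)
    (Finset.mem_Ico.2 ⟨by omega, by omega⟩)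

/-- The demands add up to zero, so the weight of vertex 0 may be moved to 0, which sets the first
variable to 1. -/
theorem hn_eq_barH {m : ℕ} (hm : 1 ≤ m) (t : ℕ) :
    hn (m + 1) t = arrCT (xv (m + 1)) (xv (m + 1)) (Finset.Ico 1 (m + 1))
      (aPar m (m - 1) t) (bPar m) (cPar m) := by
  have hd : ∀ i ∈ Finset.Ico 1 (m + 1), demand (m + 1) (aPar m (m - 1) t) (cPar m) i =
      birkhoffDemand m t i := by
    intro i hi
    rw [Finset.mem_Ico] at hi
    rw [demand, birkhoffDemand, if_neg (by omega)]
    rcases (Nat.lt_succ_iff.1 hi.2).eq_or_lt with rfl | him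
    · simp [aPar]
    · rw [sum_cPar him, aPar, if_neg him.ne, if_neg him.ne]; ring
  have hs : ∑ i ∈ Finset.Ico 1 (m + 1), demand (m + 1) (aPar m (m - 1) t) (cPar m) i •
      ev (m + 1) i = ∑ i ∈ Finset.Ico 1 (m + 1), birkhoffDemand m t i • ev (m + 1) i :=
    Finset.sum_congr rfl fun i hi => by rw [hd i hi]
  rw [hn_eq_flowSeries_coeff hm, arrCT_eq_flowSeries_coeff, hs,
    flowSeries_baseV_coeff_eq (ev (m + 1)) le_rfl _ (fun i j hij hj => ev_lt_ev hij hj)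
      (fun q _ h => ev_independent (n := m + 1) (r := m + 1) 0 q (by omega) (by simpa using h)) _
      (sum_range_birkhoffDemand hm t)]

end BirkhoffTerm

/-! ### The leading coefficient -/

section LeadingCoefficient

/-- At A = t = 0 only nonnegative powers of x_m occur, so x_m may be set to 0. Each factor (x_i -
x_m)⁻¹ leaves x_i⁻¹, the source of the exponent -1. -/
theorem flowPolyCoeff_top_eq_arrCT {m : ℕ} (hm : 1 ≤ m) (A : ℕ) :
    flowPolyCoeff m A (m ^ 2) = arrCT (xv (m + 1)) (xv (m + 1)) (Finset.Ico 1 m) (fun _ => -1)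
      (fun _ => 3) (fun _ _ => 2) := by
  rw [flowPolyCoeff_top hm, arrCT, arrCT]
  set x := xv (m + 1) with hxdef
  have hx : ∀ i, x i ≠ 0 := fun i => xv_ne_zero i
  have h : (∏ i ∈ Finset.Ico 1 (m + 1), x i) *
      arrFn x (Finset.Ico 1 (m + 1)) (aPar m 0 0) (bPar m) (cPar m) =
      ((∏ i ∈ Finset.Ico 1 m, ((1 - mono (ev (m + 1) m - ev (m + 1) i)) ^ 1)⁻¹) *
        ((1 - x m) ^ 2)⁻¹) *
      ((∏ i ∈ Finset.Ico 1 m, x i) *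
        arrFn x (Finset.Ico 1 m) (fun _ => -1) (fun _ => 3) (fun _ _ => 2)) := by
    rw [arrFn, arrFn, ← Finset.prod_mul_distrib, Finset.prod_Ico_succ_top hm,
      ← Finset.prod_mul_distrib, mul_right_comm, ← Finset.prod_mul_distrib]
    congr 1
    · refine Finset.prod_congr rfl fun i hi => ?_
      rw [Finset.mem_Ico] at hi
      rw [filter_lt_Ico (by omega), filter_lt_Ico_one (by omega), rowFn, rowFn, aPar,
        if_neg hi.2.ne, bPar, if_neg hi.2.ne, Finset.prod_Ico_succ_top hi.2,
        Finset.prod_congr rfl fun j hj => by rw [cPar, if_neg (Finset.mem_Ico.1 hj).2.ne], cPar,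
        if_pos rfl, zpow_zero, pow_one, pow_one]
      have e : x i - x m = x i * (1 - mono (ev (m + 1) m - ev (m + 1) i)) := xv_sub_xv_eq i m
      rw [e, mul_inv, zpow_neg_one]
      generalize (∏ j ∈ Finset.Ico (i + 1) m, ((x i - x j) ^ 2)⁻¹ : LaurentField (m + 1)) = P
      field_simp [hx i]
    · rw [filter_lt_Ico (by omega), rowFn, aPar, if_pos rfl, bPar, if_pos rfl, Finset.Ico_self,
        Finset.prod_empty, mul_one, ← mul_assoc]
      simp [hx m]
  rw [h]
  have hw : ∀ j < m + 1, wt (m + 1) (Pi.single m 1) (ev (m + 1) j) =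
      (Pi.single m 1 : ℕ → ℤ) j := fun j hj => wt_ev _ hj
  have hwm := hw m (by omega)
  rw [Pi.single_eq_same] at hwm
  have hw0 : ∀ j ∈ Finset.Ico 1 m, wt (m + 1) (Pi.single m 1) (ev (m + 1) j) = 0 := by
    intro j hj
    rw [Finset.mem_Ico] at hj
    rw [hw j (by omega), Pi.single_eq_of_ne (by omega)]
  refine UnitGE.coeff_mul_zero (ℓ := wt (m + 1) (Pi.single m 1)) ((UnitGE.prod _ _ fun i hi =>
    unitGE_inv_one_sub_pow (sub_pos.2 (ev_lt_ev (Finset.mem_Ico.1 hi).2 (by omega))) ?_ 1).mul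
    (unitGE_inv_one_sub_pow (ev_pos (by omega)) hwm.ge 2))
    (suppGE_arrFn_xv (fun j hj => by rw [Finset.mem_Ico] at hj; omega) hw0 _ _ _)
  rw [map_sub, hwm, hw0 i hi, sub_zero]

theorem flowPolyCoeff_top_eq_morris {m : ℕ} (hm : 1 ≤ m) (A : ℕ) :
    flowPolyCoeff m A (m ^ 2) = constantTerm (morris m 1 1 2) := by
  rw [flowPolyCoeff_top_eq_arrCT hm, constantTerm_morris_one hm le_rfl,
    arrCT_xv_field (n := m + 1) (n' := m) (by omega) le_rfl]
  rfl

theorem flowPolyCoeff_top_pos {m : ℕ} (hm : 1 ≤ m) (A : ℕ) : 0 < flowPolyCoeff m A (m ^ 2) := by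
  rw [flowPolyCoeff_top_eq_arrCT hm, arrCT_eq_flowSeries_coeff]
  have h := posAt_flowSeries_baseV (n := m + 1) (r := m) (by omega)
    (withSource (fun _ => 3) fun _ _ => 2) (fun j => by simp [withSource])
    (fun i => 2 * (m - (i + 1)))
  convert h.2 using 3 with i hi
  rw [demand, ← natCast_zsmul]
  simp [mul_comm]

end LeadingCoefficient

/-! ### Factorization across a cut without net flow -/

section Splitting

variable {Γ : Type*} [AddCommGroup Γ] [LinearOrder Γ] [IsOrderedAddMonoid Γ]

theorem suppGE_flowSeries {ℓ : Γ →+ ℤ} (v : ℕ → Γ) (c : ℕ → ℕ → ℕ) {r : ℕ}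
    (hv : ∀ i j, i < j → j < r → v i < v j) (hℓ : ∀ i j, i < j → j < r → ℓ (v i) ≤ ℓ (v j)) :
    SuppGE ℓ 0 (flowSeries v c r) := by
  refine SuppGE.prod _ _ fun j hj => SuppGE.prod _ _ fun i hi => ?_
  rw [Finset.mem_range] at hi hj
  rw [← inv_pow]
  exact (suppGE_inv_one_sub (sub_pos.2 (hv i j hi hj))
    (by rw [map_sub]; exact sub_nonneg.2 (hℓ i j hi hj))).pow _

theorem flowSeries_add (v : ℕ → Γ) (c : ℕ → ℕ → ℕ) (p r : ℕ) :
    flowSeries v c (p + r) =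
      (∏ l ∈ Finset.range r, ∏ i ∈ Finset.range p, ((1 - mono (v (p + l) - v i)) ^ c i (p + l))⁻¹) *
      (flowSeries v c p * flowSeries (fun l => v (p + l)) (fun i j => c (p + i) (p + j)) r) := by
  rw [flowSeries, Finset.prod_range_add, flowSeries, flowSeries, mul_left_comm]
  congr 1
  rw [← Finset.prod_mul_distrib]
  exact Finset.prod_congr rfl fun l _ => Finset.prod_range_add _ _ _

/-- The support bound applies to both ℓ and -ℓ: a flow series involves only the variables of its own
vertices. -/
theorem apply_eq_zero_of_coeff_ne_zero {ℓ : Γ →+ ℤ} (v : ℕ → Γ) (c : ℕ → ℕ → ℕ) {r : ℕ}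
    (hv : ∀ i j, i < j → j < r → v i < v j) (hℓ : ∀ i < r, ℓ (v i) = 0) (q : ℕ → ℤ) {γ : Γ}
    (hγ : (mono (-∑ i ∈ Finset.range r, q i • v i) * flowSeries v c r).coeff γ ≠ 0) : ℓ γ = 0 := by
  have key : ∀ ℓ' : Γ →+ ℤ, (∀ i < r, ℓ' (v i) = 0) → 0 ≤ ℓ' γ := by
    intro ℓ' h
    refine SuppGE.mul_zero (suppGE_mono ?_) (suppGE_flowSeries v c hv fun i j hij hj => ?_) γ hγ
    · rw [map_neg, map_sum, Finset.sum_eq_zero fun i hi => by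
        rw [map_zsmul, h i (Finset.mem_range.1 hi), smul_zero], neg_zero]
    · rw [h i (hij.trans hj), h j hj]
  have h1 := key ℓ hℓ
  have h2 := key (-ℓ) fun i hi => by rw [AddMonoidHom.neg_apply, hℓ i hi, neg_zero]
  rw [AddMonoidHom.neg_apply] at h2
  omega

/-- Across a cut without net flow the flow series factors. -/
theorem flowSeries_coeff_split {n p r : ℕ} (hn : p + r ≤ n) (c : ℕ → ℕ → ℕ) (q : ℕ → ℤ)
    (hq : ∑ l ∈ Finset.range r, q (p + l) = 0) :
    (flowSeries (ev n) c (p + r)).coeff (∑ i ∈ Finset.range (p + r), q i • ev n i) =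
      (flowSeries (ev n) c p).coeff (∑ i ∈ Finset.range p, q i • ev n i) *
      (flowSeries (fun l => ev n (p + l)) (fun i j => c (p + i) (p + j)) r).coeff
        (∑ l ∈ Finset.range r, q (p + l) • ev n (p + l)) := by
  have hv1 : ∀ i j, i < j → j < p → ev n i < ev n j := fun i j hij hj => ev_lt_ev hij (by omega)
  have hv2 : ∀ i j, i < j → j < r → ev n (p + i) < ev n (p + j) := fun i j hij hj =>
    ev_lt_ev (by omega) (by omega)
  set f := mono (-∑ i ∈ Finset.range p, q i • ev n i) * flowSeries (ev n) c p with hf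
  set g := mono (-∑ l ∈ Finset.range r, q (p + l) • ev n (p + l)) *
    flowSeries (fun l => ev n (p + l)) (fun i j => c (p + i) (p + j)) r with hg
  have hf0 : f.coeff 0 = (flowSeries (ev n) c p).coeff (∑ i ∈ Finset.range p, q i • ev n i) := by
    rw [hf, coeff_mono_mul, zero_sub, neg_neg]
  have hg0 : g.coeff 0 = (flowSeries (fun l => ev n (p + l)) (fun i j => c (p + i) (p + j)) r).coeff
      (∑ l ∈ Finset.range r, q (p + l) • ev n (p + l)) := by
    rw [hg, coeff_mono_mul, zero_sub, neg_neg]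
  set S : ℕ → ℤ := fun i => if p ≤ i then 1 else 0 with hS
  have hS1 : ∀ i < p, wt n S (ev n i) = 0 := fun i hi => by
    rw [wt_ev S (by omega), hS]; exact if_neg (by omega)
  have hS2 : ∀ l < r, wt n S (ev n (p + l)) = 1 := fun l hl => by
    rw [wt_ev S (by omega), hS]; exact if_pos (by omega)
  -- `S` measures the net flow across the cut. It is positive on every crossing edge, so crossing
  -- edges contribute only their leading term 1.
  have hcross : UnitGE (wt n S) (∏ l ∈ Finset.range r, ∏ i ∈ Finset.range p,
      ((1 - mono (ev n (p + l) - ev n i)) ^ c i (p + l))⁻¹) := by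
    refine UnitGE.prod _ _ fun l hl => UnitGE.prod _ _ fun i hi => ?_
    rw [Finset.mem_range] at hl hi
    refine unitGE_inv_one_sub_pow (sub_pos.2 (ev_lt_ev (by omega) (by omega))) ?_ _
    rw [map_sub, hS1 i hi, hS2 l hl, sub_zero]
  have hfS : SuppGE (wt n S) 0 f := by
    refine SuppGE.mul_zero (suppGE_mono ?_) (suppGE_flowSeries _ c hv1 fun i j hij hj => ?_)
    · rw [map_neg, map_sum, Finset.sum_eq_zero fun i hi => by
        rw [map_zsmul, hS1 i (Finset.mem_range.1 hi), smul_zero], neg_zero]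
    · rw [hS1 i (hij.trans hj), hS1 j hj]
  have hgS : SuppGE (wt n S) 0 g := by
    refine SuppGE.mul_zero (suppGE_mono ?_) (suppGE_flowSeries _ _ hv2 fun i j hij hj => ?_)
    · rw [map_neg, map_sum, Finset.sum_congr rfl fun l hl => by
        rw [map_zsmul, hS2 l (Finset.mem_range.1 hl), smul_eq_mul, mul_one], hq, neg_zero]
    · rw [hS2 i (hij.trans hj), hS2 j hj]
  -- The two sides of the cut involve disjoint sets of variables, so their exponents cancel only at
  -- 0.
  have hfg : (f * g).coeff 0 = f.coeff 0 * g.coeff 0 := by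
    refine coeff_zero_mul_of_disjoint fun γ h1 h2 => ?_
    by_contra hγ
    obtain ⟨i, hi, hne⟩ := exists_apply_ne_zero hγ
    rcases lt_or_ge i p with hip | hip
    · have := apply_eq_zero_of_coeff_ne_zero (ℓ := wt n (Pi.single i 1)) _ _ hv2 (fun l hl => by
        rw [wt_ev _ (by omega), Pi.single_eq_of_ne (by omega)]) _ h2
      rw [map_neg, neg_eq_zero] at this
      exact hne this
    · exact hne (apply_eq_zero_of_coeff_ne_zero (ℓ := wt n (Pi.single i 1)) _ _ hv1 (fun l hl => by
        rw [wt_ev _ (by omega), Pi.single_eq_of_ne (by omega)]) _ h1)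
  rw [← hf0, ← hg0, ← hfg, ← hcross.coeff_mul_zero (hfS.mul_zero hgS), hf, hg, mul_mul_mul_comm,
    ← mono_add, ← neg_add, ← Finset.sum_range_add (fun i => q i • ev n i), mul_left_comm,
    ← flowSeries_add, coeff_mono_mul, zero_sub, neg_neg]

end Splitting

/-! ### Morris constant terms as flow counts on the two sides of the cut -/

section MorrisFlow

/-- The source multiplicity `k₃ + 1` is what remains after the first Morris variable has been set to
1, so k vertices suffice for k variables. -/
theorem constantTerm_morris_eq_source {n k k₁ : ℕ} (hkn : k ≤ n) (hk : 1 ≤ k) (hk₁ : 1 ≤ k₁)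
    (k₃ : ℕ) (q : ℕ → ℤ) (hq0 : ∑ i ∈ Finset.range k, q i = 0)
    (hq : ∀ i, 1 ≤ i → i < k → q i = k₃ * (k - 1 - i) + k₁ - 1) :
    (flowSeries (ev n) (withSource (fun _ => k₃ + 1) fun _ _ => k₃) k).coeff
      (∑ i ∈ Finset.range k, q i • ev n i) = constantTerm (morris k k₁ 1 k₃) := by
  rw [constantTerm_morris_one hk hk₁, arrCT_eq_flowSeries_coeff,
    ← flowSeries_baseV_coeff_eq (n := k) (ev n) le_rfl _
      (fun i j hij hj => ev_lt_ev hij (by omega))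
      (fun q _ h => ev_independent (n := n) (r := k) 0 q (by omega) (by simpa using h)) q hq0]
  congr 1
  refine Finset.sum_congr rfl fun i hi => ?_
  rw [Finset.mem_Ico] at hi
  rw [hq i hi.1 hi.2, demand, Finset.sum_const, Nat.card_Ico, nsmul_eq_mul, Nat.cast_sub (by omega)]
  congr 1
  push_cast; ring

theorem reflected_independent {k : ℕ} (q : ℕ → ℤ) (hq : ∑ i ∈ Finset.range (k + 1), q i = 0)
    (h : ∑ l ∈ Finset.range (k + 1), q l • (if l = k then 0 else -ev k (k - 1 - l)) = 0) :
    ∀ l < k + 1, q l = 0 := by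
  rw [Finset.sum_range_succ, if_pos rfl, zsmul_zero, add_zero, ← Finset.sum_range_reflect] at h
  have e : ∑ i ∈ Finset.range k, -q (k - 1 - i) • ev k i = 0 := by
    rw [← h]
    refine Finset.sum_congr rfl fun i hi => ?_
    rw [Finset.mem_range] at hi
    rw [if_neg (by omega), neg_smul, zsmul_neg, show k - 1 - (k - 1 - i) = i by omega]
  have h1 : ∀ l < k, q l = 0 := by
    intro l hl
    have := eq_zero_of_sum_ev_eq_zero (fun i hi => Finset.mem_range.1 hi) e (k - 1 - l)
      (Finset.mem_range.2 (by omega))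
    rw [show k - 1 - (k - 1 - l) = l by omega] at this
    omega
  intro l hl
  rcases (Nat.lt_succ_iff.1 hl).eq_or_lt with rfl | hl
  · rwa [Finset.sum_range_succ, Finset.sum_eq_zero fun i hi => h1 i (Finset.mem_range.1 hi),
      zero_add] at hq
  · exact h1 l hl

/-- Reversing all edges turns the sink into a source with weight 0, joined by simple edges to the k
other vertices; these carry the Morris variables in reversed order. -/
theorem constantTerm_morris_eq_sink {n p k : ℕ} (hn : p + (k + 1) ≤ n) (k₁ k₃ : ℕ) (q : ℕ → ℤ)
    (hq0 : ∑ l ∈ Finset.range (k + 1), q l = 0)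
    (hq : ∀ l < k, q l = -((k₃ : ℤ) * l + k₁ - 1)) :
    (flowSeries (fun l => ev n (p + l)) (fun _ j => if j = k then 1 else k₃) (k + 1)).coeff
      (∑ l ∈ Finset.range (k + 1), q l • ev n (p + l)) = constantTerm (morris k k₁ 1 k₃) := by
  rw [flowSeries_coeff_eq _ (fun l => if l = k then 0 else -ev k (k - 1 - l)) _ _
    (fun i j hij hj => ev_lt_ev (by omega) (by omega)) ?_
    (fun q _ h => ev_independent p q hn h) reflected_independent q hq0, constantTerm_morris, arrCT,
    arrFn, ← Finset.prod_mul_distrib]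
  · have hrow : ∀ i ∈ Finset.range k, xv k i * rowFn (xv k) i ((Finset.range k).filter (i < ·))
        (-(k₁ : ℤ)) 1 (fun _ => k₃) = mono (-((k₃ * (k - 1 - i) + k₁ - 1 : ℤ) • ev k i)) *
        (((1 - mono (ev k i)) ^ 1)⁻¹ *
          ∏ j ∈ Finset.Ico (i + 1) k, ((1 - mono (ev k j - ev k i)) ^ k₃)⁻¹) := by
      intro i hi
      rw [Finset.mem_range] at hi
      have hf : (Finset.range k).filter (i < ·) = Finset.Ico (i + 1) k := by
        ext j; simp only [Finset.mem_filter, Finset.mem_range, Finset.mem_Ico]; omega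
      rw [hf, xv_mul_rowFn (n := k) (r := k) (-(k₁ : ℤ)) 1 (fun _ _ => k₃), Finset.sum_const,
        Nat.card_Ico, nsmul_eq_mul, Nat.cast_sub (by omega)]
      congr 4
      push_cast; ring
    rw [Finset.prod_congr rfl hrow, Finset.prod_mul_distrib, ← mono_sum, Finset.sum_neg_distrib,
      coeff_mono_mul, zero_sub, neg_neg]
    congr 1
    · rw [flowSeries, Finset.prod_range_succ, Finset.prod_mul_distrib, mul_comm]
      congr 1
      · rw [← Finset.prod_range_reflect]
        refine Finset.prod_congr rfl fun i hi => ?_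
        rw [Finset.mem_range] at hi
        rw [if_pos rfl, if_pos rfl, if_neg (by omega), zero_sub, neg_neg,
          show k - 1 - (k - 1 - i) = i by omega]
      · rw [← Finset.prod_range_reflect]
        refine Finset.prod_congr rfl fun i hi => ?_
        rw [Finset.mem_range] at hi
        rw [Finset.prod_Ico_eq_prod_range, ← Finset.prod_range_reflect,
          show k - (i + 1) = k - 1 - i by omega]
        refine Finset.prod_congr rfl fun l hl => ?_
        rw [Finset.mem_range] at hl
        rw [if_neg (by omega), if_neg (by omega), if_neg (by omega), neg_sub_neg,
          show k - 1 - (k - 1 - i) = i by omega,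
          show k - 1 - (k - 1 - i - 1 - l) = i + 1 + l by omega]
    · rw [Finset.sum_range_succ, if_pos rfl, zsmul_zero, add_zero, ← Finset.sum_range_reflect]
      refine Finset.sum_congr rfl fun i hi => ?_
      rw [Finset.mem_range] at hi
      rw [if_neg (by omega), hq _ (by omega), zsmul_neg, neg_smul, neg_neg,
        show k - 1 - (k - 1 - i) = i by omega, Nat.cast_sub (by omega), Nat.cast_sub (by omega)]
      rfl
  · intro i j hij hj
    rw [if_neg (by omega)]
    rcases (Nat.lt_succ_iff.1 hj).eq_or_lt with rfl | hj
    · rw [if_pos rfl, neg_lt_zero]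
      exact ev_pos (by omega)
    · rw [if_neg hj.ne, neg_lt_neg_iff]
      exact ev_lt_ev (by omega) (by omega)

end MorrisFlow

/-! ### Vanishing below N and the value at N -/

section Values

/-- The vertices k, …, m would need a negative net inflow, but all edges lead upwards. -/
theorem hn_eq_zero {m k t : ℕ} (hk : 1 ≤ k) (hkm : k ≤ m) (ht : t < k * (m - k)) :
    hn (m + 1) t = 0 := by
  rw [hn_eq_flowSeries_coeff (hk.trans hkm)]
  set S : ℕ → ℤ := fun i => if k ≤ i then 1 else 0 with hS
  have hw : ∀ i < m + 1, wt (m + 1) S (ev (m + 1) i) = S i := fun i hi => wt_ev S hi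
  refine (suppGE_flowSeries (ℓ := wt (m + 1) S) _ _ (fun i j hij hj => ev_lt_ev hij hj)
    fun i j hij hj => ?_).coeff_eq_zero ?_
  · rw [hw i (by omega), hw j hj, hS]
    dsimp only
    split_ifs <;> omega
  · have h : wt (m + 1) S (∑ i ∈ Finset.range (m + 1), birkhoffDemand m t i • ev (m + 1) i) =
        t - k * (m - k) := by
      rw [← sum_birkhoffDemand hk hkm, map_sum, Finset.range_eq_Ico,
        ← Finset.sum_Ico_consecutive _ (Nat.zero_le k) (by omega : k ≤ m + 1),
        Finset.sum_eq_zero, zero_add]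
      · refine Finset.sum_congr rfl fun i hi => ?_
        rw [Finset.mem_Ico] at hi
        rw [map_zsmul, hw i hi.2, hS]
        simp [hi.1]
      · intro i hi
        rw [Finset.mem_Ico] at hi
        rw [map_zsmul, hw i (by omega), hS]
        simp [hi.2]
    rw [h, sub_neg]
    have := Nat.cast_sub (R := ℤ) hkm
    rw [← this]
    exact_mod_cast ht

theorem flowSeries_coeff_source {m k p : ℕ} (hk : m = k + p) (hkp : k ≤ p) (hp : 1 ≤ p) :
    (flowSeries (ev (m + 1)) (withSource (bPar m) (cPar m)) k).coeff
      (∑ i ∈ Finset.range k, birkhoffDemand m ((k * p : ℕ) : ℤ) i • ev (m + 1) i) =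
      constantTerm (morris k (2 + (p - k)) 1 2) := by
  rcases Nat.eq_zero_or_pos k with rfl | h0
  · simp [flowSeries, constantTerm, morris]
  rw [← constantTerm_morris_eq_source (n := m + 1) (by omega) h0 (by omega) 2
    (birkhoffDemand m ((k * p : ℕ) : ℤ))]
  · congr 1
    refine flowSeries_congr _ fun i j hij hj => ?_
    simp only [withSource, bPar, cPar, if_neg (by omega : j ≠ m)]
  · have h1 := sum_range_birkhoffDemand (m := m) (by omega) ((k * p : ℕ) : ℤ)
    have h2 := sum_birkhoffDemand (m := m) (k := k) h0 (by omega) ((k * p : ℕ) : ℤ)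
    rw [Finset.range_eq_Ico, ← Finset.sum_Ico_consecutive _ (Nat.zero_le k)
      (by omega : k ≤ m + 1), h2, hk] at h1
    rw [hk, Finset.range_eq_Ico]
    push_cast at h1 ⊢
    linarith
  · intro i hi hik
    rw [birkhoffDemand, if_neg (by omega), if_neg (by omega), hk]
    push_cast [hkp]
    ring

theorem flowSeries_coeff_sink {m k p : ℕ} (hk : m = k + p) (hkp : k ≤ p) (hp : 1 ≤ p) :
    (flowSeries (fun l => ev (m + 1) (p + l))
        (fun i j => withSource (bPar m) (cPar m) (p + i) (p + j)) (k + 1)).coeff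
      (∑ l ∈ Finset.range (k + 1), birkhoffDemand m ((k * p : ℕ) : ℤ) (p + l) •
        ev (m + 1) (p + l)) =
      constantTerm (morris k (2 + (p - k)) 1 2) := by
  rw [← constantTerm_morris_eq_sink (n := m + 1) (p := p) (by omega) _ 2
    (fun l => birkhoffDemand m ((k * p : ℕ) : ℤ) (p + l))]
  · congr 1
    refine flowSeries_congr _ fun i j hij hj => ?_
    simp only [withSource, cPar, if_neg (by omega : p + i ≠ 0)]
    exact if_congr (by omega) rfl rfl
  · have h := sum_birkhoffDemand (m := m) (k := p) hp (by omega) ((k * p : ℕ) : ℤ)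
    rw [Finset.sum_Ico_eq_sum_range, show m + 1 - p = k + 1 by omega] at h
    rw [h, hk]
    push_cast; ring
  · intro l hl
    rw [birkhoffDemand, if_neg (by omega), if_neg (by omega), hk]
    push_cast [hkp]
    ring

theorem hn_eq_morris_sq {m k p : ℕ} (hk : m = k + p) (hkp : k ≤ p) (hp : p ≤ k + 1)
    (hp1 : 1 ≤ p) :
    hn (m + 1) (k * p) = constantTerm (morris k (2 + (p - k)) 1 2) ^ 2 := by
  have hsum := sum_birkhoffDemand (m := m) (k := p) hp1 (by omega) ((k * p : ℕ) : ℤ)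
  rw [Finset.sum_Ico_eq_sum_range, show m + 1 - p = k + 1 by omega] at hsum
  have hsum0 : ∑ l ∈ Finset.range (k + 1), birkhoffDemand m ((k * p : ℕ) : ℤ) (p + l) = 0 := by
    rw [hsum, hk]; push_cast; ring
  rw [hn_eq_flowSeries_coeff (by omega)]
  have hm : m + 1 = p + (k + 1) := by omega
  have hs := flowSeries_coeff_split (n := m + 1) (p := p) (r := k + 1) (by omega)
    (withSource (bPar m) (cPar m)) _ hsum0
  rw [← hm] at hs
  rw [hs, flowSeries_coeff_sink hk hkp hp1, sq]
  congr 1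
  rcases hkp.eq_or_lt with rfl | hlt
  · exact flowSeries_coeff_source hk le_rfl hp1
  · obtain rfl : p = k + 1 := by omega
    -- For odd m the middle vertex k has zero demand, so a second cut just before it splits it off
    -- with count 1. If k = 0, it is the source itself.
    have hd : birkhoffDemand m ((k * (k + 1) : ℕ) : ℤ) k = 0 := by
      rw [birkhoffDemand]
      split_ifs with h1 h2
      · subst h1; rw [hk]; simp
      · omega
      · rw [hk]; push_cast; ring
    rw [flowSeries_coeff_split (n := m + 1) (p := k) (r := 1) (by omega) _ _ (by simpa using hd),
      flowSeries_coeff_source hk hkp hp1]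
    rw [Finset.sum_range_one, add_zero, hd, zero_smul, flowSeries, Finset.prod_range_one,
      Finset.range_zero, Finset.prod_empty, HahnSeries.coeff_one, if_pos rfl, mul_one]

end Values

/-! ### Zeros, reciprocity at all arguments, and assembly -/

section FinalProof

theorem flowPoly_eval_natCast {m : ℕ} (hm : 1 ≤ m) (t : ℕ) :
    (flowPoly m (m - 1)).eval (t : ℚ) = hn (m + 1) t := by
  have hs : ∀ j ∈ Finset.Ico 1 (m + 1), 0 < j ∧ j < m + 1 := fun j hj => by
    rw [Finset.mem_Ico] at hj; omega
  have h1 := arrCT_uv_eq_eval hm (m - 1) t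
  rw [Int.cast_natCast, Nat.cast_sub hm, Nat.cast_one] at h1
  rw [hn_eq_barH hm, ← h1]
  exact (arrCT_xv_eq_uv _ hs _ _ _ (aPar_admissible le_rfl (by positivity))).symm

theorem flowPoly_reciprocity {m : ℕ} (hm : 1 ≤ m) (t : ℚ) :
    (flowPoly m (m - 1)).eval t = (-1) ^ m * (flowPoly m (m - 1)).eval (-t - (m + 1)) := by
  have h : flowPoly m (m - 1) = Polynomial.C ((-1) ^ m) * (flowPoly m (m - 1)).comp
      (-Polynomial.X - Polynomial.C ((m : ℚ) + 1)) := by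
    refine Polynomial.eq_of_infinite_eval_eq _ _ (Set.Infinite.mono ?_
      (Set.infinite_range_of_injective (Nat.cast_injective (R := ℚ))))
    rintro _ ⟨t, rfl⟩
    change Polynomial.eval _ _ = Polynomial.eval _ _
    rw [flowPoly_reciprocity_natCast hm, Polynomial.eval_mul, Polynomial.eval_C,
      Polynomial.eval_comp]
    simp
  have := congrArg (Polynomial.eval t) h
  rw [Polynomial.eval_mul, Polynomial.eval_C, Polynomial.eval_comp] at this
  simpa using this

/-- Three ranges: the cut gives 0 ≤ i < kp, the degree bound gives -m ≤ i < 0, and reciprocity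
reflects the first range below -m. -/
theorem flowPoly_eval_eq_zero {m k p : ℕ} (hk : m = k + p) (hp : 1 ≤ p) {i : ℤ}
    (h1 : -((k * p : ℕ) : ℤ) - m ≤ i) (h2 : i < (k * p : ℕ)) :
    (flowPoly m (m - 1)).eval (i : ℚ) = 0 := by
  have hm : 1 ≤ m := by omega
  have hnn : ∀ t : ℕ, t < k * p → (flowPoly m (m - 1)).eval (t : ℚ) = 0 := by
    intro t ht
    have h0 : 1 ≤ k := Nat.pos_of_ne_zero fun h => by simp [h] at ht
    rw [flowPoly_eval_natCast hm, hn_eq_zero h0 (by omega)]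
    rwa [hk, Nat.add_sub_cancel_left]
  rcases le_or_gt 0 i with hi | hi
  · lift i to ℕ using hi
    rw [Int.cast_natCast]
    exact hnn i (by exact_mod_cast h2)
  rcases le_or_gt (-(m : ℤ)) i with him | him
  · obtain ⟨j, rfl⟩ : ∃ j : ℕ, i = -j := ⟨i.natAbs, by omega⟩
    rw [Int.cast_neg, Int.cast_natCast]
    refine flowPoly_eval_neg hm ?_ (by omega) (by omega)
    obtain ⟨l, rfl⟩ : ∃ l, m = l + 1 := ⟨m - 1, by omega⟩
    rw [Nat.add_sub_cancel]
    nlinarith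
  · obtain ⟨j, hj⟩ : ∃ j : ℕ, -i - (m + 1) = j := ⟨(-i - (m + 1)).toNat, by omega⟩
    have hj' : -(i : ℚ) - (m + 1) = j := by exact_mod_cast congrArg (Int.cast (R := ℚ)) hj
    rw [flowPoly_reciprocity hm, hj', hnn j (by omega), mul_zero]

theorem exists_eq_mul_prod_of_roots {h : Polynomial ℚ} (s : Finset ℤ)
    (hs : ∀ i ∈ s, h.eval (i : ℚ) = 0) :
    ∃ P : Polynomial ℚ, h = P * ∏ i ∈ s, (Polynomial.X - Polynomial.C (i : ℚ)) := by
  have hd : (∏ i ∈ s, (Polynomial.X - Polynomial.C (i : ℚ))) ∣ h := by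
    refine Finset.prod_dvd_of_coprime (fun i _ j _ hij => ?_) fun i hi =>
      Polynomial.dvd_iff_isRoot.2 (hs i hi)
    exact Polynomial.isCoprime_X_sub_C_of_isUnit_sub
      (sub_ne_zero.2 (Int.cast_injective.ne hij)).isUnit
  obtain ⟨P, hP⟩ := hd
  exact ⟨P, hP.trans (mul_comm _ _)⟩

end FinalProof

theorem theorem1p3 (n : ℕ) (h2 : 2 ≤ n) (N : ℕ) (hN : N = (n - 1) ^ 2 / 4) :
    (∀ t : ℕ, hn n t = constantTerm (barH n h2 t)) ∧
    ∃ h : Polynomial ℚ,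
      (∀ t : ℕ, h.eval (t : ℚ) = hn n t) ∧
      (h.degree = ((n - 1) ^ 2 : ℕ) ∧
        h.leadingCoeff = constantTerm (morris (n - 1) 1 1 2) / (((n - 1) ^ 2).factorial : ℚ)) ∧
      (∀ t : ℚ, h.eval t = (-1) ^ (n - 1) * h.eval (-t - n)) ∧
      (∃ P : Polynomial ℚ, P.degree = ((n - 1) * (n - 2) - 2 * N : ℕ) ∧
        h = P * ∏ i ∈ Finset.Icc (-(N : ℤ) - n + 1) ((N : ℤ) - 1),
          (Polynomial.X - Polynomial.C (i : ℚ))) ∧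
      h.eval (N : ℚ) =
        constantTerm (morris ((n - 1) / 2) (2 + if Even n then 1 else 0) 1 2) ^ 2 := by
  obtain ⟨m, rfl⟩ : ∃ m, n = m + 1 := ⟨n - 1, by omega⟩
  have hm : 1 ≤ m := by omega
  rw [Nat.add_sub_cancel] at hN ⊢
  -- The middle cut maximizes k(m - k), and the maximum is N = ⌊m²/4⌋ = kp.
  obtain ⟨k, p, hk, hkp, hpk⟩ : ∃ k p, m = k + p ∧ k ≤ p ∧ p ≤ k + 1 :=
    ⟨m / 2, m - m / 2, by omega, by omega, by omega⟩
  have hp : 1 ≤ p := by omega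
  have hNk : N = k * p := by
    rw [hN, hk]
    obtain rfl | rfl : p = k ∨ p = k + 1 := by omega
    · rw [show (p + p) ^ 2 = p * p * 4 by ring, Nat.mul_div_cancel _ (by norm_num)]
    · rw [show (k + (k + 1)) ^ 2 = 1 + k * (k + 1) * 4 by ring,
        Nat.add_mul_div_right _ _ (by norm_num)]
      simp
  have hdeg := degree_flowPoly (flowPolyCoeff_top_pos hm (m - 1)).ne'
  rw [flowPolyCoeff_top_eq_morris hm] at hdeg
  refine ⟨fun t => by rw [constantTerm_barH hm, hn_eq_barH hm], flowPoly m (m - 1),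
    flowPoly_eval_natCast hm, hdeg, fun t => ?_, ?_, ?_⟩
  · rw [flowPoly_reciprocity hm t]; push_cast; rfl
  · obtain ⟨P, hP⟩ := exists_eq_mul_prod_of_roots (h := flowPoly m (m - 1))
      (Finset.Icc (-(N : ℤ) - (m + 1 : ℕ) + 1) ((N : ℤ) - 1)) fun i hi => by
        rw [Finset.mem_Icc] at hi
        refine flowPoly_eval_eq_zero hk hp ?_ ?_ <;> rw [← hNk] <;> push_cast at hi ⊢ <;> omega
    refine ⟨P, ?_, hP⟩
    have h0 : P ≠ 0 := by
      rintro rfl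
      rw [hP, zero_mul, Polynomial.degree_zero] at hdeg
      exact WithBot.bot_ne_coe hdeg.1
    have h := congrArg Polynomial.natDegree hP
    rw [Polynomial.natDegree_eq_of_degree_eq_some hdeg.1, Polynomial.natDegree_mul h0
      (Polynomial.monic_prod_of_monic _ _ fun i _ => Polynomial.monic_X_sub_C _).ne_zero,
      Polynomial.natDegree_prod_of_monic _ _ fun i _ => Polynomial.monic_X_sub_C _] at h
    simp only [Polynomial.natDegree_X_sub_C, Finset.sum_const, smul_eq_mul, mul_one,
      Int.card_Icc] at h
    -- There are 2N + m linear factors, so m² = deg P + 2N + m.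
    rw [show (N : ℤ) - 1 + 1 - (-(N : ℤ) - (m + 1 : ℕ) + 1) = (2 * N + m : ℕ) by push_cast; ring,
      Int.toNat_natCast] at h
    rw [Polynomial.degree_eq_natDegree h0, show m + 1 - 2 = m - 1 by omega, Nat.mul_sub, mul_one,
      ← sq, h]
    congr 1
    omega
  · rw [flowPoly_eval_natCast hm, hNk, hn_eq_morris_sq hk hkp hpk hp, show m / 2 = k by omega]
    congr 4
    split_ifs with h <;> rw [Nat.even_iff] at h <;> omega
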